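/- **Notation.** Let $G=SL(2,\mathbb R)$, $J(g,z)=cz+d$ for $g=\begin{pmatrix}a&b\\c&d\end{pmatrix}\in G$, and let $\widetilde G=\{(g,\theta)\in G\times\mathbb R\mid J(g,i)e^{i\theta}=|J(g,i)|\}$ be the universal covering group of $G$, with product $(g_1,\theta_1)(g_2,\theta_2)=\bigl(g_1g_2,\theta_1+\theta_2-\arg\frac{J(g_1,g_2i)}{J(g_1,i)}\bigr)$. For $x,\theta\in\mathbb R$ and $y>0$ put $\tilde u(x)=\bigl(\begin{pmatrix}1&x\\0&1\end{pmatrix},0\bigr)$, $\tilde a(y)=(\mathrm{diag}(\sqrt y,1/\sqrt y),0)$, $\tilde k(\theta)=\bigl(\begin{pmatrix}\cos\theta&\sin\theta\\-\sin\theta&\cos\theta\end{pmatrix},\theta\bigr)$, $\tilde w=\tilde k(-\pi/2)$. Let $\rho$ be right translation of functions on $\widetilde G$, and also the derived action of $\mathcal U(\mathfrak{sl}(2,\mathbb C))$ on smooth functions. For $\mu,\nu\in\mathbb C$ let $I^\infty_{\mu,\nu}$ be the space of smooth $F:\widetilde G\to\mathbb C$ with $F(\tilde u(x)\tilde a(y)\tilde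 k(m\pi)g)=e^{\pi mi\mu}y^{\nu+1/2}F(g)$ ($x\in\mathbb R$, $y>0$, $m\in\mathbb Z$, $g\in\widetilde G$), topologized by the seminorms $F\mapsto\sup_{-\pi\le\theta<\pi}|(\rho(X)F)(\tilde k(\theta))|$, $X\in\mathcal U(\mathfrak{sl}(2,\mathbb C))$. Let $I^{-\infty}_{\mu,\nu}$ be the space of continuous linear functionals on $I^\infty_{\mu,\nu}$. Put $F_\infty=e^{\pi i\mu/2}\rho(\tilde w)F$. A shifted lattice is a set $L=u_1+u_2\mathbb Z$ with $u_1\in\mathbb R$, $u_2\in\mathbb R\setminus\{0\}$; put $L^\vee=u_2^{-1}\mathbb Z$ and $\omega_L(t)=e^{2\pi ilt}$ for $t\in L^\vee$ and any $l\in L$. Let $$(I^{-\infty}_{\mu,\nu})_L=\{\lambda\in I^{-\infty}_{\mu,\nu}\mid\lambda(\rho(\tilde u(t))F)=\omega_L(t)\lambda(F)\ (t\in L^\vee,\ F\in I^\infty_{\mu,\nu})\}.$$ Let $\mathfrak M(L)$ be the space of $\alpha:L\to\mathbb C$ with $\alpha(l)=O(|l|^r)$ as $|l|\to\infty$ for some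 $r\in\mathbb R$, and, for $S\subset\mathbb Z_{\ge0}$, let $\mathfrak N(S)$ be the space of finitely supported $\beta:\mathbb Z_{\ge0}\to\mathbb C$ vanishing outside $S$. Let $\mathfrak M(L)^0_{\mu,\nu}$ be the set of $\alpha\in\mathfrak M(L)$ such that $\alpha(0)=0$ if $0\in L$, $-2\nu\in\mathbb Z_{>0}$ and $\mu-2\nu-1\notin2\mathbb Z$. Let $S_\nu(L)=\emptyset$ if $0\notin L$ and $S_\nu(L)=\{0,-2\nu\}\cap\mathbb Z_{\ge0}$ if $0\in L$. For $f\in C_0^\infty(\mathbb R)$ let $\mathcal F(f)(y)=\int_{\mathbb R}f(x)e^{2\pi ixy}\,dx$, with the same formula for integrable $f$, and $f_{\mu,\nu,\infty}(x)=e^{-\mathrm{sgn}(x)\pi i\mu/2}|x|^{-2\nu-1}f(-1/x)$ for $x\ne0$. As a function of $\nu$, $\mathcal F(f_{\mu,\nu,\infty})(y)$, defined for $\mathrm{Re}\,\nu>0$, has a meromorphic continuation to $\mathbb C$, which is holomorphic at $\nu$ unless $y=0$ and $-2\nu\in\mathbb Z_{\ge0}$. Let $\mathcal F_{\mu,\nu,\infty}(f)(y)$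 be its value at $\nu$, except that, if $y=0$ and $-2\nu=n\in\mathbb Z_{\ge0}$, $$\mathcal F_{\mu,\nu,\infty}(f)(0)=\lim_{s\to-n/2}\Bigl(\mathcal F(f_{\mu,s,\infty})(0)-i^n\frac{2\cos(\pi(n+\mu)/2)}{n!\,(2s+n)}(-1)^nf^{(n)}(0)\Bigr).$$ For $f\in C_0^\infty(\mathbb R)$ let $\iota_{\mu,\nu}(f)\in I^\infty_{\mu,\nu}$ be the function with $\iota_{\mu,\nu}(f)(\tilde w\tilde u(-x))=f(x)$ ($x\in\mathbb R$), extended by zero outside the big Bruhat cell. Every $F\in I^\infty_{\mu,\nu}$ can be written as $F=\iota_{\mu,\nu}(f_1)+(\iota_{\mu,\nu}(f_2))_\infty$ with $f_1,f_2\in C_0^\infty(\mathbb R)$, and the Jacquet integral $\mathcal J_l(F)=\mathcal F(f_1)(l)+\mathcal F_{\mu,\nu,\infty}(f_2)(l)$ ($l\in\mathbb R$) does not depend on the choice of $f_1,f_2$. For $m\in\mathbb Z_{\ge0}$ let $\delta^{(m)}_\infty(F)=(\rho(E_+)^mF_\infty)(\tilde w)$ with $E_+=\begin{pmatrix}0&1\\0&0\end{pmatrix}$.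 For $\alpha\in\mathfrak M(L)$ and $\beta\in\mathfrak N(\mathbb Z_{\ge0})$ put $$\lambda_{\alpha,\beta}(F)=\sum_{l\in L}\alpha(l)\mathcal J_l(F)+\sum_{m=0}^\infty\beta(m)\delta^{(m)}_\infty(F)\qquad(F\in I^\infty_{\mu,\nu}).$$ **Proposition.** Let $L$ be a shifted lattice in $\mathbb R$, $\mu,\nu\in\mathbb C$, $\alpha\in\mathfrak M(L)$ and $\beta\in\mathfrak N(\mathbb Z_{\ge0})$. Then the series over $L$ defining $\lambda_{\alpha,\beta}(F)$ converges absolutely for every $F\in I^\infty_{\mu,\nu}$, and $\lambda_{\alpha,\beta}\in(I^{-\infty}_{\mu,\nu})_L$ if and only if $\alpha\in\mathfrak M(L)^0_{\mu,\nu}$ and $\beta\in\mathfrak N(S_\nu(L))$. -/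

import Mathlib

open scoped MatrixGroups ContDiff Topology
open MeasureTheory Filter

noncomputable section

namespace AutoDist

/-! ### The universal covering group of `SL(2, ℝ)` -/

/-- The automorphy factor `J(g, z) = c z + d`. -/
def J (g : SL(2, ℝ)) (z : ℂ) : ℂ := UpperHalfPlane.denom (g : GL (Fin 2) ℝ) z

theorem J_apply (g : SL(2, ℝ)) (z : ℂ) : J g z = ((g 1 0 : ℝ) : ℂ) * z + ((g 1 1 : ℝ) : ℂ) := rfl

theorem J_ne_zero (g : SL(2, ℝ)) (z : UpperHalfPlane) : J g z ≠ 0 :=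
  UpperHalfPlane.denom_ne_zero _ z

theorem coe_smul (g : SL(2, ℝ)) (z : UpperHalfPlane) :
    ((g • z : UpperHalfPlane) : ℂ)
      = (((g 0 0 : ℝ) : ℂ) * z + ((g 0 1 : ℝ) : ℂ)) / J g z := by
  rw [UpperHalfPlane.specialLinearGroup_apply]
  rfl

theorem J_mul (g h : SL(2, ℝ)) (z : UpperHalfPlane) :
    J (g * h) z = J g ((h • z : UpperHalfPlane) : ℂ) * J h z := by
  have hz := J_ne_zero h z
  rw [J_apply g, coe_smul, J_apply (g * h)]
  field_simp
  rw [J_apply]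
  simp [Matrix.mul_apply, Fin.sum_univ_two]
  ring

theorem J_one (z : ℂ) : J 1 z = 1 := by simp [J_apply]

theorem continuous_J (g : SL(2, ℝ)) : Continuous (J g) := by
  unfold J UpperHalfPlane.denom
  fun_prop

theorem arg_J_div (g : SL(2, ℝ)) (z w : UpperHalfPlane) :
    (J g z / J g w).arg = (J g z).arg - (J g w).arg := by
  have hz := J_ne_zero g z
  have hw := J_ne_zero g w
  have key : (((J g z / J g w).arg : ℝ) : Real.Angle)
      = (((J g z).arg - (J g w).arg : ℝ) : Real.Angle) := by
    rw [Complex.arg_div_coe_angle hz hw, Real.Angle.coe_sub]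
  have h2 : (J g z).arg - (J g w).arg ∈ Set.Ioc (-Real.pi) Real.pi := by
    have hzi := z.im_pos
    have hwi := w.im_pos
    have e1 : (J g z).im = g 1 0 * z.im := by simp [J_apply]
    have e2 : (J g w).im = g 1 0 * w.im := by simp [J_apply]
    have a1 := Complex.arg_le_pi (J g z)
    have a2 := Complex.arg_le_pi (J g w)
    have b1 := Complex.neg_pi_lt_arg (J g z)
    have b2 := Complex.neg_pi_lt_arg (J g w)
    have hpi := Real.pi_pos
    rcases lt_trichotomy (g 1 0) 0 with h | h | h
    · have c1 : (J g z).arg < 0 := Complex.arg_neg_iff.2 (by rw [e1]; exact mul_neg_of_neg_of_pos h hzi)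
      have c2 : (J g w).arg < 0 := Complex.arg_neg_iff.2 (by rw [e2]; exact mul_neg_of_neg_of_pos h hwi)
      constructor <;> linarith
    · have : J g z = J g w := by simp [J_apply, h]
      rw [this]
      constructor <;> linarith
    · have c1 : 0 ≤ (J g z).arg := Complex.arg_nonneg_iff.2 (by rw [e1]; positivity)
      have c2 : (J g w).arg ≠ Real.pi := by
        intro hh
        rw [Complex.arg_eq_pi_iff] at hh
        rw [e2] at hh
        have := mul_pos h hwi
        linarith [hh.2]
      have c2' := lt_of_le_of_ne a2 c2
      have c3 : 0 ≤ (J g w).arg := Complex.arg_nonneg_iff.2 (by rw [e2]; positivity)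
      constructor <;> linarith
  have h1 := Complex.arg_mem_Ioc (J g z / J g w)
  have := (Real.Angle.toReal_coe_eq_self_iff_mem_Ioc).2 h1
  rw [← this, key, (Real.Angle.toReal_coe_eq_self_iff_mem_Ioc).2 h2]

theorem div_mem_slitPlane (g : SL(2, ℝ)) (z : UpperHalfPlane) (w : UpperHalfPlane) :
    J g z / J g w ∈ Complex.slitPlane := by
  rw [Complex.mem_slitPlane_iff_arg]
  refine ⟨?_, div_ne_zero (J_ne_zero g z) (J_ne_zero g _)⟩
  intro hh
  rw [Complex.arg_eq_pi_iff] at hh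
  have hI := J_ne_zero g w
  have e : J g z = ((J g z / J g w).re : ℂ) * J g w := by
    have : J g z / J g w = ((J g z / J g w).re : ℂ) := by
      exact Complex.ext rfl (by rw [hh.2, Complex.ofReal_im])
    rw [← this]; field_simp
  set r := (J g z / J g w).re
  have him := congrArg Complex.im e
  have hre := congrArg Complex.re e
  simp [J_apply] at him hre
  have hzi := z.im_pos
  have hwi := w.im_pos
  by_cases hc0 : g 1 0 = 0
  · rw [hc0] at hre
    have hd : g 1 1 ≠ 0 := by
      intro h; apply hI; simp [J_apply, hc0, h]
    have : r = 1 := by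
      have : (r - 1) * g 1 1 = 0 := by linarith
      rcases mul_eq_zero.1 this with h | h
      · linarith
      · exact absurd h hd
    linarith [hh.1]
  · have : z.im = r * w.im := by
      have : g 1 0 * (z.im - r * w.im) = 0 := by linarith
      rcases mul_eq_zero.1 this with h | h
      · exact absurd h hc0
      · linarith
    nlinarith [hh.1]

theorem continuous_arg_J (g : SL(2, ℝ)) :
    Continuous fun z : UpperHalfPlane => (J g z).arg := by
  have : (fun z : UpperHalfPlane => (J g z).arg)
      = fun z : UpperHalfPlane => (J g z / J g UpperHalfPlane.I).arg + (J g UpperHalfPlane.I).arg := by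
    funext z
    rw [arg_J_div]
    ring
  rw [this]
  refine Continuous.add ?_ continuous_const
  rw [continuous_iff_continuousAt]
  intro z
  have hc : ContinuousAt (fun z : UpperHalfPlane => J g z / J g UpperHalfPlane.I) z :=
    (((continuous_J g).comp UpperHalfPlane.continuous_coe).div_const _).continuousAt
  exact ContinuousAt.comp (g := Complex.arg) (Complex.continuousAt_arg
    (div_mem_slitPlane g z UpperHalfPlane.I)) hc

theorem continuous_smul_SL (h : SL(2, ℝ)) :
    Continuous fun z : UpperHalfPlane => (h • z : UpperHalfPlane) :=
  continuous_const_smul (T := UpperHalfPlane) (h : GL (Fin 2) ℝ)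

theorem arg_cocycle (g h : SL(2, ℝ)) (z w : UpperHalfPlane) :
    (J (g * h) z).arg - (J g ((h • z : UpperHalfPlane) : ℂ)).arg - (J h z).arg
      = (J (g * h) w).arg - (J g ((h • w : UpperHalfPlane) : ℂ)).arg - (J h w).arg := by
  have hgh : Continuous fun z : UpperHalfPlane => (J g ((h • z : UpperHalfPlane) : ℂ)).arg :=
    Continuous.comp (g := fun z : UpperHalfPlane => (J g z).arg) (continuous_arg_J g)
      (continuous_smul_SL h)
  have hcont : Continuous fun z : UpperHalfPlane =>
      (J (g * h) z).arg - (J g ((h • z : UpperHalfPlane) : ℂ)).arg - (J h z).arg :=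
    ((continuous_arg_J _).sub hgh).sub (continuous_arg_J h)
  have hint : ∀ z : UpperHalfPlane, ∃ n : ℤ,
      (J (g * h) z).arg - (J g ((h • z : UpperHalfPlane) : ℂ)).arg - (J h z).arg
        = 2 * Real.pi * n := by
    intro z
    have : (((J (g * h) z).arg : ℝ) : Real.Angle)
        = (((J g ((h • z : UpperHalfPlane) : ℂ)).arg + (J h z).arg : ℝ) : Real.Angle) := by
      rw [J_mul, Complex.arg_mul_coe_angle (J_ne_zero _ _) (J_ne_zero _ _), Real.Angle.coe_add]
    rw [Real.Angle.angle_eq_iff_two_pi_dvd_sub] at this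
    obtain ⟨n, hn⟩ := this
    exact ⟨n, by rw [← hn]; ring⟩
  choose n hn using hint
  have hn' : ∀ z, ((n z : ℤ) : ℝ) = (2 * Real.pi)⁻¹ *
      ((J (g * h) z).arg - (J g ((h • z : UpperHalfPlane) : ℂ)).arg - (J h z).arg) := by
    intro z
    rw [hn z]
    field_simp
  have hnc : Continuous n := by
    rw [Int.isClosedEmbedding_coe_real.isEmbedding.continuous_iff]
    have : ((fun k : ℤ => (k : ℝ)) ∘ n) = fun z : UpperHalfPlane => (2 * Real.pi)⁻¹ *
      ((J (g * h) z).arg - (J g ((h • z : UpperHalfPlane) : ℂ)).arg - (J h z).arg) := by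
      funext z; exact hn' z
    rw [this]
    exact continuous_const.mul hcont
  have := PreconnectedSpace.constant (inferInstance : PreconnectedSpace UpperHalfPlane) hnc
    (x := z) (y := w)
  rw [hn, hn, this]

theorem exp_arg_mul_I {z : ℂ} (hz : z ≠ 0) :
    Complex.exp (Complex.I * (z.arg : ℂ)) = z / (‖z‖ : ℂ) := by
  have h := Complex.norm_mul_exp_arg_mul_I z
  have : (‖z‖ : ℂ) ≠ 0 := by simpa using hz
  rw [eq_div_iff this, mul_comm Complex.I]
  linear_combination h

/-- The universal covering group of `SL(2, ℝ)`, realised as the set of pairs `(g, θ)` with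
`J(g, i) e^{iθ} = |J(g, i)|`. -/
@[ext]
structure Gtilde where
  g : SL(2, ℝ)
  θ : ℝ
  cond : J g Complex.I * Complex.exp (Complex.I * (θ : ℂ)) = (‖J g Complex.I‖ : ℂ)

namespace Gtilde

/-- The correction angle `arg (J(g₁, g₂ i) / J(g₁, i))`. -/
def corr (g₁ g₂ : SL(2, ℝ)) : ℝ :=
  (J g₁ ((g₂ • UpperHalfPlane.I : UpperHalfPlane) : ℂ) / J g₁ Complex.I).arg

theorem J_I_ne_zero (g : SL(2, ℝ)) : J g Complex.I ≠ 0 := J_ne_zero g UpperHalfPlane.I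

theorem exp_theta (p : Gtilde) :
    Complex.exp (Complex.I * (p.θ : ℂ)) = (‖J p.g Complex.I‖ : ℂ) / J p.g Complex.I := by
  rw [eq_div_iff (J_I_ne_zero _), mul_comm]
  exact p.cond

theorem exp_corr (g h : SL(2, ℝ)) :
    Complex.exp (Complex.I * (corr g h : ℂ))
      = (J g ((h • UpperHalfPlane.I : UpperHalfPlane) : ℂ) / J g Complex.I)
        / ((‖J g ((h • UpperHalfPlane.I : UpperHalfPlane) : ℂ)‖ : ℂ) / (‖J g Complex.I‖ : ℂ)) := by
  rw [corr, exp_arg_mul_I (div_ne_zero (J_ne_zero _ _) (J_I_ne_zero _))]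
  simp

theorem J_mul_I (g h : SL(2, ℝ)) : J (g * h) Complex.I
    = J g ((h • UpperHalfPlane.I : UpperHalfPlane) : ℂ) * J h Complex.I :=
  J_mul g h UpperHalfPlane.I

/-- `(g₁, θ₁) (g₂, θ₂) = (g₁ g₂, θ₁ + θ₂ - arg (J(g₁, g₂ i) / J(g₁, i)))`. -/
instance : Mul Gtilde where
  mul p q := ⟨p.g * q.g, p.θ + q.θ - corr p.g q.g, by
    have h1 := J_I_ne_zero p.g
    have h2 := J_I_ne_zero q.g
    have h3 := J_ne_zero p.g (q.g • UpperHalfPlane.I)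
    have n1 : (‖J p.g Complex.I‖ : ℂ) ≠ 0 := by simpa using h1
    have n3 : (‖J p.g ((q.g • UpperHalfPlane.I : UpperHalfPlane) : ℂ)‖ : ℂ) ≠ 0 := by simpa using h3
    have e : Complex.I * ((p.θ + q.θ - corr p.g q.g : ℝ) : ℂ)
        = Complex.I * (p.θ : ℂ) + Complex.I * (q.θ : ℂ) - Complex.I * (corr p.g q.g : ℂ) := by
      push_cast; ring
    rw [e, Complex.exp_sub, Complex.exp_add, exp_theta, exp_theta, exp_corr, J_mul_I, norm_mul]
    push_cast
    field_simp⟩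

instance : One Gtilde where
  one := ⟨1, 0, by simp [J_one]⟩

instance : Inv Gtilde where
  inv p := ⟨p.g⁻¹, -p.θ + corr p.g⁻¹ p.g, by
    have h1 := J_I_ne_zero p.g
    have h2 := J_I_ne_zero p.g⁻¹
    have h3 := J_ne_zero p.g⁻¹ (p.g • UpperHalfPlane.I)
    have n1 : (‖J p.g Complex.I‖ : ℂ) ≠ 0 := by simpa using h1
    have n2 : (‖J p.g⁻¹ Complex.I‖ : ℂ) ≠ 0 := by simpa using h2
    have n3 : (‖J p.g⁻¹ ((p.g • UpperHalfPlane.I : UpperHalfPlane) : ℂ)‖ : ℂ) ≠ 0 := by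
      simpa using h3
    have e : Complex.I * ((-p.θ + corr p.g⁻¹ p.g : ℝ) : ℂ)
        = -(Complex.I * (p.θ : ℂ)) + Complex.I * (corr p.g⁻¹ p.g : ℂ) := by
      push_cast; ring
    have hc := J_mul_I p.g⁻¹ p.g
    rw [inv_mul_cancel, J_one] at hc
    have hn : (1 : ℂ) = (‖J p.g⁻¹ ((p.g • UpperHalfPlane.I : UpperHalfPlane) : ℂ)‖ : ℂ)
        * (‖J p.g Complex.I‖ : ℂ) := by
      rw [← Complex.ofReal_mul, ← norm_mul, ← hc]; simp
    rw [e, Complex.exp_add, Complex.exp_neg, exp_theta, exp_corr]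
    field_simp
    linear_combination hn - hc⟩

@[simp] theorem mul_g (p q : Gtilde) : (p * q).g = p.g * q.g := rfl
theorem mul_theta (p q : Gtilde) : (p * q).θ = p.θ + q.θ - corr p.g q.g := rfl
@[simp] theorem one_g : (1 : Gtilde).g = 1 := rfl
@[simp] theorem one_theta : (1 : Gtilde).θ = 0 := rfl
@[simp] theorem inv_g (p : Gtilde) : p⁻¹.g = p.g⁻¹ := rfl
theorem inv_theta (p : Gtilde) : p⁻¹.θ = -p.θ + corr p.g⁻¹ p.g := rfl

theorem corr_eq (g h : SL(2, ℝ)) : corr g h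
    = (J g ((h • UpperHalfPlane.I : UpperHalfPlane) : ℂ)).arg - (J g Complex.I).arg :=
  arg_J_div g _ UpperHalfPlane.I

instance : Group Gtilde where
  mul_assoc p q r := by
    apply Gtilde.ext
    · simp [mul_assoc]
    · have := arg_cocycle p.g q.g (r.g • UpperHalfPlane.I) UpperHalfPlane.I
      simp only [mul_theta, mul_g, corr_eq, mul_smul] at *
      simp only [UpperHalfPlane.coe_I] at this
      linarith
  one_mul p := by
    apply Gtilde.ext
    · simp
    · simp [mul_theta, corr, J_one]
  mul_one p := by
    apply Gtilde.ext
    · simp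
    · simp [mul_theta, corr, div_self (J_I_ne_zero _)]
  inv_mul_cancel p := by
    apply Gtilde.ext
    · simp
    · simp [mul_theta, inv_theta]

end Gtilde

/-- The matrix with rows `(1, x)` and `(0, 1)`. -/
def uM (x : ℝ) : SL(2, ℝ) := ⟨!![1, x; 0, 1], by simp⟩

/-- The matrix `diag(√y, 1/√y)`, for `y > 0`. -/
def aM (y : ℝ) (hy : 0 < y) : SL(2, ℝ) :=
  ⟨!![√y, 0; 0, 1 / √y], by simp [(Real.sqrt_pos.2 hy).ne']⟩

/-- The matrix with rows `(cos θ, sin θ)` and `(-sin θ, cos θ)`. -/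
def kM (θ : ℝ) : SL(2, ℝ) :=
  ⟨!![Real.cos θ, Real.sin θ; -Real.sin θ, Real.cos θ], by
    rw [Matrix.det_fin_two_of]; nlinarith [Real.sin_sq_add_cos_sq θ]⟩

theorem J_uM (x : ℝ) (z : ℂ) : J (uM x) z = 1 := by
  rw [J_apply]; simp [uM]

theorem J_aM (y : ℝ) (hy : 0 < y) (z : ℂ) : J (aM y hy) z = ((1 / √y : ℝ) : ℂ) := by
  rw [J_apply]; simp [aM]

theorem J_kM (θ : ℝ) (z : ℂ) :
    J (kM θ) z = ((-Real.sin θ : ℝ) : ℂ) * z + ((Real.cos θ : ℝ) : ℂ) := by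
  rw [J_apply]; simp [kM]

theorem J_kM_I (θ : ℝ) : J (kM θ) Complex.I = Complex.exp (-(Complex.I * (θ : ℂ))) := by
  rw [J_kM, ← mul_neg, mul_comm Complex.I, ← Complex.ofReal_neg, Complex.exp_mul_I]
  push_cast
  simp
  ring

/-- `ũ(x) = (u(x), 0)`. -/
def uT (x : ℝ) : Gtilde := ⟨uM x, 0, by simp [J_uM]⟩

/-- `ã(y) = (a(y), 0)`, for `y > 0`. -/
def aT (y : ℝ) (hy : 0 < y) : Gtilde :=
  ⟨aM y hy, 0, by
    rw [J_aM, Complex.norm_real, Real.norm_of_nonneg (by positivity)]; simp⟩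

/-- `k̃(θ) = (k(θ), θ)`. -/
def kT (θ : ℝ) : Gtilde :=
  ⟨kM θ, θ, by rw [J_kM_I, ← Complex.exp_add, Complex.norm_exp]; simp⟩

/-- `w̃ = k̃(-π/2)`, a lift of the matrix with rows `(0, -1)` and `(1, 0)`. -/
def wT : Gtilde := kT (-(Real.pi / 2))

/-- The lower triangular unipotent elements `w̃ ũ(-x) w̃⁻¹`. -/
def ubT (x : ℝ) : Gtilde := wT * uT (-x) * wT⁻¹

/-- The Iwasawa coordinates `(x, s, θ) ↦ ũ(x) ã(eˢ) k̃(θ)`, a global chart of the universal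
covering group. -/
def chart (p : ℝ × ℝ × ℝ) : Gtilde :=
  uT p.1 * aT (Real.exp p.2.1) (Real.exp_pos _) * kT p.2.2

theorem ext_smul {p q : Gtilde}
    (h1 : p.g • UpperHalfPlane.I = q.g • UpperHalfPlane.I) (h2 : p.θ = q.θ) : p = q := by
  have hp := Gtilde.J_I_ne_zero p.g
  have hq := Gtilde.J_I_ne_zero q.g
  have him : ∀ g : SL(2, ℝ),
      (g • UpperHalfPlane.I).im * Complex.normSq (J g Complex.I) = 1 := by
    intro g
    have := UpperHalfPlane.im_smul_eq_div_normSq (g : GL (Fin 2) ℝ) UpperHalfPlane.I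
    have h0 : Complex.normSq (J g Complex.I) ≠ 0 := by
      simpa using Gtilde.J_I_ne_zero g
    have e : (g • UpperHalfPlane.I).im = 1 / Complex.normSq (J g Complex.I) := by
      refine Eq.trans ?_ (this.trans ?_)
      · rfl
      · simp [J]
    rw [e]; field_simp
  have hn : ‖J p.g Complex.I‖ = ‖J q.g Complex.I‖ := by
    have a := him p.g
    have b := him q.g
    rw [h1] at a
    have hpos := (q.g • UpperHalfPlane.I).im_pos
    have : Complex.normSq (J p.g Complex.I) = Complex.normSq (J q.g Complex.I) := by
      have : (q.g • UpperHalfPlane.I).im *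
        (Complex.normSq (J p.g Complex.I) - Complex.normSq (J q.g Complex.I)) = 0 := by linarith
      rcases mul_eq_zero.1 this with h | h
      · exact absurd h hpos.ne'
      · linarith
    rw [Complex.norm_def, Complex.norm_def, this]
  have hJ : J p.g Complex.I = J q.g Complex.I := by
    have a := p.cond
    have b := q.cond
    rw [h2, hn, ← b] at a
    exact mul_right_cancel₀ (Complex.exp_ne_zero _) a
  have hnum := congrArg (fun z : UpperHalfPlane => (z : ℂ)) h1
  simp only [coe_smul, UpperHalfPlane.coe_I] at hnum
  rw [hJ, div_left_inj' hq] at hnum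
  rw [J_apply, J_apply] at hJ
  have r1 := congrArg Complex.re hnum
  have i1 := congrArg Complex.im hnum
  have r2 := congrArg Complex.re hJ
  have i2 := congrArg Complex.im hJ
  simp at r1 i1 r2 i2
  refine Gtilde.ext ?_ h2
  ext i j
  fin_cases i <;> fin_cases j <;> simpa

theorem uM_smul (x : ℝ) (z : UpperHalfPlane) :
    ((uM x • z : UpperHalfPlane) : ℂ) = x + z := by
  rw [coe_smul, J_uM]; simp [uM]; ring

theorem aM_smul (y : ℝ) (hy : 0 < y) (z : UpperHalfPlane) :
    ((aM y hy • z : UpperHalfPlane) : ℂ) = y * z := by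
  rw [coe_smul, J_aM]
  have h : ((√y : ℝ) : ℂ) * ((√y : ℝ) : ℂ) = y := by
    rw [← Complex.ofReal_mul, Real.mul_self_sqrt hy.le]
  simp [aM]
  linear_combination (z : ℂ) * h

theorem chart_g (p : ℝ × ℝ × ℝ) :
    (chart p).g = uM p.1 * aM (Real.exp p.2.1) (Real.exp_pos _) * kM p.2.2 := rfl

theorem J_chart (p : ℝ × ℝ × ℝ) (z : UpperHalfPlane) :
    J (chart p).g z = ((1 / √(Real.exp p.2.1) : ℝ) : ℂ) * J (kM p.2.2) z := by
  rw [chart_g, J_mul, J_mul, J_uM, J_aM, one_mul]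

theorem chart_smul (p : ℝ × ℝ × ℝ) (z : UpperHalfPlane) :
    (((chart p).g • z : UpperHalfPlane) : ℂ)
      = p.1 + (Real.exp p.2.1 : ℝ) * ((kM p.2.2 • z : UpperHalfPlane) : ℂ) := by
  rw [chart_g, mul_smul, mul_smul, uM_smul, aM_smul]

theorem chart_theta (p : ℝ × ℝ × ℝ) : (chart p).θ = p.2.2 := by
  have h1 : ∀ x, (uT x).g = uM x := fun _ => rfl
  have h2 : ∀ y hy, (aT y hy).g = aM y hy := fun _ _ => rfl
  have hne : ((1 / √(Real.exp p.2.1) : ℝ) : ℂ) ≠ 0 := by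
    have : 0 < 1 / √(Real.exp p.2.1) := by positivity
    exact_mod_cast this.ne'
  unfold chart
  simp only [Gtilde.mul_theta, Gtilde.corr, Gtilde.mul_g, h1, h2, J_uM]
  rw [J_mul, Gtilde.J_mul_I, J_uM, J_aM, J_uM, J_aM, one_mul, div_self hne]
  simp [uT, aT, kT]

theorem kM_smul_I (θ : ℝ) : ((kM θ • UpperHalfPlane.I : UpperHalfPlane) : ℂ) = Complex.I := by
  rw [coe_smul, div_eq_iff (J_ne_zero _ _), J_kM, UpperHalfPlane.coe_I]
  simp [kM]
  linear_combination (Complex.sin θ) * Complex.I_mul_I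

/-- The coordinates of a product `chart p * h`, by which right translations are smooth. -/
def chartMul (h : Gtilde) (p : ℝ × ℝ × ℝ) : ℝ × ℝ × ℝ :=
  (p.1 + Real.exp p.2.1 * ((kM p.2.2 • h.g • UpperHalfPlane.I : UpperHalfPlane) : ℂ).re,
    p.2.1 + Real.log ((kM p.2.2 • h.g • UpperHalfPlane.I : UpperHalfPlane) : ℂ).im,
    p.2.2 + h.θ - Gtilde.corr (kM p.2.2) h.g)

theorem chart_mul (h : Gtilde) (p : ℝ × ℝ × ℝ) : chart p * h = chart (chartMul h p) := by
  apply ext_smul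
  · apply UpperHalfPlane.ext
    rw [Gtilde.mul_g, mul_smul, chart_smul, chart_smul, kM_smul_I]
    set z := kM p.2.2 • h.g • UpperHalfPlane.I with hz
    have hpos : 0 < ((z : UpperHalfPlane) : ℂ).im := z.im_pos
    have e : Real.exp (p.2.1 + Real.log ((z : UpperHalfPlane) : ℂ).im)
        = Real.exp p.2.1 * ((z : UpperHalfPlane) : ℂ).im := by
      rw [Real.exp_add, Real.exp_log hpos]
    simp only [chartMul, ← hz, e]
    apply Complex.ext <;> simp [-Complex.ofReal_exp, -UpperHalfPlane.coe_re, -UpperHalfPlane.coe_im]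
  · rw [Gtilde.mul_theta, chart_theta, chart_theta]
    have hne : ((1 / √(Real.exp p.2.1) : ℝ) : ℂ) ≠ 0 := by
      have : 0 < 1 / √(Real.exp p.2.1) := by positivity
      exact_mod_cast this.ne'
    have e : Gtilde.corr (chart p).g h.g = Gtilde.corr (kM p.2.2) h.g := by
      have := J_chart p UpperHalfPlane.I
      rw [UpperHalfPlane.coe_I] at this
      rw [Gtilde.corr, J_chart, this, mul_div_mul_left _ _ hne, Gtilde.corr]
    simp [chartMul, e]

theorem chart_injective : Function.Injective chart := by
  intro p q h
  have h1 := congrArg (fun z : Gtilde => ((z.g • UpperHalfPlane.I : UpperHalfPlane) : ℂ)) h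
  have h2 := congrArg Gtilde.θ h
  rw [chart_theta, chart_theta] at h2
  simp only [chart_smul, kM_smul_I] at h1
  have hre := congrArg Complex.re h1
  have him := congrArg Complex.im h1
  simp [-Complex.ofReal_exp] at hre him
  exact Prod.ext hre (Prod.ext him h2)

theorem chart_surjective : Function.Surjective chart := by
  intro q
  set z := q.g • UpperHalfPlane.I with hz
  refine ⟨((z : ℂ).re, Real.log (z : ℂ).im, q.θ), ?_⟩
  apply ext_smul
  · apply UpperHalfPlane.ext
    have hpos : 0 < ((z : UpperHalfPlane) : ℂ).im := z.im_pos
    rw [chart_smul, kM_smul_I, ← hz]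
    simp only [Real.exp_log hpos]
    exact Complex.re_add_im _
  · rw [chart_theta]

theorem contDiff_chartMul (h : Gtilde) : ContDiff ℝ ∞ (chartMul h) := by
  set z := h.g • UpperHalfPlane.I with hz
  have hform : ∀ θ : ℝ, ((kM θ • z : UpperHalfPlane) : ℂ)
      = (((Real.cos θ : ℝ) : ℂ) * z + ((Real.sin θ : ℝ) : ℂ)) / J (kM θ) z := by
    intro θ
    rw [coe_smul]; simp [kM]
  have hJ : ∀ w : UpperHalfPlane, ContDiff ℝ ∞ fun p : ℝ × ℝ × ℝ => J (kM p.2.2) w := by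
    intro w
    simp only [J_kM]
    have h1 : ContDiff ℝ ∞ fun p : ℝ × ℝ × ℝ => ((-Real.sin p.2.2 : ℝ) : ℂ) :=
      Complex.ofRealCLM.contDiff.comp
        (show ContDiff ℝ ∞ fun p : ℝ × ℝ × ℝ => -Real.sin p.2.2 by fun_prop)
    have h2 : ContDiff ℝ ∞ fun p : ℝ × ℝ × ℝ => ((Real.cos p.2.2 : ℝ) : ℂ) :=
      Complex.ofRealCLM.contDiff.comp
        (show ContDiff ℝ ∞ fun p : ℝ × ℝ × ℝ => Real.cos p.2.2 by fun_prop)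
    exact (h1.mul contDiff_const).add h2
  have hk : ContDiff ℝ ∞ fun p : ℝ × ℝ × ℝ => ((kM p.2.2 • z : UpperHalfPlane) : ℂ) := by
    simp only [hform]
    have h1 : ContDiff ℝ ∞ fun p : ℝ × ℝ × ℝ => ((Real.sin p.2.2 : ℝ) : ℂ) :=
      Complex.ofRealCLM.contDiff.comp
        (show ContDiff ℝ ∞ fun p : ℝ × ℝ × ℝ => Real.sin p.2.2 by fun_prop)
    have h2 : ContDiff ℝ ∞ fun p : ℝ × ℝ × ℝ => ((Real.cos p.2.2 : ℝ) : ℂ) :=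
      Complex.ofRealCLM.contDiff.comp
        (show ContDiff ℝ ∞ fun p : ℝ × ℝ × ℝ => Real.cos p.2.2 by fun_prop)
    exact ((h2.mul contDiff_const).add h1).mul ((hJ z).inv fun p => J_ne_zero _ _)
  have hre := Complex.reCLM.contDiff.comp hk
  have him := Complex.imCLM.contDiff.comp hk
  have hc : ContDiff ℝ ∞ fun p : ℝ × ℝ × ℝ => Gtilde.corr (kM p.2.2) h.g := by
    have hq : ContDiff ℝ ∞ fun p : ℝ × ℝ × ℝ =>
        J (kM p.2.2) z / J (kM p.2.2) UpperHalfPlane.I :=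
      (hJ z).mul ((hJ UpperHalfPlane.I).inv fun p => J_ne_zero _ _)
    have hlog : ContDiff ℝ ∞ fun p : ℝ × ℝ × ℝ =>
        Complex.log (J (kM p.2.2) z / J (kM p.2.2) UpperHalfPlane.I) := by
      rw [contDiff_iff_contDiffAt]
      intro p
      exact ((Complex.contDiffAt_log (div_mem_slitPlane _ _ _)).restrict_scalars ℝ).comp p
        hq.contDiffAt
    have := Complex.imCLM.contDiff.comp hlog
    convert this using 1
    funext p
    simp [Gtilde.corr, ← hz, Complex.log_im]
  unfold chartMul
  refine ContDiff.prodMk ?_ (ContDiff.prodMk ?_ ?_)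
  · refine contDiff_fst.add (ContDiff.mul (by fun_prop) hre)
  · refine ContDiff.add (by fun_prop) (ContDiff.log him fun p => ?_)
    exact (kM p.2.2 • z).im_pos.ne'
  · exact ContDiff.sub (by fun_prop) hc

/-! ### Smooth principal series -/

/-- Smooth functions on the universal covering group. -/
def IsSmooth (F : Gtilde → ℂ) : Prop := ContDiff ℝ ∞ fun p : ℝ × ℝ × ℝ => F (chart p)

/-- Right translation `(ρ(h) F)(g) = F(g h)`. -/
def rho (h : Gtilde) (F : Gtilde → ℂ) : Gtilde → ℂ := fun g => F (g * h)

theorem IsSmooth.rho {F : Gtilde → ℂ} (hF : IsSmooth F) (h : Gtilde) : IsSmooth (rho h F) := by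
  have : (fun p : ℝ × ℝ × ℝ => AutoDist.rho h F (chart p))
      = (fun p : ℝ × ℝ × ℝ => F (chart p)) ∘ chartMul h := by
    funext p
    simp only [AutoDist.rho, Function.comp, chart_mul]
  unfold IsSmooth
  rw [this]
  exact ContDiff.comp hF (contDiff_chartMul h)

/-- The space of the smooth principal series representation with parameters `μ`, `ν`. -/
def PS (μ ν : ℂ) : Submodule ℂ (Gtilde → ℂ) where
  carrier := {F | (∀ (x y : ℝ) (hy : 0 < y) (m : ℤ) (g : Gtilde),
      F (uT x * aT y hy * kT (m * Real.pi) * g)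
        = Complex.exp (Real.pi * m * Complex.I * μ) * (y : ℂ) ^ (ν + 1 / 2) * F g) ∧ IsSmooth F}
  zero_mem' := ⟨fun x y hy m g => by simp, contDiff_const⟩
  add_mem' := by
    rintro F G ⟨hF, hF'⟩ ⟨hG, hG'⟩
    refine ⟨fun x y hy m g => ?_, ContDiff.add hF' hG'⟩
    simp only [Pi.add_apply, hF, hG]
    ring
  smul_mem' := by
    rintro c F ⟨hF, hF'⟩
    refine ⟨fun x y hy m g => ?_, ContDiff.const_smul c hF'⟩
    simp only [Pi.smul_apply, smul_eq_mul, hF]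
    ring

/-- The action of the universal covering group on the smooth principal series. -/
def PS.act {μ ν : ℂ} (h : Gtilde) (F : PS μ ν) : PS μ ν :=
  ⟨rho h F, fun x y hy m g => by
    simp only [rho, mul_assoc _ g h]
    exact F.2.1 x y hy m (g * h), F.2.2.rho h⟩

/-- The map `F ↦ F_∞ = e^{πiμ/2} ρ(w̃) F`. -/
def inftyMap (μ : ℂ) (F : Gtilde → ℂ) : Gtilde → ℂ :=
  fun g => Complex.exp (Real.pi * Complex.I * μ / 2) * rho wT F g

/-- The standard basis `H = diag(1, -1)`, `E₊`, `E₋` of `𝔰𝔩(2, ℝ)`. -/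
inductive Sl2Basis
  | H
  | Ep
  | Em

/-- The one-parameter subgroups `t ↦ exp(t X)` of the universal covering group for the basis
vectors `X`. -/
def oneParam : Sl2Basis → ℝ → Gtilde
  | .H, t => aT (Real.exp (2 * t)) (Real.exp_pos _)
  | .Ep, t => uT t
  | .Em, t => ubT t

/-- `(ρ(X) F)(g) = d/dt|_{t = 0} F(g exp(t X))`. -/
def lieDeriv (X : Sl2Basis) (F : Gtilde → ℂ) : Gtilde → ℂ :=
  fun g => deriv (fun t : ℝ => F (g * oneParam X t)) 0

/-- `ρ(X₁) ⋯ ρ(X_k) F` for a monomial `X₁ ⋯ X_k` in the basis vectors. These monomials span the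
universal enveloping algebra of `𝔰𝔩(2, ℂ)`. -/
def wordDeriv (w : List Sl2Basis) (F : Gtilde → ℂ) : Gtilde → ℂ := w.foldr lieDeriv F

/-- The seminorm `F ↦ sup_{-π ≤ θ < π} |(ρ(X₁ ⋯ X_k) F)(k̃(θ))|`. -/
def seminormQ (w : List Sl2Basis) (F : Gtilde → ℂ) : ℝ :=
  ⨆ θ : Set.Ico (-Real.pi) Real.pi, ‖wordDeriv w F (kT θ)‖

/-- Distributions on the smooth principal series: the linear functionals that are continuous for
the topology defined by the seminorms of the elements of the enveloping algebra. As the monomials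
span the enveloping algebra, their seminorms define the same topology. -/
def distributions (μ ν : ℂ) : Set (PS μ ν → ℂ) :=
  {Λ | IsLinearMap ℂ Λ ∧ ∃ c : ℝ, 0 < c ∧ ∃ S : Finset (List Sl2Basis),
    ∀ F : PS μ ν, ‖Λ F‖ ≤ c * ∑ w ∈ S, seminormQ w F}

/-! ### Shifted lattices -/

/-- Shifted lattices `u₁ + u₂ ℤ` in `ℝ`, with `u₂ ≠ 0`. -/
structure ShiftedLattice where
  carrier : Set ℝ
  exists_eq : ∃ u₁ u₂ : ℝ, u₂ ≠ 0 ∧ carrier = Set.range fun n : ℤ => u₁ + u₂ * n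

namespace ShiftedLattice

variable (L : ShiftedLattice)

theorem nonempty : L.carrier.Nonempty := by
  obtain ⟨u₁, u₂, -, h⟩ := L.exists_eq
  rw [h]
  exact Set.range_nonempty _

/-- The dual lattice. -/
def dual : Set ℝ :=
  {t | ∀ l₁ ∈ L.carrier, ∀ l₂ ∈ L.carrier, ∃ n : ℤ, (l₁ - l₂) * t = n}

/-- The character `ω_L(t) = e^{2πi l t}` of the dual lattice, for any `l ∈ L`. -/
def omega (t : ℝ) : ℂ :=
  Complex.exp (2 * Real.pi * Complex.I * (L.nonempty.some : ℝ) * t)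

theorem omega_eq {l t : ℝ} (hl : l ∈ L.carrier) (ht : t ∈ L.dual) :
    L.omega t = Complex.exp (2 * Real.pi * Complex.I * l * t) := by
  obtain ⟨n, hn⟩ := ht _ L.nonempty.some_mem _ hl
  have hn' : ((L.nonempty.some : ℝ) - l : ℂ) * t = n := by exact_mod_cast hn
  rw [omega, Complex.exp_eq_exp_iff_exists_int]
  exact ⟨n, by linear_combination (2 * Real.pi * Complex.I) * hn'⟩

/-- The space `𝔐(L)` of functions of polynomial growth on `L`. -/
def polyGrowth : Set (L.carrier → ℂ) :=
  {α | ∃ r : ℝ, α =O[comap (fun l : L.carrier => |(l : ℝ)|) atTop]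
    fun l : L.carrier => |(l : ℝ)| ^ r}

/-- The set `𝔐(L)⁰_{μ,ν}` of all `α` in `𝔐(L)` with `α(0) = 0` in case `0 ∈ L`,
`-2ν` is a positive integer and `μ - 2ν - 1` is not an even integer. -/
def polyGrowthZero (μ ν : ℂ) : Set (L.carrier → ℂ) :=
  {α | α ∈ L.polyGrowth ∧ ∀ h0 : (0 : ℝ) ∈ L.carrier,
    (∃ n : ℕ, 0 < n ∧ -2 * ν = n) → (¬ ∃ k : ℤ, μ - 2 * ν - 1 = 2 * k) → α ⟨0, h0⟩ = 0}

/-- The set `S_ν(L)`: empty if `0 ∉ L`, and `{0, -2ν} ∩ ℤ_{≥ 0}` if `0 ∈ L`. -/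
def expSet (ν : ℂ) : Set ℕ := {m | (0 : ℝ) ∈ L.carrier ∧ (m = 0 ∨ (m : ℂ) = -2 * ν)}

end ShiftedLattice

/-- The space `𝔑(S)` of finitely supported functions on `ℤ_{≥ 0}` that vanish outside `S`. -/
def finSuppOn (S : Set ℕ) : Set (ℕ →₀ ℂ) := {β | ∀ m, m ∉ S → β m = 0}

/-- The distributions `Λ` with `Λ(ρ(ũ(t)) F) = ω_L(t) Λ(F)` for all `t` in the dual lattice. -/
def invariantDist (μ ν : ℂ) (L : ShiftedLattice) : Set (PS μ ν → ℂ) :=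
  {Λ | Λ ∈ distributions μ ν ∧
    ∀ t ∈ L.dual, ∀ F : PS μ ν, Λ (PS.act (uT t) F) = L.omega t * Λ F}

/-! ### Jacquet integrals and the Fourier expansion -/

/-- Smooth compactly supported functions on `ℝ`. -/
def IsTest (f : ℝ → ℂ) : Prop := ContDiff ℝ ∞ f ∧ HasCompactSupport f

/-- The Fourier transform `∫ f(x) e^{2πixy} dx`. -/
def fourierT (f : ℝ → ℂ) (y : ℝ) : ℂ :=
  ∫ x : ℝ, f x * Complex.exp (2 * Real.pi * Complex.I * x * y)

/-- `f_{μ,ν,∞}(x) = e^{-sgn(x) πiμ/2} |x|^{-2ν-1} f(-1/x)` for `x ≠ 0` (the value at the single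
point `0` plays no role below). -/
def twist (μ ν : ℂ) (f : ℝ → ℂ) (x : ℝ) : ℂ :=
  Complex.exp (-((SignType.sign x : ℝ) : ℂ) * Real.pi * Complex.I * μ / 2)
    * ((|x| : ℝ) : ℂ) ^ (-2 * ν - 1) * f (-1 / x)

/-- `G` is the meromorphic continuation to `ℂ` of the function `g` on `Re s > 0`; normal form means
that `G` has its analytic value at each point where it is not singular, so `G` is unique. -/
def IsMeroCont (g G : ℂ → ℂ) : Prop :=
  MeromorphicNFOn G Set.univ ∧ ∀ s : ℂ, 0 < s.re → G s = g s

/-- The meromorphic continuation to `ℂ` of a function on `Re s > 0`. -/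
def meroCont (g : ℂ → ℂ) : ℂ → ℂ := Classical.epsilon (IsMeroCont g)

/-- The meromorphic continuation in `ν` of the Fourier transform of `f_{μ,ν,∞}` at `y`. -/
def twistFourierCont (μ : ℂ) (f : ℝ → ℂ) (y : ℝ) : ℂ → ℂ :=
  meroCont fun s => fourierT (twist μ s f) y

/-- `δ^{(n)}(f) = (-1)ⁿ f^{(n)}(0)`. -/
def delta (n : ℕ) (f : ℝ → ℂ) : ℂ := (-1) ^ n * iteratedDeriv n f 0

open Classical in
/-- The twisted Fourier transform `𝓕_{μ,ν,∞}(f)(y)`: the value at `ν` of the meromorphic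
continuation, and its finite part if `y = 0` and `-2ν = n` is a nonnegative integer. -/
def twistFourier (μ ν : ℂ) (f : ℝ → ℂ) (y : ℝ) : ℂ :=
  if h : y = 0 ∧ ∃ n : ℕ, -2 * ν = n then
    limUnder (𝓝[≠] ν) fun s : ℂ =>
      twistFourierCont μ f 0 s
        - Complex.I ^ h.2.choose * (2 * Complex.cos (Real.pi * (h.2.choose + μ) / 2))
          / (h.2.choose.factorial * (2 * s + h.2.choose)) * delta h.2.choose f
  else twistFourierCont μ f y ν

/-- The function on the universal covering group attached to a function `f` on the line, so that
its value at `w̃ ũ(-x)` is `f(x)`. -/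
def iota (μ ν : ℂ) (f : ℝ → ℂ) (p : Gtilde) : ℂ :=
  if p.g 1 0 = 0 then 0
  else Complex.exp (Complex.I * μ * ((p.θ + (J p.g Complex.I / ((p.g 1 0 : ℝ) : ℂ)).arg : ℝ) : ℂ))
    * ((|p.g 1 0| : ℝ) : ℂ) ^ (-2 * ν - 1) * f (-(p.g 1 1) / (p.g 1 0))

/-- A partition of `F`: test functions `f₁`, `f₂` with `F = ι(f₁) + ι(f₂)_∞`. -/
def IsPartition (μ ν : ℂ) (F : Gtilde → ℂ) (f : (ℝ → ℂ) × (ℝ → ℂ)) : Prop :=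
  IsTest f.1 ∧ IsTest f.2 ∧ iota μ ν f.1 + inftyMap μ (iota μ ν f.2) = F

/-- A chosen partition of `F`; the Jacquet integral does not depend on the choice. -/
def partition (μ ν : ℂ) (F : Gtilde → ℂ) : (ℝ → ℂ) × (ℝ → ℂ) :=
  Classical.epsilon (IsPartition μ ν F)

/-- The (analytically continued) Jacquet integral `𝒥_l(F)`. -/
def jacquet (μ ν : ℂ) (l : ℝ) (F : PS μ ν) : ℂ :=
  fourierT (partition μ ν F).1 l + twistFourier μ ν (partition μ ν F).2 l

/-- `δ_∞^{(m)}(F) = (ρ(E₊)^m F_∞)(w̃)`. -/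
def deltaInfty (μ ν : ℂ) (m : ℕ) (F : PS μ ν) : ℂ :=
  wordDeriv (List.replicate m .Ep) (inftyMap μ F) wT

/-- `λ_{α,β}(F) = ∑_{l ∈ L} α(l) 𝒥_l(F) + ∑_m β(m) δ_∞^{(m)}(F)`. -/
def lambdaDist (μ ν : ℂ) (L : ShiftedLattice) (α : L.carrier → ℂ) (β : ℕ →₀ ℂ) (F : PS μ ν) : ℂ :=
  ∑' l : L.carrier, α l * jacquet μ ν l F + β.sum fun m b => b * deltaInfty μ ν m F

end AutoDist

end

noncomputable section

namespace AutoDist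

/-! ### Group identities in the covering group -/

/-! An element F of the principal series is recorded by two smooth functions on the line: `lineFn
F`, its values on the big Bruhat cell, and `inftyFn μ F`, its coordinate near the missing point.
They determine each other through the twist `tw`, which substitutes x ↦ -1/x with a factor of type
|x|^{-2ν-1}. Translation by ũ(t) shifts `lineFn F`. Its generator E₊ is -d/dx on the line, and in
the coordinate u at infinity it is minus the operator `dOp ν` = u² d/du + (2ν+1)u. The functionals
δ_∞^{(m)} are, up to sign, the jets of `inftyFn μ F` at 0.

For l ≠ 0, N integrations by parts give 𝒥_l(F) = (-2πil)^{-N} ∫ (d/dx)^N(lineFn F) e^{2πixl} dx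
(`jacquet_of_ne_zero`). Since `dOp`^N produces a factor u^N, the integrand decays like |x|^{-2 Re ν
- 1 - N}, so the integral converges absolutely once N > -2 Re ν. For l = 0 one subtracts the twist
of a Taylor polynomial at infinity and adds the explicit pole terms c_k ψ^{(k)}(0)/(k!(2ν+k)) with ψ
= `inftyFn μ F` (`jacquet_zero`). These formulas involve F alone, not a partition. They give
linearity and a bound of 𝒥_l by |l|^{-N} times finitely many seminorms, with N as large as desired.
Polynomial growth of α then yields absolute convergence and continuity of λ_{α,β}
(`exists_jacquet_bounds`, `lambdaDist_mem_distributions`). Only the equivariance under L^∨ remains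
to be decided.

For l ≠ 0 the integral 𝒥_l is equivariant under all ũ(t). The other terms are handled by writing
ρ(ũ(t))F - F as the E₊-image of G = ∫₀ᵗ ρ(ũ(τ))F dτ (`deriv_lineFn_translateInt`). On jets at
infinity E₊ sends order k to order k+1 with factor -(k+1)(2ν+k+1), and it kills order 0. On such an
image the regularised integral 𝒥_0 reduces to boundary terms. These cancel against the pole terms,
except at the index j with 2ν+j+1 = 0, where c_{j+1} times a jet of G survives
(`jacquet_zero_of_lineFn_eq_neg_deriv`). The constant c_{j+1} vanishes exactly when μ-2ν-1 is an
even integer (`cConst_eq_zero_iff`).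

If 0 ∈ L, the defect of equivariance is thus a linear combination of jets of G with coefficients
`jumpCoeff`. Test functions with a prescribed order of vanishing at infinity (`exists_jet_order`)
show that every coefficient must vanish, and these equations are the stated conditions on α(0) and
β. If 0 ∉ L, the 𝒥_l contribute no defect. A test vector vanishing to the top order k in the support
of β isolates (1-ω_L(t))β(k). With t = 1/u₂ one has ω_L(t) ≠ 1, so β must be zero. -/

theorem SL_mul_apply (g h : SL(2, ℝ)) (i j : Fin 2) :
    (g * h) i j = g i 0 * h 0 j + g i 1 * h 1 j := by
  simp [Matrix.mul_apply, Fin.sum_univ_two]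

theorem uM_apply (x : ℝ) : uM x 0 0 = 1 ∧ uM x 0 1 = x ∧ uM x 1 0 = 0 ∧ uM x 1 1 = 1 :=
  ⟨rfl, rfl, rfl, rfl⟩

theorem aM_apply (y : ℝ) (hy : 0 < y) :
    aM y hy 0 0 = √y ∧ aM y hy 0 1 = 0 ∧ aM y hy 1 0 = 0 ∧ aM y hy 1 1 = 1 / √y :=
  ⟨rfl, rfl, rfl, rfl⟩

theorem kM_apply (θ : ℝ) : kM θ 0 0 = Real.cos θ ∧ kM θ 0 1 = Real.sin θ ∧
    kM θ 1 0 = -Real.sin θ ∧ kM θ 1 1 = Real.cos θ :=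
  ⟨rfl, rfl, rfl, rfl⟩

theorem J_wM (z : ℂ) : J wT.g z = z := by
  rw [wT, kT, J_kM]; simp

theorem wT_theta : wT.θ = -(Real.pi / 2) := rfl

theorem uT_mul (x y : ℝ) : uT x * uT y = uT (x + y) := by
  apply ext_smul
  · rw [Gtilde.mul_g, mul_smul]
    apply UpperHalfPlane.ext
    simp only [uT, uM_smul]
    push_cast
    ring
  · rw [Gtilde.mul_theta, Gtilde.corr]
    simp [uT, J_uM]

theorem uT_zero : uT 0 = 1 := by
  apply ext_smul
  · apply UpperHalfPlane.ext
    simp [uT, uM_smul]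
  · simp [uT]

theorem kT_mul_theta (q : Gtilde) (θ : ℝ) : (q * kT θ).θ = q.θ + θ := by
  rw [Gtilde.mul_theta, Gtilde.corr]
  have : ((kT θ).g • UpperHalfPlane.I : UpperHalfPlane) = UpperHalfPlane.I :=
    UpperHalfPlane.ext (kM_smul_I θ)
  rw [this, UpperHalfPlane.coe_I, div_self (Gtilde.J_I_ne_zero _)]
  simp [kT]

theorem mul_kT_smul (q : Gtilde) (θ : ℝ) :
    (q * kT θ).g • UpperHalfPlane.I = q.g • UpperHalfPlane.I := by
  rw [Gtilde.mul_g, mul_smul]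
  congr 1
  exact UpperHalfPlane.ext (kM_smul_I θ)

theorem kT_mul (a b : ℝ) : kT a * kT b = kT (a + b) := by
  apply ext_smul
  · rw [mul_kT_smul]
    exact UpperHalfPlane.ext ((kM_smul_I a).trans (kM_smul_I _).symm)
  · rw [kT_mul_theta]; rfl

theorem kT_zero : kT 0 = 1 := by
  apply ext_smul
  · rw [Gtilde.one_g, one_smul]; exact UpperHalfPlane.ext (kM_smul_I 0)
  · rfl

theorem kM_int_pi_smul (m : ℤ) (z : UpperHalfPlane) : kM (m * Real.pi) • z = z := by
  apply UpperHalfPlane.ext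
  have h : Real.cos (m * Real.pi) ≠ 0 := by
    rw [Real.cos_int_mul_pi]; exact zpow_ne_zero _ (by norm_num)
  have h' : ((Real.cos (m * Real.pi) : ℝ) : ℂ) ≠ 0 := by exact_mod_cast h
  rw [coe_smul, div_eq_iff (J_ne_zero _ _), J_kM]
  simp [kM, Real.sin_int_mul_pi]
  ring

/-- The element k̃(mπ) covers ±1: it fixes the upper half-plane pointwise and has a constant
automorphy factor, so no correction angle occurs and it is central. -/
theorem kT_int_pi_mul (m : ℤ) (q : Gtilde) : kT (m * Real.pi) * q = q * kT (m * Real.pi) := by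
  apply ext_smul
  · rw [mul_kT_smul, Gtilde.mul_g, mul_smul]
    exact kM_int_pi_smul m _
  · rw [kT_mul_theta, Gtilde.mul_theta, Gtilde.corr]
    have h : ∀ z, J (kT (m * Real.pi)).g z = Real.cos (m * Real.pi) := by
      intro z; rw [kT, J_kM, Real.sin_int_mul_pi]; simp
    have h0 : (Real.cos (m * Real.pi) : ℂ) ≠ 0 := by
      have := Gtilde.J_I_ne_zero (kT (m * Real.pi)).g
      rwa [h] at this
    rw [h, h, div_self h0]
    simp [kT]; ring

theorem wT_inv : wT⁻¹ = kT (Real.pi / 2) := by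
  rw [inv_eq_iff_mul_eq_one, wT, kT_mul, neg_add_cancel, kT_zero]

theorem wT_eq : wT = kT (Real.pi / 2) * kT ((-1 : ℤ) * Real.pi) := by
  rw [kT_mul, wT]; congr 1; push_cast; ring

theorem wT_mul_uT_theta (x : ℝ) : (wT * uT x).θ = -((x : ℂ) + Complex.I).arg := by
  rw [Gtilde.mul_theta, Gtilde.corr_eq, J_wM, J_wM, wT_theta]
  simp [uT, uM_smul]
  ring

theorem arg_mul_I_of_pos {z : ℂ} (hz : 0 < z.re) : (Complex.I * z).arg = Real.pi / 2 + z.arg := by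
  have h0 : z ≠ 0 := by rintro rfl; simp at hz
  have h1 := Complex.abs_arg_lt_pi_div_two_iff.2 (Or.inl hz)
  have h2 := abs_lt.1 h1
  rw [Complex.arg_mul Complex.I_ne_zero h0]
  · rw [Complex.arg_I]
  · rw [Complex.arg_I]; constructor <;> linarith [Real.pi_pos]

theorem wT_mul_uT_g (x : ℝ) : ((wT * uT x).g 1 0 = 1) ∧ ((wT * uT x).g 1 1 = x) := by
  have h1 := kM_apply (-(Real.pi / 2))
  have h2 := uM_apply x
  have e : (wT * uT x).g = kM (-(Real.pi / 2)) * uM x := rfl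
  constructor <;> simp [e, SL_mul_apply, h1, h2]

theorem ubT_theta (x : ℝ) : (ubT x).θ = -((1 : ℂ) + x * Complex.I).arg := by
  rw [ubT, wT_inv, kT_mul_theta, wT_mul_uT_theta]
  -- The factor 1 + xi lies in the right half-plane, where multiplication by i adds exactly π/2 to
  -- the argument without a jump.
  have : (((-x : ℝ) : ℂ) + Complex.I) = Complex.I * (1 + x * Complex.I) := by
    push_cast; linear_combination -(x : ℂ) * Complex.I_mul_I
  rw [this, arg_mul_I_of_pos (by simp)]
  ring

theorem ubT_g (x : ℝ) : ((ubT x).g 1 0 = x) ∧ ((ubT x).g 1 1 = 1) := by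
  rw [ubT, wT_inv]
  have h1 := kM_apply (-(Real.pi / 2))
  have h3 := kM_apply (Real.pi / 2)
  have h2 := uM_apply (-x)
  have e : (wT * uT (-x) * kT (Real.pi / 2)).g
      = kM (-(Real.pi / 2)) * uM (-x) * kM (Real.pi / 2) := rfl
  constructor <;> simp [e, SL_mul_apply, h1, h2, h3]

theorem ubT_mul (x y : ℝ) : ubT x * ubT y = ubT (x + y) := by
  simp only [ubT, mul_assoc, inv_mul_cancel_left]
  rw [← mul_assoc (uT (-x)), uT_mul]
  congr 3; ring

/-- The angle `θ + arg(J/c)` is a multiple of `π` on the big cell. -/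
theorem exists_int_angle (p : Gtilde) (hc : p.g 1 0 ≠ 0) :
    ∃ m : ℤ, p.θ + (J p.g Complex.I / ((p.g 1 0 : ℝ) : ℂ)).arg = m * Real.pi := by
  have hJ := Gtilde.J_I_ne_zero p.g
  have hc' : ((p.g 1 0 : ℝ) : ℂ) ≠ 0 := by exact_mod_cast hc
  have h1 := Gtilde.exp_theta p
  have h2 := exp_arg_mul_I (div_ne_zero hJ hc')
  -- The exponential equals |c|/c, which is real; hence the sine of the angle vanishes and the angle
  -- is an integral multiple of π.
  have h3 : Complex.exp (Complex.I *
      ((p.θ + (J p.g Complex.I / ((p.g 1 0 : ℝ) : ℂ)).arg : ℝ) : ℂ))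
      = ((|p.g 1 0| / p.g 1 0 : ℝ) : ℂ) := by
    have n1 : (‖J p.g Complex.I‖ : ℂ) ≠ 0 := by simpa using hJ
    have n2 : ((|p.g 1 0| : ℝ) : ℂ) ≠ 0 := by simpa using hc
    rw [Complex.ofReal_add, mul_add, Complex.exp_add, h1, h2, norm_div, Complex.norm_real,
      Real.norm_eq_abs]
    push_cast
    field_simp
  have h4 := congrArg Complex.im h3
  rw [mul_comm, Complex.exp_ofReal_mul_I_im, Complex.ofReal_im, Real.sin_eq_zero_iff] at h4
  obtain ⟨m, hm⟩ := h4
  exact ⟨m, hm.symm⟩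

theorem wT_mul_uT_smul (x : ℝ) :
    (((wT * uT x).g • UpperHalfPlane.I : UpperHalfPlane) : ℂ) = -1 / ((x : ℂ) + Complex.I) := by
  rw [Gtilde.mul_g, mul_smul, coe_smul, J_wM]
  simp [wT, kT, kM, uT, uM_smul]

theorem pow_pos_of_ne_zero {c : ℝ} (hc : c ≠ 0) : 0 < c⁻¹ ^ 2 := by positivity

/-- Bruhat decomposition on the big cell. -/
theorem bruhat (p : Gtilde) (hc : p.g 1 0 ≠ 0) (m : ℤ)
    (hm : p.θ + (J p.g Complex.I / ((p.g 1 0 : ℝ) : ℂ)).arg = m * Real.pi) :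
    p = uT (p.g 0 0 / p.g 1 0) * aT ((p.g 1 0)⁻¹ ^ 2) (pow_pos_of_ne_zero hc) * kT (m * Real.pi)
      * (wT * uT (p.g 1 1 / p.g 1 0)) := by
  set c := p.g 1 0 with hcdef
  set d := p.g 1 1 with hddef
  have hc' : (c : ℂ) ≠ 0 := by exact_mod_cast hc
  have hJ : J p.g Complex.I = c * Complex.I + d := by rw [J_apply]
  have hJ0 : (c : ℂ) * Complex.I + d ≠ 0 := hJ ▸ Gtilde.J_I_ne_zero p.g
  have hz : (d / c : ℂ) + Complex.I ≠ 0 := by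
    intro h; apply hJ0
    have : (c : ℂ) * Complex.I + d = c * ((d / c : ℂ) + Complex.I) := by field_simp; ring
    rw [this, h, mul_zero]
  have hdet : p.g 0 0 * d - p.g 0 1 * c = 1 := by
    have := p.g.det_coe
    rw [Matrix.det_fin_two] at this
    exact this
  have hdet' : (p.g 0 0 : ℂ) * d - p.g 0 1 * c = 1 := by exact_mod_cast hdet
  apply ext_smul
  · apply UpperHalfPlane.ext
    rw [Gtilde.mul_g, Gtilde.mul_g, Gtilde.mul_g, mul_smul, mul_smul, mul_smul]
    have e : (kT (m * Real.pi)).g = kM (m * Real.pi) := rfl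
    rw [e, kM_int_pi_smul]
    have eu : ∀ x, (uT x).g = uM x := fun _ => rfl
    have ea : ∀ y hy, (aT y hy).g = aM y hy := fun _ _ => rfl
    rw [eu, ea, uM_smul, aM_smul, wT_mul_uT_smul]
    rw [coe_smul]
    simp only [UpperHalfPlane.coe_I, hJ, ← hcdef]
    push_cast
    have key : (d : ℂ) + Complex.I * c ≠ 0 := by rw [add_comm, mul_comm]; exact hJ0
    rw [div_eq_iff hJ0]
    have hz' : (d : ℂ) / c + Complex.I = (c * Complex.I + d) / c := by field_simp; ring
    rw [hz']
    have key' : (c : ℂ)⁻¹ ^ 2 * (-1 / ((c * Complex.I + d) / c)) * (c * Complex.I + d) = -(c : ℂ)⁻¹ := by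
      field_simp
    rw [add_mul, key']
    field_simp
    linear_combination -hdet'
  · have hθ : ∀ x y hy m, (uT x * aT y hy * kT m).θ = m := by
      intro x y hy m
      have := chart_theta (x, Real.log y, m)
      simpa only [chart, Real.exp_log hy] using this
    -- The central factor is moved to the far right, where it merely adds mπ to the angle.
    rw [mul_assoc, mul_assoc, kT_int_pi_mul, ← mul_assoc, ← mul_assoc, kT_mul_theta]
    -- An upper triangular left factor has an automorphy factor independent of z, so its correction
    -- angle is zero.
    have hlow : (uT (p.g 0 0 / c) * aT (c⁻¹ ^ 2) (by positivity) * (wT * uT (d / c))).θ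
        = (wT * uT (d / c)).θ := by
      rw [Gtilde.mul_theta, Gtilde.corr]
      have h1 : ∀ z, J (uT (p.g 0 0 / c) * aT (c⁻¹ ^ 2) (by positivity)).g z
          = ((1 / √(c⁻¹ ^ 2) : ℝ) : ℂ) := by
        intro z
        have : J (uT (p.g 0 0 / c) * aT (c⁻¹ ^ 2) (by positivity)).g z
          = J (uM (p.g 0 0 / c) * aM (c⁻¹ ^ 2) (by positivity)) z := rfl
        rw [this, J_apply]
        simp [SL_mul_apply, uM_apply, aM_apply]
      have h2 : ((1 / √(c⁻¹ ^ 2) : ℝ) : ℂ) ≠ 0 := by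
        have : 0 < 1 / √(c⁻¹ ^ 2) := by positivity
        exact_mod_cast this.ne'
      have h3 := hθ (p.g 0 0 / c) (c⁻¹ ^ 2) (by positivity) 0
      rw [kT_zero, mul_one] at h3
      rw [h1, h1, div_self h2, h3]
      simp
    rw [hlow, wT_mul_uT_theta]
    have : (J p.g Complex.I / (c : ℂ)) = ((d / c : ℝ) : ℂ) + Complex.I := by
      rw [hJ]; push_cast; field_simp; ring
    rw [← this]
    linarith

theorem iota_of_int (μ ν : ℂ) (f : ℝ → ℂ) (p : Gtilde) (hc : p.g 1 0 ≠ 0) (m : ℤ)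
    (hm : p.θ + (J p.g Complex.I / ((p.g 1 0 : ℝ) : ℂ)).arg = m * Real.pi) :
    iota μ ν f p = Complex.exp (Real.pi * m * Complex.I * μ)
      * ((|p.g 1 0| : ℝ) : ℂ) ^ (-2 * ν - 1) * f (-(p.g 1 1) / (p.g 1 0)) := by
  rw [iota, if_neg hc, hm]
  congr 3
  push_cast; ring

/-- A function with the left transformation law is determined on the big cell by its restriction
to `w̃ ũ(-x)`. -/
theorem eq_iota_of_law {μ ν : ℂ} {F : Gtilde → ℂ}
    (hF : ∀ (x y : ℝ) (hy : 0 < y) (m : ℤ) (g : Gtilde),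
      F (uT x * aT y hy * kT (m * Real.pi) * g)
        = Complex.exp (Real.pi * m * Complex.I * μ) * (y : ℂ) ^ (ν + 1 / 2) * F g)
    (p : Gtilde) (hc : p.g 1 0 ≠ 0) :
    F p = iota μ ν (fun x => F (wT * uT (-x))) p := by
  obtain ⟨m, hm⟩ := exists_int_angle p hc
  rw [iota_of_int μ ν _ p hc m hm]
  conv_lhs => rw [bruhat p hc m hm]
  rw [hF]
  have e : -(-(p.g 1 1) / p.g 1 0) = p.g 1 1 / p.g 1 0 := by rw [neg_div, neg_neg]
  rw [e]
  congr 2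
  generalize p.g 1 0 = c at hc
  have hpos : 0 < |c| := abs_pos.2 hc
  -- With y = |c|^{-2} the factor y^{ν+1/2} becomes |c|^{-2ν-1}; the powers combine because the
  -- logarithm of a positive real number has imaginary part 0.
  have e1 : ((c⁻¹ ^ 2 : ℝ) : ℂ) = ((|c| ^ (-2 : ℝ) : ℝ) : ℂ) := by
    congr 1
    rw [Real.rpow_neg hpos.le, ← sq_abs, abs_inv]
    norm_num
  rw [e1, Complex.ofReal_cpow hpos.le, ← Complex.cpow_mul]
  · congr 1; push_cast; ring
  · rw [← Complex.ofReal_log hpos.le, ← Complex.ofReal_mul, Complex.ofReal_im]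
    linarith [Real.pi_pos]
  · rw [← Complex.ofReal_log hpos.le, ← Complex.ofReal_mul, Complex.ofReal_im]
    exact Real.pi_pos.le

theorem iota_wT_mul_uT (μ ν : ℂ) (f : ℝ → ℂ) (x : ℝ) : iota μ ν f (wT * uT (-x)) = f x := by
  obtain ⟨h1, h2⟩ := wT_mul_uT_g (-x)
  have : (wT * uT (-x)).θ + (J (wT * uT (-x)).g Complex.I / (((wT * uT (-x)).g 1 0 : ℝ) : ℂ)).arg
      = ((0 : ℤ) : ℝ) * Real.pi := by
    rw [wT_mul_uT_theta, J_apply, h1, h2]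
    have : ((1 : ℝ) : ℂ) * Complex.I + ((-x : ℝ) : ℂ) = ((-x : ℝ) : ℂ) + Complex.I := by
      push_cast; ring
    rw [this]; simp
  rw [iota_of_int μ ν f _ (by rw [h1]; norm_num) 0 this, h1, h2]
  simp

/-- `f_{μ,ν,∞}` with the value `0` at `0`. -/
def tw (μ ν : ℂ) (f : ℝ → ℂ) (x : ℝ) : ℂ := if x = 0 then 0 else twist μ ν f x

/-- The bottom row of `ubT x` is (x, 1), so the argument of f is -1/x. The Bruhat angle is 0 for x >
0 and π for x < 0; the resulting factors 1 and e^{πiμ} are e^{πiμ/2} times the sign factor of the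
twist. -/
theorem iota_ubT (μ ν : ℂ) (f : ℝ → ℂ) (x : ℝ) :
    iota μ ν f (ubT x) = Complex.exp (Real.pi * Complex.I * μ / 2) * tw μ ν f x := by
  obtain ⟨h1, h2⟩ := ubT_g x
  rcases lt_trichotomy x 0 with hx | rfl | hx
  · have : (ubT x).θ + (J (ubT x).g Complex.I / (((ubT x).g 1 0 : ℝ) : ℂ)).arg
        = ((1 : ℤ) : ℝ) * Real.pi := by
      rw [ubT_theta, J_apply, h1, h2]
      have e : ((x : ℝ) : ℂ) * Complex.I + ((1 : ℝ) : ℂ) = 1 + x * Complex.I := by push_cast; ring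
      have e2 : (1 + (x : ℂ) * Complex.I) / x = (((-x)⁻¹ : ℝ) : ℂ) * (-(1 + x * Complex.I)) := by
        have : (x : ℂ) ≠ 0 := by exact_mod_cast hx.ne
        push_cast; field_simp
      rw [e, e2, Complex.arg_real_mul _ (by simpa using hx),
        Complex.arg_neg_eq_arg_add_pi_of_im_neg (by simpa using hx)]
      simp
    rw [iota_of_int μ ν f _ (by rw [h1]; exact hx.ne) 1 this, h1, h2, tw, if_neg hx.ne, twist,
      sign_neg hx, ← mul_assoc, ← mul_assoc, ← Complex.exp_add, neg_div]
    congr 3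
    push_cast; simp
  · rw [iota, tw, if_pos h1, if_pos rfl, mul_zero]
  · have : (ubT x).θ + (J (ubT x).g Complex.I / (((ubT x).g 1 0 : ℝ) : ℂ)).arg
        = ((0 : ℤ) : ℝ) * Real.pi := by
      rw [ubT_theta, J_apply, h1, h2]
      have e : ((x : ℝ) : ℂ) * Complex.I + ((1 : ℝ) : ℂ) = 1 + x * Complex.I := by push_cast; ring
      have e2 : (1 + (x : ℂ) * Complex.I) / x = ((x⁻¹ : ℝ) : ℂ) * (1 + x * Complex.I) := by
        push_cast; field_simp
      rw [e, e2, Complex.arg_real_mul _ (by simpa using hx)]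
      simp
    rw [iota_of_int μ ν f _ (by rw [h1]; exact hx.ne') 0 this, h1, h2, tw, if_neg hx.ne', twist,
      sign_pos hx, ← mul_assoc, ← mul_assoc, ← Complex.exp_add, neg_div]
    congr 3
    push_cast; simp; ring

/-! ### Smooth maps into the covering group -/

/-- The Iwasawa coordinates of an element of the covering group. -/
def coords (q : Gtilde) : ℝ × ℝ × ℝ :=
  (((q.g • UpperHalfPlane.I : UpperHalfPlane) : ℂ).re,
    Real.log ((q.g • UpperHalfPlane.I : UpperHalfPlane) : ℂ).im, q.θ)

theorem chart_coords (q : Gtilde) : chart (coords q) = q := by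
  apply ext_smul
  · apply UpperHalfPlane.ext
    have hpos : 0 < ((q.g • UpperHalfPlane.I : UpperHalfPlane) : ℂ).im := UpperHalfPlane.im_pos _
    rw [chart_smul, kM_smul_I]
    simp only [coords, Real.exp_log hpos]
    exact Complex.re_add_im _
  · rw [chart_theta]; rfl

/-- A map into the covering group is smooth if its Iwasawa coordinates are smooth. -/
def IsSmoothMap {E : Type*} [NormedAddCommGroup E] [NormedSpace ℝ E] (h : E → Gtilde) : Prop :=
  ContDiff ℝ ∞ fun e => coords (h e)

section SmoothMap

variable {E : Type*} [NormedAddCommGroup E] [NormedSpace ℝ E]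

theorem coords_chart (p : ℝ × ℝ × ℝ) : coords (chart p) = p :=
  chart_injective (chart_coords _)

theorem isSmoothMap_chart {c : E → ℝ × ℝ × ℝ} (hc : ContDiff ℝ ∞ c) :
    IsSmoothMap fun e => chart (c e) := by
  unfold IsSmoothMap
  simpa only [coords_chart] using hc

theorem IsSmoothMap.smul_I {h : E → Gtilde} (hh : IsSmoothMap h) :
    ContDiff ℝ ∞ fun e => (((h e).g • UpperHalfPlane.I : UpperHalfPlane) : ℂ) := by
  have h1 : ContDiff ℝ ∞ fun e => (coords (h e)).1 := contDiff_fst.comp hh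
  have h2 : ContDiff ℝ ∞ fun e => (coords (h e)).2.1 :=
    contDiff_fst.comp (contDiff_snd.comp hh)
  have e : (fun e => (((h e).g • UpperHalfPlane.I : UpperHalfPlane) : ℂ))
      = fun e => (((coords (h e)).1 : ℝ) : ℂ)
        + ((Real.exp (coords (h e)).2.1 : ℝ) : ℂ) * Complex.I := by
    funext e
    have := chart_smul (coords (h e)) UpperHalfPlane.I
    rwa [chart_coords, kM_smul_I] at this
  rw [e]
  exact (Complex.ofRealCLM.contDiff.comp h1).add
    ((Complex.ofRealCLM.contDiff.comp (Real.contDiff_exp.comp h2)).mul contDiff_const)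

theorem IsSmoothMap.theta {h : E → Gtilde} (hh : IsSmoothMap h) :
    ContDiff ℝ ∞ fun e => (h e).θ :=
  contDiff_snd.comp (contDiff_snd.comp hh)

/-- In Iwasawa coordinates multiplication is given by `chartMul`, whose only delicate ingredient is
the correction angle. That angle is the imaginary part of a logarithm of a quotient that never
leaves the slit plane. -/
theorem IsSmoothMap.mul {h₁ h₂ : E → Gtilde} (hh₁ : IsSmoothMap h₁) (hh₂ : IsSmoothMap h₂) :
    IsSmoothMap fun e => h₁ e * h₂ e := by
  have hz := hh₂.smul_I
  set z : E → UpperHalfPlane := fun e => (h₂ e).g • UpperHalfPlane.I with hzdef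
  have hθ := hh₁.theta
  have h1 : ContDiff ℝ ∞ fun e => (coords (h₁ e)).1 := contDiff_fst.comp hh₁
  have h2 : ContDiff ℝ ∞ fun e => (coords (h₁ e)).2.1 :=
    contDiff_fst.comp (contDiff_snd.comp hh₁)
  have hcos : ContDiff ℝ ∞ fun e => ((Real.cos (h₁ e).θ : ℝ) : ℂ) :=
    Complex.ofRealCLM.contDiff.comp (Real.contDiff_cos.comp hθ)
  have hsin : ContDiff ℝ ∞ fun e => ((Real.sin (h₁ e).θ : ℝ) : ℂ) :=
    Complex.ofRealCLM.contDiff.comp (Real.contDiff_sin.comp hθ)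
  have hJ : ∀ w : E → UpperHalfPlane, ContDiff ℝ ∞ (fun e => ((w e : UpperHalfPlane) : ℂ)) →
      ContDiff ℝ ∞ fun e => J (kM (h₁ e).θ) (w e) := by
    intro w hw
    simp only [J_kM, Complex.ofReal_neg]
    exact (hsin.neg.mul hw).add hcos
  have hform : (fun e => ((kM (h₁ e).θ • z e : UpperHalfPlane) : ℂ))
      = fun e => (((Real.cos (h₁ e).θ : ℝ) : ℂ) * z e + ((Real.sin (h₁ e).θ : ℝ) : ℂ))
        * (J (kM (h₁ e).θ) (z e))⁻¹ := by
    funext e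
    rw [coe_smul, div_eq_mul_inv]; simp [kM]
  have hk : ContDiff ℝ ∞ fun e => ((kM (h₁ e).θ • z e : UpperHalfPlane) : ℂ) := by
    rw [hform]
    exact ((hcos.mul hz).add hsin).mul ((hJ z hz).inv fun e => J_ne_zero _ _)
  have hre := Complex.reCLM.contDiff.comp hk
  have him := Complex.imCLM.contDiff.comp hk
  have hc : ContDiff ℝ ∞ fun e => Gtilde.corr (kM (h₁ e).θ) (h₂ e).g := by
    have hq : ContDiff ℝ ∞ fun e =>
        J (kM (h₁ e).θ) (z e) / J (kM (h₁ e).θ) UpperHalfPlane.I :=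
      (hJ z hz).mul ((hJ (fun _ => UpperHalfPlane.I) contDiff_const).inv fun e => J_ne_zero _ _)
    have hlog : ContDiff ℝ ∞ fun e =>
        Complex.log (J (kM (h₁ e).θ) (z e) / J (kM (h₁ e).θ) UpperHalfPlane.I) := by
      rw [contDiff_iff_contDiffAt]
      intro e
      exact ((Complex.contDiffAt_log (div_mem_slitPlane _ _ _)).restrict_scalars ℝ).comp e
        hq.contDiffAt
    have := Complex.imCLM.contDiff.comp hlog
    convert this using 1
    funext p
    simp [Gtilde.corr, hzdef, Complex.log_im]
  have key : (fun e => h₁ e * h₂ e) = fun e => chart (chartMul (h₂ e) (coords (h₁ e))) := by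
    funext e
    rw [← chart_mul, chart_coords]
  rw [key]
  apply isSmoothMap_chart
  unfold chartMul
  refine ContDiff.prodMk ?_ (ContDiff.prodMk ?_ ?_)
  · exact h1.add ((Real.contDiff_exp.comp h2).mul hre)
  · exact h2.add (ContDiff.log him fun e => (kM (h₁ e).θ • z e).im_pos.ne')
  · exact (hθ.add hh₂.theta).sub hc

theorem isSmoothMap_const (q : Gtilde) : IsSmoothMap fun _ : E => q := contDiff_const

theorem isSmoothMap_uT {f : E → ℝ} (hf : ContDiff ℝ ∞ f) : IsSmoothMap fun e => uT (f e) := by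
  have : (fun e => uT (f e)) = fun e => chart (f e, 0, 0) := by
    funext e
    apply ext_smul
    · apply UpperHalfPlane.ext
      rw [chart_smul, kM_smul_I]; simp [uT, uM_smul]
    · rw [chart_theta]; rfl
  rw [this]
  exact isSmoothMap_chart (hf.prodMk contDiff_const)

theorem isSmoothMap_kT {f : E → ℝ} (hf : ContDiff ℝ ∞ f) : IsSmoothMap fun e => kT (f e) := by
  have : (fun e => kT (f e)) = fun e => chart (0, 0, f e) := by
    funext e
    apply ext_smul
    · apply UpperHalfPlane.ext
      rw [chart_smul, kM_smul_I]
      have := kM_smul_I (f e)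
      simp only [kT, this]; simp
    · rw [chart_theta]; rfl
  rw [this]
  exact isSmoothMap_chart (contDiff_const.prodMk (contDiff_const.prodMk hf))

theorem isSmoothMap_ubT {f : E → ℝ} (hf : ContDiff ℝ ∞ f) : IsSmoothMap fun e => ubT (f e) :=
  ((isSmoothMap_const _).mul (isSmoothMap_uT hf.neg)).mul (isSmoothMap_const _)

theorem isSmoothMap_aT {f : E → ℝ} (hf : ContDiff ℝ ∞ f) :
    IsSmoothMap fun e => aT (Real.exp (f e)) (Real.exp_pos _) := by
  have : (fun e => aT (Real.exp (f e)) (Real.exp_pos _)) = fun e => chart (0, f e, 0) := by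
    funext e
    rw [chart, uT_zero, kT_zero, one_mul, mul_one]
  rw [this]
  exact isSmoothMap_chart (contDiff_const.prodMk (hf.prodMk contDiff_const))

theorem isSmoothMap_oneParam (X : Sl2Basis) {f : E → ℝ} (hf : ContDiff ℝ ∞ f) :
    IsSmoothMap fun e => oneParam X (f e) := by
  cases X
  · exact isSmoothMap_aT (contDiff_const.mul hf)
  · exact isSmoothMap_uT hf
  · exact isSmoothMap_ubT hf

theorem IsSmooth.comp {F : Gtilde → ℂ} (hF : IsSmooth F) {h : E → Gtilde} (hh : IsSmoothMap h) :
    ContDiff ℝ ∞ fun e => F (h e) := by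
  have : (fun e => F (h e)) = (fun p => F (chart p)) ∘ fun e => coords (h e) := by
    funext e
    simp only [Function.comp, chart_coords]
  rw [this]
  exact ContDiff.comp hF hh

theorem hasDerivAt_snd {Φ : E × ℝ → ℂ} (hΦ : ContDiff ℝ ∞ Φ) (q : E × ℝ) :
    HasDerivAt (fun t => Φ (q.1, t)) (fderiv ℝ Φ q (0, 1)) q.2 := by
  have h1 : HasFDerivAt Φ (fderiv ℝ Φ q) q :=
    (hΦ.differentiable (by simp)).differentiableAt.hasFDerivAt
  have h2 : HasDerivAt (fun t : ℝ => (q.1, t)) ((0 : E), (1 : ℝ)) q.2 :=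
    (hasDerivAt_const _ _).prodMk (hasDerivAt_id _)
  exact h1.comp_hasDerivAt (f := fun t : ℝ => (q.1, t)) q.2 h2

theorem contDiff_deriv_snd {Φ : E × ℝ → ℂ} (hΦ : ContDiff ℝ ∞ Φ) :
    ContDiff ℝ ∞ fun q : E × ℝ => deriv (fun t => Φ (q.1, t)) q.2 := by
  have : (fun q : E × ℝ => deriv (fun t => Φ (q.1, t)) q.2)
      = fun q => fderiv ℝ Φ q (0, 1) := by
    funext q
    exact (hasDerivAt_snd hΦ q).deriv
  rw [this]
  exact (hΦ.fderiv_right (m := ∞) (by simp)).clm_apply contDiff_const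

end SmoothMap

/-! ### The derived action -/

/-- The left transformation law of the principal series. -/
def Law (μ ν : ℂ) (F : Gtilde → ℂ) : Prop :=
  ∀ (x y : ℝ) (hy : 0 < y) (m : ℤ) (g : Gtilde),
    F (uT x * aT y hy * kT (m * Real.pi) * g)
      = Complex.exp (Real.pi * m * Complex.I * μ) * (y : ℂ) ^ (ν + 1 / 2) * F g

theorem IsSmooth.lieDeriv {F : Gtilde → ℂ} (hF : IsSmooth F) (X : Sl2Basis) :
    IsSmooth (lieDeriv X F) := by
  have h1 : ContDiff ℝ ∞ fun q : (ℝ × ℝ × ℝ) × ℝ => F (chart q.1 * oneParam X q.2) :=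
    hF.comp ((isSmoothMap_chart contDiff_fst).mul (isSmoothMap_oneParam X contDiff_snd))
  have h2 := contDiff_deriv_snd h1
  have h3 : ContDiff ℝ ∞ fun p : ℝ × ℝ × ℝ => (p, (0 : ℝ)) := contDiff_id.prodMk contDiff_const
  have h4 := ContDiff.comp h2 h3
  change ContDiff ℝ ∞ fun p : ℝ × ℝ × ℝ => deriv (fun t : ℝ => F (chart p * oneParam X t)) 0
  simpa only [Function.comp_def] using h4

theorem Law.lieDeriv {μ ν : ℂ} {F : Gtilde → ℂ} (hF : Law μ ν F) (X : Sl2Basis) :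
    Law μ ν (lieDeriv X F) := by
  intro x y hy m g
  simp only [AutoDist.lieDeriv, mul_assoc _ g, hF x y hy m]
  exact deriv_const_mul_field _

theorem IsSmooth.wordDeriv {F : Gtilde → ℂ} (hF : IsSmooth F) (w : List Sl2Basis) :
    IsSmooth (wordDeriv w F) := by
  induction w with
  | nil => exact hF
  | cons X w ih => exact IsSmooth.lieDeriv ih X

theorem Law.wordDeriv {μ ν : ℂ} {F : Gtilde → ℂ} (hF : Law μ ν F) (w : List Sl2Basis) :
    Law μ ν (wordDeriv w F) := by
  induction w with
  | nil => exact hF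
  | cons X w ih => exact Law.lieDeriv ih X

/-! ### Bounds by seminorms -/

theorem norm_le_seminormQ {F : Gtilde → ℂ} (hF : IsSmooth F) (w : List Sl2Basis) {θ : ℝ}
    (hθ : θ ∈ Set.Ico (-Real.pi) Real.pi) : ‖wordDeriv w F (kT θ)‖ ≤ seminormQ w F := by
  have hc : Continuous fun θ : ℝ => ‖wordDeriv w F (kT θ)‖ :=
    ((hF.wordDeriv w).comp (isSmoothMap_kT contDiff_id)).continuous.norm
  have hb : BddAbove (Set.range fun θ : Set.Ico (-Real.pi) Real.pi => ‖wordDeriv w F (kT θ)‖) := by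
    have := (isCompact_Icc (a := -Real.pi) (b := Real.pi)).bddAbove_image hc.continuousOn
    refine this.mono ?_
    rintro _ ⟨θ, rfl⟩
    exact ⟨θ, Set.Ico_subset_Icc_self θ.2, rfl⟩
  exact le_ciSup hb ⟨θ, hθ⟩

theorem seminormQ_nonneg (F : Gtilde → ℂ) (w : List Sl2Basis) : 0 ≤ seminormQ w F :=
  Real.iSup_nonneg fun _ => norm_nonneg _

/-- The angles of w̃ũ(-x) and of `ubT x` are negatives of principal arguments, hence lie in exactly
the interval over which the seminorms take their supremum. -/
theorem neg_arg_mem (z : ℂ) : -z.arg ∈ Set.Ico (-Real.pi) Real.pi := by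
  have := Complex.arg_mem_Ioc z
  constructor <;> linarith [this.1, this.2]

theorem Law.norm_chart {μ ν : ℂ} {F : Gtilde → ℂ} (hF : Law μ ν F) (p : ℝ × ℝ × ℝ) :
    ‖F (chart p)‖ = Real.exp (p.2.1 * (ν.re + 1 / 2)) * ‖F (kT p.2.2)‖ := by
  have := hF p.1 (Real.exp p.2.1) (Real.exp_pos _) 0 (kT p.2.2)
  rw [Int.cast_zero, zero_mul, kT_zero, mul_one] at this
  rw [chart, this]
  simp only [Int.cast_zero, mul_zero, zero_mul, Complex.exp_zero, one_mul, norm_mul]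
  rw [Complex.norm_cpow_eq_rpow_re_of_pos (Real.exp_pos _), ← Real.exp_mul]
  simp

theorem wT_mul_uT_im (x : ℝ) :
    (((wT * uT (-x)).g • UpperHalfPlane.I : UpperHalfPlane) : ℂ).im = (1 + x ^ 2)⁻¹ := by
  rw [wT_mul_uT_smul]
  simp [Complex.div_im, Complex.normSq_apply]
  ring

/-- The height y = (1+x²)^{-1} stays in [1/2, 1] for |x| ≤ 1, so the factor y^{Re ν + 1/2} relating
F(q) to its value on the compact part is bounded by 2^{|Re ν + 1/2|}. -/
theorem Law.norm_le_of_abs_le_one {μ ν : ℂ} {F : Gtilde → ℂ} (hF : Law μ ν F) (q : Gtilde) {x : ℝ}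
    (hx : |x| ≤ 1)
    (hq : ((q.g • UpperHalfPlane.I : UpperHalfPlane) : ℂ).im = (1 + x ^ 2)⁻¹) :
    ‖F q‖ ≤ Real.exp (Real.log 2 * |ν.re + 1 / 2|) * ‖F (kT q.θ)‖ := by
  have := hF.norm_chart (coords q)
  rw [chart_coords] at this
  rw [this]
  refine mul_le_mul_of_nonneg_right (Real.exp_le_exp.2 ?_) (norm_nonneg _)
  have h1 : (coords q).2.1 = -Real.log (1 + x ^ 2) := by
    rw [coords, hq, Real.log_inv]
  have h2 : 0 ≤ Real.log (1 + x ^ 2) := Real.log_nonneg (by nlinarith [sq_nonneg x])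
  have h3 : Real.log (1 + x ^ 2) ≤ Real.log 2 :=
    Real.log_le_log (by positivity) (by nlinarith [abs_le.1 hx, sq_abs x, abs_nonneg x])
  rw [h1]
  calc -Real.log (1 + x ^ 2) * (ν.re + 1 / 2) ≤ |-Real.log (1 + x ^ 2) * (ν.re + 1 / 2)| :=
        le_abs_self _
    _ = Real.log (1 + x ^ 2) * |ν.re + 1 / 2| := by rw [abs_mul, abs_neg, abs_of_nonneg h2]
    _ ≤ _ := by gcongr

/-- The constant that compares values near the base points with values on the compact part. -/
def cmpConst (ν : ℂ) : ℝ := Real.exp (Real.log 2 * |ν.re + 1 / 2|)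

theorem norm_wordDeriv_wT_le {μ ν : ℂ} (F : PS μ ν) (w : List Sl2Basis) {x : ℝ} (hx : |x| ≤ 1) :
    ‖wordDeriv w F (wT * uT (-x))‖ ≤ cmpConst ν * seminormQ w F := by
  refine ((Law.wordDeriv F.2.1 w).norm_le_of_abs_le_one _ hx (wT_mul_uT_im x)).trans ?_
  rw [wT_mul_uT_theta]
  exact mul_le_mul_of_nonneg_left (norm_le_seminormQ F.2.2 w (neg_arg_mem _)) (Real.exp_pos _).le

theorem norm_wordDeriv_ubT_le {μ ν : ℂ} (F : PS μ ν) (w : List Sl2Basis) {x : ℝ} (hx : |x| ≤ 1) :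
    ‖wordDeriv w F (ubT x)‖ ≤ cmpConst ν * seminormQ w F := by
  have h : (((ubT x).g • UpperHalfPlane.I : UpperHalfPlane) : ℂ).im = (1 + x ^ 2)⁻¹ := by
    rw [ubT, wT_inv, mul_kT_smul, wT_mul_uT_im]
  refine ((Law.wordDeriv F.2.1 w).norm_le_of_abs_le_one _ hx h).trans ?_
  rw [ubT_theta]
  exact mul_le_mul_of_nonneg_left (norm_le_seminormQ F.2.2 w (neg_arg_mem _)) (Real.exp_pos _).le

/-! ### The two coordinate functions of an element of the principal series -/

/-- The restriction of `F` to the line `w̃ ũ(-x)`. -/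
def lineFn (F : Gtilde → ℂ) (x : ℝ) : ℂ := F (wT * uT (-x))

/-- The coordinate of `F` near the point at infinity. -/
def inftyFn (μ : ℂ) (F : Gtilde → ℂ) (u : ℝ) : ℂ :=
  Complex.exp (-(Real.pi * Complex.I * μ / 2)) * F (ubT u)

theorem contDiff_lineFn {F : Gtilde → ℂ} (hF : IsSmooth F) : ContDiff ℝ ∞ (lineFn F) :=
  hF.comp ((isSmoothMap_const _).mul (isSmoothMap_uT contDiff_neg))

theorem contDiff_inftyFn (μ : ℂ) {F : Gtilde → ℂ} (hF : IsSmooth F) :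
    ContDiff ℝ ∞ (inftyFn μ F) :=
  contDiff_const.mul (hF.comp (isSmoothMap_ubT contDiff_id))

/-- The minus sign arises because the line is parametrised by ũ(-x): right multiplication by ũ(t)
moves x to x - t. -/
theorem lineFn_lieDeriv (F : Gtilde → ℂ) (x : ℝ) :
    lineFn (lieDeriv .Ep F) x = -deriv (lineFn F) x := by
  have : (fun t : ℝ => F (wT * uT (-x) * oneParam .Ep t)) = fun t => lineFn F (x - t) := by
    funext t
    rw [lineFn, oneParam, mul_assoc, uT_mul]
    congr 3; ring
  rw [lineFn, lieDeriv, this, deriv_comp_const_sub, sub_zero]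

theorem lineFn_wordDeriv (F : Gtilde → ℂ) (m : ℕ) :
    lineFn (wordDeriv (List.replicate m .Ep) F)
      = fun x => (-1) ^ m * iteratedDeriv m (lineFn F) x := by
  induction m with
  | zero => funext x; simp [wordDeriv]
  | succ m ih =>
    funext x
    have : wordDeriv (List.replicate (m + 1) .Ep) F
        = lieDeriv .Ep (wordDeriv (List.replicate m .Ep) F) := rfl
    rw [this, lineFn_lieDeriv, ih, deriv_const_mul_field, iteratedDeriv_succ, pow_succ]
    ring

theorem ubT_lieDeriv (F : Gtilde → ℂ) (u : ℝ) :
    lieDeriv .Em F (ubT u) = deriv (fun u => F (ubT u)) u := by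
  have : (fun t : ℝ => F (ubT u * oneParam .Em t)) = fun t => (fun u => F (ubT u)) (u + t) := by
    funext t
    rw [oneParam, ubT_mul]
  rw [lieDeriv, this, deriv_comp_const_add (f := fun u => F (ubT u)), add_zero]

theorem ubT_wordDeriv (F : Gtilde → ℂ) (m : ℕ) :
    (fun u => wordDeriv (List.replicate m .Em) F (ubT u))
      = iteratedDeriv m (fun u => F (ubT u)) := by
  induction m with
  | zero => funext x; simp [wordDeriv]
  | succ m ih =>
    funext x
    have : wordDeriv (List.replicate (m + 1) .Em) F
        = lieDeriv .Em (wordDeriv (List.replicate m .Em) F) := rfl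
    rw [this, ubT_lieDeriv, ih, iteratedDeriv_succ]

theorem iteratedDeriv_inftyFn (μ : ℂ) (F : Gtilde → ℂ) (m : ℕ) (u : ℝ) :
    iteratedDeriv m (inftyFn μ F) u = Complex.exp (-(Real.pi * Complex.I * μ / 2))
      * wordDeriv (List.replicate m .Em) F (ubT u) := by
  have := congrFun (ubT_wordDeriv F m) u
  rw [this]
  exact iteratedDeriv_const_mul_field _ _

theorem aT_one : aT 1 one_pos = 1 := by
  apply ext_smul
  · apply UpperHalfPlane.ext
    simp [aT, aM_smul]
  · rfl

theorem Law.kT_int_pi {μ ν : ℂ} {F : Gtilde → ℂ} (hF : Law μ ν F) (m : ℤ) (g : Gtilde) :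
    F (kT (m * Real.pi) * g) = Complex.exp (Real.pi * m * Complex.I * μ) * F g := by
  have := hF 0 1 one_pos m g
  rw [uT_zero, aT_one, one_mul, one_mul] at this
  rw [this]; simp

theorem wT_mul_uT_mul_wT (x : ℝ) : wT * uT (-x) * wT = ubT x * kT ((-1 : ℤ) * Real.pi) := by
  rw [ubT, mul_assoc (wT * uT (-x)), wT_inv, ← wT_eq]

theorem ubT_mul_wT (x : ℝ) : ubT x * wT = wT * uT (-x) := by
  rw [ubT, inv_mul_cancel_right]

/-- One has w̃ũ(-x)w̃ = `ubT x` k̃(-π), and the central factor contributes e^{-πiμ}, turning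
e^{πiμ/2} into e^{-πiμ/2}. -/
theorem lineFn_inftyMap {μ ν : ℂ} {F : Gtilde → ℂ} (hF : Law μ ν F) :
    lineFn (inftyMap μ F) = inftyFn μ F := by
  funext x
  rw [lineFn, inftyMap, rho, wT_mul_uT_mul_wT, ← kT_int_pi_mul, hF.kT_int_pi, inftyFn, ← mul_assoc,
    ← Complex.exp_add]
  congr 2
  push_cast; ring

/-- E₊ acting on F_∞ differentiates its restriction to the line, which is the coordinate of F at
infinity. From here on the functionals δ_∞^{(m)} are treated purely as jets at 0. -/
theorem deltaInfty_eq {μ ν : ℂ} (m : ℕ) (F : PS μ ν) :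
    deltaInfty μ ν m F = (-1) ^ m * iteratedDeriv m (inftyFn μ F) 0 := by
  have h := congrFun (lineFn_wordDeriv (inftyMap μ F) m) 0
  rw [lineFn_inftyMap F.2.1, lineFn, neg_zero, uT_zero, mul_one] at h
  exact h

/-! ### The twist -/

theorem tw_zero_right (μ ν : ℂ) (f : ℝ → ℂ) : tw μ ν f 0 = 0 := if_pos rfl

theorem tw_of_ne (μ ν : ℂ) (f : ℝ → ℂ) {x : ℝ} (hx : x ≠ 0) : tw μ ν f x = twist μ ν f x :=
  if_neg hx

theorem abs_cpow {x : ℝ} (hx : x ≠ 0) (z : ℂ) :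
    ((|x| : ℝ) : ℂ) ^ z = Complex.exp (z * (Real.log x : ℝ)) := by
  have h : ((|x| : ℝ) : ℂ) ≠ 0 := by simpa using hx
  rw [Complex.cpow_def_of_ne_zero h, ← Complex.ofReal_log (abs_nonneg x), Real.log_abs, mul_comm]

/-- The sign factor of the twist. -/
def sgnFactor (μ : ℂ) (x : ℝ) : ℂ :=
  Complex.exp (-((SignType.sign x : ℝ) : ℂ) * Real.pi * Complex.I * μ / 2)

theorem tw_eq_exp (μ ν : ℂ) (f : ℝ → ℂ) {x : ℝ} (hx : x ≠ 0) :
    tw μ ν f x = sgnFactor μ x * Complex.exp ((-2 * ν - 1) * (Real.log x : ℝ)) * f (-1 / x) := by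
  rw [tw_of_ne _ _ _ hx, twist, abs_cpow hx, sgnFactor]

theorem sgnFactor_neg_inv_mul (μ : ℂ) {x : ℝ} (hx : x ≠ 0) :
    sgnFactor μ x * sgnFactor μ (-1 / x) = 1 := by
  rw [sgnFactor, sgnFactor, ← Complex.exp_add]
  rcases lt_or_gt_of_ne hx with h | h
  · have h' : 0 < -1 / x := div_pos_of_neg_of_neg (by norm_num) h
    rw [sign_neg h, sign_pos h']; simp; ring_nf; simp
  · have h' : -1 / x < 0 := div_neg_of_neg_of_pos (by norm_num) h
    rw [sign_pos h, sign_neg h']; simp; ring_nf; simp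

/-- The map x ↦ -1/x is an involution that reverses signs and inverts absolute values, so both the
sign factors and the powers cancel. The twist can therefore be read in either direction between the
two coordinates. -/
theorem tw_tw (μ ν : ℂ) (f : ℝ → ℂ) {x : ℝ} (hx : x ≠ 0) : tw μ ν (tw μ ν f) x = f x := by
  have hx' : -1 / x ≠ 0 := div_ne_zero (by norm_num) hx
  have e : -1 / (-1 / x) = x := by field_simp
  have hl : Real.log (-1 / x) = -Real.log x := by
    rw [neg_div, Real.log_neg_eq_log, one_div, Real.log_inv]
  rw [tw_eq_exp _ _ _ hx, tw_eq_exp _ _ _ hx', e, hl]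
  have h1 := sgnFactor_neg_inv_mul μ hx
  have h2 : Complex.exp ((-2 * ν - 1) * (Real.log x : ℝ))
      * Complex.exp ((-2 * ν - 1) * ((-Real.log x : ℝ) : ℂ)) = 1 := by
    rw [← Complex.exp_add]; push_cast; ring_nf; simp
  linear_combination (f x * Complex.exp ((-2 * ν - 1) * (Real.log x : ℝ))
      * Complex.exp ((-2 * ν - 1) * ((-Real.log x : ℝ) : ℂ))) * h1 + f x * h2

theorem inftyFn_eq_tw {μ ν : ℂ} {F : Gtilde → ℂ} (hF : Law μ ν F) {u : ℝ} (hu : u ≠ 0) :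
    inftyFn μ F u = tw μ ν (lineFn F) u := by
  have h : (ubT u).g 1 0 ≠ 0 := by rw [(ubT_g u).1]; exact hu
  rw [inftyFn, eq_iota_of_law hF _ h, iota_ubT, ← mul_assoc, ← Complex.exp_add, neg_add_cancel,
    Complex.exp_zero, one_mul]
  rfl

theorem tw_congr (μ ν : ℂ) {f g : ℝ → ℂ} {x : ℝ} (h : x ≠ 0 → f (-1 / x) = g (-1 / x)) :
    tw μ ν f x = tw μ ν g x := by
  by_cases hx : x = 0
  · simp [tw, hx]
  · simp only [tw_eq_exp _ _ _ hx, h hx]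

theorem lineFn_eq_tw {μ ν : ℂ} {F : Gtilde → ℂ} (hF : Law μ ν F) {x : ℝ} (hx : x ≠ 0) :
    lineFn F x = tw μ ν (inftyFn μ F) x := by
  rw [← tw_tw μ ν (lineFn F) hx]
  refine tw_congr _ _ fun _ => ?_
  rw [inftyFn_eq_tw hF (div_ne_zero (by norm_num) hx)]

theorem tw_add (μ ν : ℂ) (f g : ℝ → ℂ) (x : ℝ) :
    tw μ ν (fun u => f u + g u) x = tw μ ν f x + tw μ ν g x := by
  by_cases hx : x = 0
  · simp [tw, hx]
  · simp only [tw_eq_exp _ _ _ hx]; ring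

theorem tw_sub (μ ν : ℂ) (f g : ℝ → ℂ) (x : ℝ) :
    tw μ ν (fun u => f u - g u) x = tw μ ν f x - tw μ ν g x := by
  by_cases hx : x = 0
  · simp [tw, hx]
  · simp only [tw_eq_exp _ _ _ hx]; ring

theorem tw_const_mul (μ ν c : ℂ) (f : ℝ → ℂ) (x : ℝ) :
    tw μ ν (fun u => c * f u) x = c * tw μ ν f x := by
  by_cases hx : x = 0
  · simp [tw, hx]
  · simp only [tw_eq_exp _ _ _ hx]; ring

theorem tw_sum (μ ν : ℂ) {ι : Type*} (s : Finset ι) (f : ι → ℝ → ℂ) (x : ℝ) :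
    tw μ ν (fun u => ∑ i ∈ s, f i u) x = ∑ i ∈ s, tw μ ν (f i) x := by
  by_cases hx : x = 0
  · simp [tw, hx]
  · simp only [tw_eq_exp _ _ _ hx, Finset.mul_sum]

/-- The operator that corresponds to `d/dx` under the twist. -/
def dOp (s : ℂ) (f : ℝ → ℂ) (u : ℝ) : ℂ := (u : ℂ) ^ 2 * deriv f u + (2 * s + 1) * u * f u

theorem contDiff_dOp (s : ℂ) {f : ℝ → ℂ} (hf : ContDiff ℝ ∞ f) : ContDiff ℝ ∞ (dOp s f) := by
  have h1 : ContDiff ℝ ∞ (fun u : ℝ => (u : ℂ)) := Complex.ofRealCLM.contDiff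
  have h2 : ContDiff ℝ ∞ (deriv f) := (contDiff_infty_iff_deriv.1 hf).2
  exact ((h1.pow 2).mul h2).add ((contDiff_const.mul h1).mul hf)

theorem contDiff_dOp_iterate (s : ℂ) {f : ℝ → ℂ} (hf : ContDiff ℝ ∞ f) (N : ℕ) :
    ContDiff ℝ ∞ ((dOp s)^[N] f) := by
  induction N with
  | zero => exact hf
  | succ N ih => rw [Function.iterate_succ_apply']; exact contDiff_dOp s ih

theorem sgnFactor_eventuallyEq (μ : ℂ) {x : ℝ} (hx : x ≠ 0) :
    ∀ᶠ y in 𝓝 x, sgnFactor μ y = sgnFactor μ x := by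
  rcases lt_or_gt_of_ne hx with h | h
  · filter_upwards [gt_mem_nhds h] with y hy
    rw [sgnFactor, sgnFactor, sign_neg h, sign_neg hy]
  · filter_upwards [lt_mem_nhds h] with y hy
    rw [sgnFactor, sgnFactor, sign_pos h, sign_pos hy]

/-- Put u = -1/x. The chain rule contributes x^{-2} = u² in front of f'(u), the logarithmic
derivative (-2s-1)/x of the power is (2s+1)u, and the sign factor is locally constant. Together
these are `dOp`. -/
theorem hasDerivAt_tw (μ s : ℂ) {f : ℝ → ℂ} (hf : Differentiable ℝ f) {x : ℝ} (hx : x ≠ 0) :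
    HasDerivAt (tw μ s f) (tw μ s (dOp s f) x) x := by
  have hev : tw μ s f =ᶠ[𝓝 x] fun x' => sgnFactor μ x
      * Complex.exp ((-2 * s - 1) * (Real.log x' : ℝ)) * f (-1 / x') := by
    filter_upwards [sgnFactor_eventuallyEq μ hx, isOpen_ne.mem_nhds hx] with y hy hy0
    rw [tw_eq_exp _ _ _ hy0, hy]
  refine HasDerivAt.congr_of_eventuallyEq ?_ hev
  have h1 : HasDerivAt (fun x' : ℝ => ((Real.log x' : ℝ) : ℂ)) ((x⁻¹ : ℝ) : ℂ) x :=
    (Real.hasDerivAt_log hx).ofReal_comp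
  have h2 := ((h1.const_mul (-2 * s - 1)).cexp).const_mul (sgnFactor μ x)
  have h3 : HasDerivAt (fun x' : ℝ => -1 / x') (1 / x ^ 2) x := by
    have h := (hasDerivAt_inv hx).const_mul (-1)
    rw [neg_mul_neg, one_mul, ← one_div] at h
    exact h
  have h4 : HasDerivAt (fun x' : ℝ => f (-1 / x')) ((1 / x ^ 2 : ℝ) • deriv f (-1 / x)) x :=
    HasDerivAt.scomp x (hf _).hasDerivAt h3
  refine (h2.mul h4).congr_deriv ?_
  have hx' : (x : ℂ) ≠ 0 := by exact_mod_cast hx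
  rw [tw_eq_exp _ _ _ hx, dOp, Complex.real_smul]
  push_cast
  field_simp
  ring

theorem iteratedDeriv_tw (μ s : ℂ) {f : ℝ → ℂ} (hf : ContDiff ℝ ∞ f) (N : ℕ) {x : ℝ}
    (hx : x ≠ 0) : iteratedDeriv N (tw μ s f) x = tw μ s ((dOp s)^[N] f) x := by
  induction N generalizing x with
  | zero => simp
  | succ N ih =>
    rw [iteratedDeriv_succ, Function.iterate_succ_apply']
    have hev : iteratedDeriv N (tw μ s f) =ᶠ[𝓝 x] tw μ s ((dOp s)^[N] f) := by
      filter_upwards [isOpen_ne.mem_nhds hx] with y hy using ih hy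
    rw [hev.deriv_eq]
    exact (hasDerivAt_tw μ s ((contDiff_dOp_iterate s hf N).differentiable (by simp)) hx).deriv

/-- The coefficients of the powers of `dOp`. -/
def dCoeff (s : ℂ) : ℕ → ℕ → ℂ
  | 0, 0 => 1
  | 0, _ + 1 => 0
  | N + 1, 0 => (N + 2 * s + 1) * dCoeff s N 0
  | N + 1, k + 1 => (N + (k + 1) + 2 * s + 1) * dCoeff s N (k + 1) + dCoeff s N k

theorem differentiable_dCoeff (N k : ℕ) : Differentiable ℂ fun s => dCoeff s N k := by
  induction N generalizing k with
  | zero => cases k <;> simp [dCoeff]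
  | succ N ih =>
    cases k with
    | zero => simp only [dCoeff]; exact (by fun_prop : Differentiable ℂ fun s : ℂ =>
        ((N : ℂ) + 2 * s + 1)).mul (ih 0)
    | succ k => simp only [dCoeff]; exact ((by fun_prop : Differentiable ℂ fun s : ℂ =>
        ((N : ℂ) + (k + 1) + 2 * s + 1)).mul (ih (k + 1))).add (ih k)

theorem dCoeff_eq_zero (s : ℂ) {N k : ℕ} (h : N < k) : dCoeff s N k = 0 := by
  induction N generalizing k with
  | zero => obtain ⟨k, rfl⟩ := Nat.exists_eq_succ_of_ne_zero h.ne'; rfl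
  | succ N ih =>
    obtain ⟨k, rfl⟩ := Nat.exists_eq_succ_of_ne_zero (Nat.ne_of_gt (Nat.zero_lt_of_lt h))
    rw [dCoeff, ih (by omega), ih (by omega)]; simp

/-- One application sends u^{N+k} f^{(k)} to u^{N+1+(k+1)} f^{(k+1)} + (N+k+2s+1) u^{N+1+k} f^{(k)}.
Two features are used later: every term is divisible by u^N, and the dependence on s sits in the
coefficients alone. -/
theorem dOp_iterate (s : ℂ) {f : ℝ → ℂ} (hf : ContDiff ℝ ∞ f) (N : ℕ) :
    (dOp s)^[N] f = fun u : ℝ => ∑ k ∈ Finset.range (N + 1),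
      dCoeff s N k * ((u : ℂ) ^ (N + k) * iteratedDeriv k f u) := by
  induction N with
  | zero => funext u; simp [dCoeff]
  | succ N ih =>
    funext u
    rw [Function.iterate_succ_apply', ih, dOp]
    have hd : HasDerivAt (fun u : ℝ => ∑ k ∈ Finset.range (N + 1),
        dCoeff s N k * ((u : ℂ) ^ (N + k) * iteratedDeriv k f u))
        (∑ k ∈ Finset.range (N + 1), dCoeff s N k * ((((N + k : ℕ) : ℂ) * (u : ℂ) ^ (N + k - 1) * ((1 : ℝ) : ℂ))
          * iteratedDeriv k f u + (u : ℂ) ^ (N + k) * iteratedDeriv (k + 1) f u)) u := by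
      refine HasDerivAt.fun_sum fun k _ => HasDerivAt.const_mul _ (HasDerivAt.mul ?_ ?_)
      · exact ((hasDerivAt_id u).ofReal_comp).pow (N + k)
      · rw [iteratedDeriv_succ]
        exact ((hf.differentiable_iteratedDeriv k (by
          exact_mod_cast ENat.natCast_lt_top k)) u).hasDerivAt
    rw [hd.deriv, Finset.mul_sum, Finset.mul_sum, ← Finset.sum_add_distrib]
    have e : ∀ k, (u : ℂ) ^ 2 * (dCoeff s N k * ((((N + k : ℕ) : ℂ) * (u : ℂ) ^ (N + k - 1) * ((1 : ℝ) : ℂ))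
          * iteratedDeriv k f u + (u : ℂ) ^ (N + k) * iteratedDeriv (k + 1) f u))
        + (2 * s + 1) * u * (dCoeff s N k * ((u : ℂ) ^ (N + k) * iteratedDeriv k f u))
        = (N + k + 2 * s + 1) * dCoeff s N k * ((u : ℂ) ^ (N + 1 + k) * iteratedDeriv k f u)
          + dCoeff s N k * ((u : ℂ) ^ (N + 1 + (k + 1)) * iteratedDeriv (k + 1) f u) := by
      intro k
      -- The exponent N + k - 1 is truncated when N + k = 0, but then the factor N + k kills the
      -- term.
      have : (u : ℂ) ^ 2 * (((N + k : ℕ) : ℂ) * (u : ℂ) ^ (N + k - 1))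
          = ((N + k : ℕ) : ℂ) * (u : ℂ) ^ (N + 1 + k) := by
        rcases Nat.eq_zero_or_pos (N + k) with h | h
        · simp [h]
        · obtain ⟨j, hj⟩ := Nat.exists_eq_succ_of_ne_zero h.ne'
          have : N + 1 + k = j + 2 := by omega
          rw [hj, this]; simp only [Nat.succ_sub_one]; ring
      push_cast at this ⊢
      linear_combination (dCoeff s N k * iteratedDeriv k f u) * this
    simp only [e]
    rw [Finset.sum_add_distrib, Finset.sum_range_succ' (fun k => dCoeff s (N + 1) k *
      ((u : ℂ) ^ (N + 1 + k) * iteratedDeriv k f u))]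
    simp only [dCoeff, add_mul (_ * _) (dCoeff s N _) _, Finset.sum_add_distrib]
    -- The sum can be extended by one index and shifted because the coefficient with k = N + 1 is
    -- zero.
    have h2 : ∑ k ∈ Finset.range (N + 1), (N + k + 2 * s + 1) * dCoeff s N k *
          ((u : ℂ) ^ (N + 1 + k) * iteratedDeriv k f u)
        = ∑ k ∈ Finset.range (N + 1), (N + (k + 1) + 2 * s + 1) * dCoeff s N (k + 1) *
          ((u : ℂ) ^ (N + 1 + (k + 1)) * iteratedDeriv (k + 1) f u)
          + (N + 2 * s + 1) * dCoeff s N 0 * ((u : ℂ) ^ (N + 1 + 0) * iteratedDeriv 0 f u) := by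
      have := Finset.sum_range_succ' (fun k : ℕ => (N + k + 2 * s + 1) * dCoeff s N k *
          ((u : ℂ) ^ (N + 1 + k) * iteratedDeriv k f u)) (N + 1)
      rw [Finset.sum_range_succ, dCoeff_eq_zero s (Nat.lt_succ_self N)] at this
      simp only [mul_zero, zero_mul, add_zero] at this
      rw [this]
      push_cast
      simp
    rw [h2]
    ring

/-! ### Partitions -/

theorem iota_mul_left (μ ν : ℂ) (a f : ℝ → ℂ) (p : Gtilde) :
    iota μ ν (fun x => a x * f x) p = a (-(p.g 1 1) / p.g 1 0) * iota μ ν f p := by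
  unfold iota
  split_ifs
  · simp
  · ring

theorem mul_wT_g (p : Gtilde) : (p * wT).g 1 0 = p.g 1 1 ∧ (p * wT).g 1 1 = -p.g 1 0 := by
  have h1 := kM_apply (-(Real.pi / 2))
  have e : (p * wT).g = p.g * kM (-(Real.pi / 2)) := rfl
  constructor <;> simp [e, SL_mul_apply, h1]

theorem row_ne_zero (p : Gtilde) (h : p.g 1 0 = 0) : p.g 1 1 ≠ 0 := by
  intro h'
  apply Gtilde.J_I_ne_zero p.g
  rw [J_apply, h, h']; simp

theorem rho_law {μ ν : ℂ} {F : Gtilde → ℂ} (hF : Law μ ν F) (h : Gtilde) : Law μ ν (rho h F) := by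
  intro x y hy m g
  simp only [rho, mul_assoc _ g h]
  exact hF x y hy m (g * h)

/-- Right translation by w̃ carries the cell d ≠ 0 to the big cell c ≠ 0, so the Bruhat formula
applied to ρ(w̃⁻¹)F recovers F from its coordinate at infinity. -/
theorem eq_iota_inftyFn {μ ν : ℂ} {F : Gtilde → ℂ} (hF : Law μ ν F) (p : Gtilde)
    (hp : p.g 1 1 ≠ 0) :
    F p = Complex.exp (Real.pi * Complex.I * μ / 2) * iota μ ν (inftyFn μ F) (p * wT) := by
  have h := eq_iota_of_law (rho_law hF wT⁻¹) (p * wT) (by rw [(mul_wT_g p).1]; exact hp)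
  rw [rho, mul_inv_cancel_right] at h
  have e : inftyFn μ F = fun x => (fun _ => Complex.exp (-(Real.pi * Complex.I * μ / 2))) x
      * (fun x => rho wT⁻¹ F (wT * uT (-x))) x := by
    funext x; rfl
  rw [e, iota_mul_left, ← mul_assoc, ← Complex.exp_add, add_neg_cancel, Complex.exp_zero, one_mul]
  exact h

/-- A smooth cutoff function. -/
def cutoff : ContDiffBump (0 : ℝ) := ⟨1, 2, one_pos, one_lt_two⟩

theorem contDiff_cutoff : ContDiff ℝ ∞ (fun x : ℝ => ((cutoff x : ℝ) : ℂ)) :=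
  Complex.ofRealCLM.contDiff.comp cutoff.contDiff

theorem cutoff_eq_one {x : ℝ} (hx : |x| ≤ 1) : cutoff x = 1 :=
  cutoff.one_of_mem_closedBall (by simpa [cutoff] using hx)

theorem cutoff_eq_zero {x : ℝ} (hx : 2 ≤ |x|) : cutoff x = 0 :=
  cutoff.zero_of_le_dist (by simpa [cutoff] using hx)

/-- A cutoff χ(x) on the line and its complement 1 - χ(-1/u) near infinity form a partition of unity
on the circle of Bruhat cosets; multiplying the two coordinates of F by them gives the test
functions. -/
theorem exists_isPartition {μ ν : ℂ} (F : PS μ ν) : ∃ f, IsPartition μ ν F f := by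
  set ψ := inftyFn μ (F : Gtilde → ℂ) with hψ
  have hψs : ContDiff ℝ ∞ ψ := contDiff_inftyFn μ F.2.2
  -- The value at 0 is set by hand: there -1/0 = 0, and the formula would give 1 - χ(0) = 0 instead
  -- of the limit 1.
  set b : ℝ → ℂ := fun u => if u = 0 then 1 else 1 - ((cutoff (-1 / u) : ℝ) : ℂ) with hb
  have hb1 : ∀ u : ℝ, |u| < 1 / 2 → b u = 1 := by
    intro u hu
    by_cases h0 : u = 0
    · simp [hb, h0]
    · have : cutoff (-1 / u) = 0 := by
        apply cutoff_eq_zero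
        rw [abs_div, abs_neg, abs_one, le_div_iff₀ (abs_pos.2 h0)]; linarith
      simp [hb, h0, this]
  have hb0 : ∀ u : ℝ, 1 ≤ |u| → b u = 0 := by
    intro u hu
    have h0 : u ≠ 0 := by rintro rfl; norm_num at hu
    have : cutoff (-1 / u) = 1 := by
      apply cutoff_eq_one
      rw [abs_div, abs_neg, abs_one, div_le_one (abs_pos.2 h0)]; exact hu
    simp [hb, h0, this]
  have hbs : ContDiff ℝ ∞ b := by
    rw [contDiff_iff_contDiffAt]
    intro u
    by_cases h0 : u = 0
    · have : b =ᶠ[𝓝 u] fun _ => 1 := by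
        have : ∀ᶠ v : ℝ in 𝓝 u, |v| < 1 / 2 :=
          (continuous_abs.tendsto u).eventually (gt_mem_nhds (by rw [h0]; norm_num))
        filter_upwards [this] with v hv using hb1 v hv
      exact contDiffAt_const.congr_of_eventuallyEq this
    · have : b =ᶠ[𝓝 u] fun u => 1 - ((cutoff (-1 / u) : ℝ) : ℂ) := by
        filter_upwards [isOpen_ne.mem_nhds h0] with v hv
        exact if_neg hv
      refine ContDiffAt.congr_of_eventuallyEq ?_ this
      have h1 : ContDiffAt ℝ ∞ (fun u : ℝ => -1 / u) u := contDiffAt_const.div contDiffAt_id h0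
      exact contDiffAt_const.sub (contDiff_cutoff.contDiffAt.comp u h1)
  refine ⟨(fun x => ((cutoff x : ℝ) : ℂ) * lineFn F x, fun u => b u * ψ u), ⟨?_, ?_⟩, ⟨?_, ?_⟩, ?_⟩
  · exact contDiff_cutoff.mul (contDiff_lineFn F.2.2)
  · refine HasCompactSupport.of_support_subset_isCompact (isCompact_Icc (a := (-2 : ℝ)) (b := 2)) ?_
    intro x hx
    by_contra h
    apply hx
    have : cutoff x = 0 := cutoff_eq_zero (by
      by_contra h'
      push Not at h'
      exact h ⟨(abs_lt.1 h').1.le, (abs_lt.1 h').2.le⟩)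
    simp [this]
  · exact hbs.mul hψs
  · refine HasCompactSupport.of_support_subset_isCompact (isCompact_Icc (a := (-1 : ℝ)) (b := 1)) ?_
    intro x hx
    by_contra h
    apply hx
    have := hb0 x (by
      by_contra h'
      push Not at h'
      exact h ⟨(abs_lt.1 h').1.le, (abs_lt.1 h').2.le⟩)
    simp [this]
  · funext p
    simp only [Pi.add_apply, inftyMap, rho]
    obtain ⟨hw1, hw2⟩ := mul_wT_g p
    rw [iota_mul_left, iota_mul_left, hw1, hw2, neg_neg, mul_left_comm (Complex.exp _)]
    -- Where c = 0 or d = 0 only one of the two coordinates sees the point and its cutoff equals 1;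
    -- elsewhere both see it and the cutoffs add up to 1.
    by_cases hc : p.g 1 0 = 0
    · have hd := row_ne_zero p hc
      rw [hψ, ← eq_iota_inftyFn F.2.1 p hd, hc]
      have : iota μ ν (lineFn F) p = 0 := by rw [iota, if_pos hc]
      rw [this]
      simp [hb]
    · have h1 : (F : Gtilde → ℂ) p = iota μ ν (lineFn F) p := eq_iota_of_law F.2.1 p hc
      rw [← h1]
      by_cases hd : p.g 1 1 = 0
      · have : iota μ ν ψ (p * wT) = 0 := by rw [iota, if_pos (hw1.trans hd)]
        rw [this, hd]
        have : cutoff (-0 / p.g 1 0) = 1 := cutoff_eq_one (by simp)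
        rw [this]
        simp
      · rw [hψ, ← eq_iota_inftyFn F.2.1 p hd]
        have h0 : p.g 1 0 / p.g 1 1 ≠ 0 := div_ne_zero hc hd
        have h3 : -1 / (p.g 1 0 / p.g 1 1) = -p.g 1 1 / p.g 1 0 := by
          rw [div_div_eq_mul_div]; ring
        simp only [hb, if_neg h0, h3]
        ring

theorem partition_spec {μ ν : ℂ} (F : PS μ ν) : IsPartition μ ν F (partition μ ν F) :=
  Classical.epsilon_spec (exists_isPartition F)

theorem iota_mul_kT_neg_pi (μ ν : ℂ) (f : ℝ → ℂ) (p : Gtilde) :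
    iota μ ν f (p * kT ((-1 : ℤ) * Real.pi))
      = Complex.exp (-(Real.pi * Complex.I * μ)) * iota μ ν f p := by
  have e : (p * kT ((-1 : ℤ) * Real.pi)).g = p.g * kM ((-1 : ℤ) * Real.pi) := rfl
  have e0 : (p * kT ((-1 : ℤ) * Real.pi)).g 1 0 = -p.g 1 0 := by
    rw [e, SL_mul_apply]; simp [kM_apply]
  have e1 : (p * kT ((-1 : ℤ) * Real.pi)).g 1 1 = -p.g 1 1 := by
    rw [e, SL_mul_apply]; simp [kM_apply]
  have eJ : J (p * kT ((-1 : ℤ) * Real.pi)).g Complex.I = -J p.g Complex.I := by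
    rw [J_apply, J_apply, e0, e1]; push_cast; ring
  unfold iota
  rw [e0, e1, eJ, kT_mul_theta]
  by_cases hc : p.g 1 0 = 0
  · simp [hc]
  · rw [if_neg (neg_ne_zero.2 hc), if_neg hc, abs_neg, neg_div_neg_eq]
    rw [Complex.ofReal_neg, neg_div_neg_eq, ← mul_assoc, ← mul_assoc, ← Complex.exp_add]
    congr 3
    push_cast; ring

theorem lineFn_eq_of_isPartition {μ ν : ℂ} {F : Gtilde → ℂ} {f : (ℝ → ℂ) × (ℝ → ℂ)}
    (h : IsPartition μ ν F f) (x : ℝ) : lineFn F x = f.1 x + tw μ ν f.2 x := by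
  have h1 := congrFun h.2.2 (wT * uT (-x))
  rw [lineFn, ← h1, Pi.add_apply, iota_wT_mul_uT, inftyMap, rho, wT_mul_uT_mul_wT,
    iota_mul_kT_neg_pi, iota_ubT, ← mul_assoc, ← mul_assoc, ← Complex.exp_add, ← Complex.exp_add]
  have : (Real.pi * Complex.I * μ / 2 : ℂ) + -(Real.pi * Complex.I * μ)
      + Real.pi * Complex.I * μ / 2 = 0 := by ring
  rw [this, Complex.exp_zero, one_mul]

theorem inftyFn_eq_of_isPartition {μ ν : ℂ} {F : Gtilde → ℂ} {f : (ℝ → ℂ) × (ℝ → ℂ)}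
    (h : IsPartition μ ν F f) (u : ℝ) : inftyFn μ F u = tw μ ν f.1 u + f.2 u := by
  have h1 := congrFun h.2.2 (ubT u)
  rw [inftyFn, ← h1, Pi.add_apply, iota_ubT, inftyMap, rho, ubT_mul_wT, iota_wT_mul_uT, ← mul_add,
    ← mul_assoc, ← Complex.exp_add, neg_add_cancel, Complex.exp_zero, one_mul]

theorem IsTest.exists_bound {f : ℝ → ℂ} (hf : IsTest f) :
    ∃ A : ℝ, 1 ≤ A ∧ ∀ x, A < |x| → f x = 0 := by
  obtain ⟨A, hA⟩ := hf.2.isCompact.isBounded.subset_closedBall 0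
  refine ⟨max 1 A, le_max_left _ _, fun x hx => ?_⟩
  by_contra h
  have := hA (subset_tsupport f h)
  rw [mem_closedBall_zero_iff, Real.norm_eq_abs] at this
  exact absurd (lt_of_le_of_lt (le_max_right _ _) hx) (not_lt.2 this)

theorem tw_eventually_eq_zero {μ ν : ℂ} {f : ℝ → ℂ} {A : ℝ} (hA : 0 < A)
    (hf : ∀ x, A < |x| → f x = 0) {x : ℝ} (hx : |x| < A⁻¹) : tw μ ν f x = 0 := by
  by_cases h0 : x = 0
  · rw [h0, tw_zero_right]
  · rw [tw_eq_exp _ _ _ h0, hf, mul_zero]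
    rw [abs_div, abs_neg, abs_one, lt_div_iff₀ (abs_pos.2 h0)]
    calc A * |x| < A * A⁻¹ := by gcongr
      _ = 1 := mul_inv_cancel₀ hA.ne'

/-- The twist of the compactly supported f₁ vanishes near 0. Hence the jets of f₂ at 0 are those of
F at infinity, whatever partition was chosen. -/
theorem inftyFn_eventuallyEq {μ ν : ℂ} {F : Gtilde → ℂ} {f : (ℝ → ℂ) × (ℝ → ℂ)}
    (h : IsPartition μ ν F f) : inftyFn μ F =ᶠ[𝓝 0] f.2 := by
  obtain ⟨A, hA, hf⟩ := h.1.exists_bound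
  have hA0 : 0 < A := by linarith
  have : ∀ᶠ v : ℝ in 𝓝 0, |v| < A⁻¹ :=
    (continuous_abs.tendsto 0).eventually (gt_mem_nhds (by rw [abs_zero]; positivity))
  filter_upwards [this] with u hu
  rw [inftyFn_eq_of_isPartition h, tw_eventually_eq_zero hA0 hf hu, zero_add]

/-! ### Meromorphic continuation -/

/-- Identity theorem: on a preconnected set the order of f - g is infinite either everywhere or
nowhere. Agreement is stated on punctured neighbourhoods because values at poles carry no
information. -/
theorem eventuallyEq_of_meromorphicOn {f g : ℂ → ℂ} {U : Set ℂ} (hf : MeromorphicOn f U)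
    (hg : MeromorphicOn g U) (hU : IsPreconnected U) {x y : ℂ} (hx : x ∈ U) (hy : y ∈ U)
    (h : f =ᶠ[𝓝[≠] x] g) : f =ᶠ[𝓝[≠] y] g := by
  by_contra hne
  have hfg : MeromorphicOn (f - g) U := hf.sub hg
  have h1 : meromorphicOrderAt (f - g) y ≠ ⊤ := by
    intro h2
    rw [meromorphicOrderAt_eq_top_iff] at h2
    apply hne
    filter_upwards [h2] with z hz
    exact sub_eq_zero.1 hz
  have h2 := hfg.meromorphicOrderAt_ne_top_of_isPreconnected hU hy hx h1
  apply h2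
  rw [meromorphicOrderAt_eq_top_iff]
  filter_upwards [h] with z hz
  exact sub_eq_zero.2 hz

/-- The half-plane `-N < 2 Re s`. -/
def halfPl (N : ℕ) : Set ℂ := {s | -(N : ℝ) < 2 * s.re}

theorem isOpen_halfPl (N : ℕ) : IsOpen (halfPl N) :=
  isOpen_lt continuous_const (continuous_const.mul Complex.continuous_re)

theorem isPreconnected_halfPl (N : ℕ) : IsPreconnected (halfPl N) := by
  have : halfPl N = {s : ℂ | -(N : ℝ) / 2 < s.re} := by
    ext s; simp only [halfPl, Set.mem_ofPred_eq]; constructor <;> intro h <;> linarith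
  rw [this]
  exact (convex_halfSpace_re_gt _).isPreconnected

theorem eventuallyEq_nhdsNE_of_eqOn_re_pos {f g : ℂ → ℂ} (h : ∀ s : ℂ, 0 < s.re → f s = g s) :
    f =ᶠ[𝓝[≠] 1] g := by
  have h1 : {s : ℂ | 0 < s.re} ∈ 𝓝 (1 : ℂ) :=
    (isOpen_lt continuous_const Complex.continuous_re).mem_nhds (by simp)
  filter_upwards [mem_nhdsWithin_of_mem_nhds h1] with s hs using h s hs

theorem one_mem_halfPl (N : ℕ) : (1 : ℂ) ∈ halfPl N := by
  simp only [halfPl, Set.mem_ofPred_eq, Complex.one_re]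
  have : (0 : ℝ) ≤ N := N.cast_nonneg
  linarith

section Gluing

variable {g : ℂ → ℂ} {G : ℕ → ℂ → ℂ}

/-- The identity theorem makes the continuations on the growing half-planes compatible off isolated
points. Gluing them and passing to normal form gives the continuation on ℂ, and normalisation
changes nothing where the function is already analytic. -/
theorem exists_isMeroCont (hG : ∀ N, MeromorphicOn (G N) (halfPl N))
    (hgG : ∀ N s, 0 < s.re → G N s = g s) (hg : AnalyticOnNhd ℂ g {s | 0 < s.re}) :
    ∃ G', IsMeroCont g G' := by
  have hcomp : ∀ N M s, s ∈ halfPl N → s ∈ halfPl M → G N =ᶠ[𝓝[≠] s] G M := by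
    have aux : ∀ N M s, N ≤ M → s ∈ halfPl N → G N =ᶠ[𝓝[≠] s] G M := by
      intro N M s hNM hs
      have hsub : halfPl N ⊆ halfPl M := by
        intro z hz
        simp only [halfPl, Set.mem_ofPred_eq] at hz ⊢
        have : (N : ℝ) ≤ M := by exact_mod_cast hNM
        linarith
      refine eventuallyEq_of_meromorphicOn (hG N) (fun z hz => hG M z (hsub hz))
        (isPreconnected_halfPl N) (one_mem_halfPl N) hs ?_
      exact eventuallyEq_nhdsNE_of_eqOn_re_pos fun z hz => (hgG N z hz).trans (hgG M z hz).symm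
    intro N M s hN hM
    rcases le_total N M with h | h
    · exact aux N M s h hN
    · exact (aux M N s h hM).symm
  set n : ℂ → ℕ := fun s => ⌈2 * |s.re|⌉₊ + 1 with hn
  set H : ℂ → ℂ := fun s => G (n s) s with hH
  have hloc : ∀ s : ℂ, H =ᶠ[𝓝[≠] s] G (n s) := by
    intro s
    have hmem : ∀ z w : ℂ, |z.re - w.re| < 1 / 4 → w ∈ halfPl (n z) := by
      intro z w h
      simp only [halfPl, Set.mem_ofPred_eq, hn]
      push_cast
      have h1 := Nat.le_ceil (2 * |z.re|)
      have h2 := abs_lt.1 h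
      have h3 := neg_abs_le z.re
      linarith
    -- The index n(w) varies with w, but for w near s it is at most n(s) + 1, so only finitely many
    -- pieces must be compared and a common punctured neighbourhood exists.
    have hev : ∀ᶠ w in 𝓝[≠] s, ∀ N ∈ Finset.range (n s + 2), s ∈ halfPl N → G N w = G (n s) w := by
      rw [Filter.eventually_all_finset]
      intro N _
      by_cases h : s ∈ halfPl N
      · filter_upwards [hcomp N (n s) s h (hmem s s (by norm_num))] with w hw _ using hw
      · exact Eventually.of_forall fun w h' => absurd h' h
    have hnear : ∀ᶠ w in 𝓝 s, |w.re - s.re| < 1 / 4 := by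
      have hc : Continuous fun w : ℂ => |w.re - s.re| := by fun_prop
      exact (hc.tendsto s).eventually (gt_mem_nhds (by norm_num))
    filter_upwards [hev, mem_nhdsWithin_of_mem_nhds hnear] with w hw1 hw2
    refine hw1 (n w) ?_ (hmem w s hw2)
    rw [Finset.mem_range]
    have : ⌈2 * |w.re|⌉₊ ≤ ⌈2 * |s.re|⌉₊ + 1 := by
      rw [Nat.ceil_le]
      push_cast
      have h1 := Nat.le_ceil (2 * |s.re|)
      have h2 := abs_abs_sub_abs_le w.re s.re
      have h3 := le_abs_self (|w.re| - |s.re|)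
      linarith
    simp only [hn]; omega
  have hself : ∀ s, s ∈ halfPl (n s) := by
    intro s
    simp only [halfPl, Set.mem_ofPred_eq, hn]
    push_cast
    have h1 := Nat.le_ceil (2 * |s.re|)
    have h3 := neg_abs_le s.re
    linarith
  have hHm : MeromorphicOn H Set.univ := fun s _ =>
    ((hG (n s)) s (hself s)).congr (hloc s).symm
  refine ⟨toMeromorphicNFOn H Set.univ, meromorphicNFOn_toMeromorphicNFOn _ _, ?_⟩
  intro s hs
  have h1 : H =ᶠ[𝓝 s] g := by
    have : {s : ℂ | 0 < s.re} ∈ 𝓝 s :=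
      (isOpen_lt continuous_const Complex.continuous_re).mem_nhds hs
    filter_upwards [this] with z hz using hgG _ z hz
  have h2 : AnalyticAt ℂ H s := (hg s hs).congr h1.symm
  have h3 := toMeromorphicNFOn_eq_toMeromorphicNFAt hHm (Set.mem_univ s)
  rw [h3, toMeromorphicNFAt_eq_self.2 h2.meromorphicNFAt]
  exact h1.self_of_nhds

theorem meroCont_eventuallyEq (hG : ∀ N, MeromorphicOn (G N) (halfPl N))
    (hgG : ∀ N s, 0 < s.re → G N s = g s) (hg : AnalyticOnNhd ℂ g {s | 0 < s.re})
    {N : ℕ} {s : ℂ} (hs : s ∈ halfPl N) : meroCont g =ᶠ[𝓝[≠] s] G N := by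
  have h := Classical.epsilon_spec (exists_isMeroCont hG hgG hg)
  change IsMeroCont g (meroCont g) at h
  refine eventuallyEq_of_meromorphicOn (fun z _ => (h.1 (Set.mem_univ z)).meromorphicAt) (hG N)
        (isPreconnected_halfPl N) (one_mem_halfPl N) hs ?_
  exact eventuallyEq_nhdsNE_of_eqOn_re_pos fun z hz => (h.2 z hz).trans (hgG N z hz).symm

/-- Two functions in meromorphic normal form that agree on a punctured neighbourhood also agree at
the centre; an analytic function is in normal form. -/
theorem meroCont_eq (hG : ∀ N, MeromorphicOn (G N) (halfPl N))
    (hgG : ∀ N s, 0 < s.re → G N s = g s) (hg : AnalyticOnNhd ℂ g {s | 0 < s.re})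
    {N : ℕ} {s : ℂ} (hs : s ∈ halfPl N) (han : AnalyticAt ℂ (G N) s) : meroCont g s = G N s := by
  have h := Classical.epsilon_spec (exists_isMeroCont hG hgG hg)
  change IsMeroCont g (meroCont g) at h
  have h1 := meroCont_eventuallyEq hG hgG hg hs
  exact (((h.1 (Set.mem_univ s)).eventuallyEq_nhdsNE_iff_eventuallyEq_nhds
    han.meromorphicNFAt).1 h1).self_of_nhds

end Gluing

/-! ### Mellin transforms and twisted Fourier integrals -/

theorem integrable_of_halves {g : ℝ → ℂ} (h1 : IntegrableOn g (Set.Ioi 0))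
    (h2 : IntegrableOn (fun x => g (-x)) (Set.Ioi 0)) :
    Integrable g ∧ ∫ x, g x = (∫ x in Set.Ioi 0, g x) + ∫ x in Set.Ioi 0, g (-x) := by
  have h3 : IntegrableOn g (Set.Iic 0) := by
    rw [integrableOn_Iic_iff_integrableOn_Iio]
    have := (Measure.measurePreserving_neg (volume : Measure ℝ)).integrableOn_comp_preimage
      (Homeomorph.neg ℝ).measurableEmbedding (f := g) (s := Set.Iio 0)
    rw [← this]
    have e : (Neg.neg : ℝ → ℝ) ⁻¹' Set.Iio 0 = Set.Ioi 0 := by ext x; simp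
    rw [e]
    exact h2
  have hint : Integrable g := by
    rw [← integrableOn_univ, ← Set.Iic_union_Ioi (a := (0 : ℝ))]
    exact h3.union h1
  refine ⟨hint, ?_⟩
  rw [integral_comp_neg_Ioi, neg_zero, ← integral_add_compl (measurableSet_Ioi (a := (0 : ℝ))) hint,
    Set.compl_Ioi]

/-- Bounded support and vanishing to order `N` at `0`. -/
structure TwAdm (N : ℕ) (h : ℝ → ℂ) : Prop where
  measurable : Measurable h
  support : ∃ A : ℝ, 0 < A ∧ ∀ u, A < |u| → h u = 0
  bound : ∃ C : ℝ, 0 ≤ C ∧ ∀ u, ‖h u‖ ≤ C * |u| ^ N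

theorem TwAdm.comp_neg {N : ℕ} {h : ℝ → ℂ} (hh : TwAdm N h) : TwAdm N fun u => h (-u) where
  measurable := hh.measurable.comp measurable_neg
  support := by
    obtain ⟨A, hA, h1⟩ := hh.support
    exact ⟨A, hA, fun u hu => h1 _ (by rwa [abs_neg])⟩
  bound := by
    obtain ⟨C, hC, h1⟩ := hh.bound
    exact ⟨C, hC, fun u => by simpa using h1 (-u)⟩

/-- The exponential `e^{2πixy}`. -/
def eChar (x y : ℝ) : ℂ := Complex.exp (2 * Real.pi * Complex.I * x * y)

theorem norm_eChar (x y : ℝ) : ‖eChar x y‖ = 1 := by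
  rw [eChar, Complex.norm_exp]; simp

theorem continuous_eChar (y : ℝ) : Continuous fun x => eChar x y := by
  unfold eChar; fun_prop

/-- The kernel of the Mellin transform that computes one half of the twisted Fourier integral. -/
def mKer (h : ℝ → ℂ) (y x : ℝ) : ℂ := h (-1 / x) * eChar x y

theorem TwAdm.measurable_mKer {N : ℕ} {h : ℝ → ℂ} (hh : TwAdm N h) (y : ℝ) :
    Measurable (mKer h y) :=
  (hh.measurable.comp (measurable_const.div measurable_id)).mul (continuous_eChar y).measurable

/-- For small x > 0 the point -1/x lies outside the support of h, so the kernel vanishes near 0 and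
any exponent b is allowed. The Mellin integral is therefore constrained only at infinity. -/
theorem TwAdm.mKer_zero {N : ℕ} {h : ℝ → ℂ} (hh : TwAdm N h) (y b : ℝ) :
    mKer h y =O[𝓝[>] 0] fun x : ℝ => x ^ b := by
  obtain ⟨A, hA, h1⟩ := hh.support
  have : mKer h y =ᶠ[𝓝[>] 0] fun _ => 0 := by
    have h2 : Set.Ioo (0 : ℝ) A⁻¹ ∈ 𝓝[>] (0 : ℝ) := Ioo_mem_nhdsGT (by positivity)
    filter_upwards [h2] with x hx
    rw [mKer, h1, zero_mul]
    rw [abs_div, abs_neg, abs_one, abs_of_pos hx.1, lt_div_iff₀ hx.1]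
    calc A * x < A * A⁻¹ := by gcongr; exact hx.2
      _ = 1 := mul_inv_cancel₀ hA.ne'
  exact this.trans_isBigO (Asymptotics.isBigO_zero _ _)

theorem TwAdm.mKer_top {N : ℕ} {h : ℝ → ℂ} (hh : TwAdm N h) (y : ℝ) :
    mKer h y =O[atTop] fun x : ℝ => x ^ (-(N : ℝ)) := by
  obtain ⟨C, hC, h1⟩ := hh.bound
  refine Asymptotics.IsBigO.of_bound C ?_
  filter_upwards [eventually_gt_atTop 0] with x hx
  rw [mKer, norm_mul, norm_eChar, mul_one]
  refine (h1 _).trans_eq ?_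
  rw [Real.rpow_neg hx.le, Real.rpow_natCast, norm_inv, norm_pow, Real.norm_eq_abs, abs_div,
    abs_neg, abs_one, one_div, inv_pow]

theorem TwAdm.mKer_locallyIntegrableOn {N : ℕ} {h : ℝ → ℂ} (hh : TwAdm N h) (y : ℝ) :
    LocallyIntegrableOn (mKer h y) (Set.Ioi 0) := by
  obtain ⟨C, hC, h1⟩ := hh.bound
  have h2 : LocallyIntegrableOn (fun x : ℝ => C * (|x|⁻¹) ^ N) (Set.Ioi 0) := by
    refine ContinuousOn.locallyIntegrableOn (fun x hx => ?_) measurableSet_Ioi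
    have hx0 : |x| ≠ 0 := abs_ne_zero.2 (ne_of_gt hx)
    exact ((continuousAt_const.mul ((continuous_abs.continuousAt.inv₀ hx0).pow N))).continuousWithinAt
  refine h2.mono (hh.measurable_mKer y).aestronglyMeasurable (Eventually.of_forall fun x => ?_)
  rw [mKer, norm_mul, norm_eChar, mul_one, Real.norm_of_nonneg (by positivity)]
  refine (h1 _).trans_eq ?_
  rw [abs_div, abs_neg, abs_one, one_div]

theorem TwAdm.mellinConvergent {N : ℕ} {h : ℝ → ℂ} (hh : TwAdm N h) (y : ℝ) {z : ℂ}
    (hz : z.re < N) : MellinConvergent (mKer h y) z :=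
  mellinConvergent_of_isBigO_rpow (hh.mKer_locallyIntegrableOn y) (hh.mKer_top y) hz
    (hh.mKer_zero y (-(z.re - 1))) (by linarith)

theorem TwAdm.mellin_differentiableAt {N : ℕ} {h : ℝ → ℂ} (hh : TwAdm N h) (y : ℝ) {z : ℂ}
    (hz : z.re < N) : DifferentiableAt ℂ (mellin (mKer h y)) z :=
  mellin_differentiableAt_of_isBigO_rpow (hh.mKer_locallyIntegrableOn y) (hh.mKer_top y) hz
    (hh.mKer_zero y (-(z.re - 1))) (by linarith)

theorem sgnFactor_pos (μ : ℂ) {x : ℝ} (hx : 0 < x) :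
    sgnFactor μ x = Complex.exp (-(Real.pi * Complex.I * μ / 2)) := by
  rw [sgnFactor, sign_pos hx]; congr 1; simp; ring

theorem sgnFactor_neg (μ : ℂ) {x : ℝ} (hx : x < 0) :
    sgnFactor μ x = Complex.exp (Real.pi * Complex.I * μ / 2) := by
  rw [sgnFactor, sign_neg hx]; congr 1; simp

theorem tw_of_pos (μ s : ℂ) (h : ℝ → ℂ) {x : ℝ} (hx : 0 < x) :
    tw μ s h x = Complex.exp (-(Real.pi * Complex.I * μ / 2))
      * ((x : ℂ) ^ (-2 * s - 1) * h (-1 / x)) := by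
  rw [tw_eq_exp _ _ _ hx.ne', sgnFactor_pos μ hx, ← abs_cpow hx.ne', abs_of_pos hx, mul_assoc]

theorem tw_of_neg (μ s : ℂ) (h : ℝ → ℂ) {x : ℝ} (hx : 0 < x) :
    tw μ s h (-x) = Complex.exp (Real.pi * Complex.I * μ / 2)
      * ((x : ℂ) ^ (-2 * s - 1) * h (-(-1 / x))) := by
  have hx' : -x < 0 := neg_lt_zero.2 hx
  rw [tw_eq_exp _ _ _ hx'.ne, sgnFactor_neg μ hx', ← abs_cpow hx'.ne, abs_neg, abs_of_pos hx,
    mul_assoc, div_neg]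

theorem eChar_neg (x y : ℝ) : eChar (-x) y = eChar x (-y) := by
  unfold eChar; push_cast; ring_nf

/-- On each half-line |x|^{-2s-1} = |x|^{z-1} with z = -2s, so the integral is a pair of Mellin
transforms, the negative half being reflected by u ↦ -u, y ↦ -y. They converge for Re z < N, which
is the half-plane `halfPl N`. -/
theorem TwAdm.integrable_and_eq (μ : ℂ) {N : ℕ} {h : ℝ → ℂ} (hh : TwAdm N h) (y : ℝ) {s : ℂ}
    (hs : s ∈ halfPl N) :
    Integrable (fun x => tw μ s h x * eChar x y) ∧ ∫ x, tw μ s h x * eChar x y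
      = Complex.exp (-(Real.pi * Complex.I * μ / 2)) * mellin (mKer h y) (-2 * s)
      + Complex.exp (Real.pi * Complex.I * μ / 2)
        * mellin (mKer (fun u => h (-u)) (-y)) (-2 * s) := by
  have hz : (-2 * s).re < N := by
    simp only [halfPl, Set.mem_ofPred_eq] at hs
    simp; linarith
  have c1 := (hh.mellinConvergent y hz).const_mul (Complex.exp (-(Real.pi * Complex.I * μ / 2)))
  have c2 := (hh.comp_neg.mellinConvergent (-y) hz).const_mul
    (Complex.exp (Real.pi * Complex.I * μ / 2))
  have e1 : ∀ x ∈ Set.Ioi (0 : ℝ), Complex.exp (-(Real.pi * Complex.I * μ / 2))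
      * ((x : ℂ) ^ (-2 * s - 1) • mKer h y x) = tw μ s h x * eChar x y := by
    intro x hx
    rw [tw_of_pos μ s h hx, mKer, smul_eq_mul]; ring
  have e2 : ∀ x ∈ Set.Ioi (0 : ℝ), Complex.exp (Real.pi * Complex.I * μ / 2)
      * ((x : ℂ) ^ (-2 * s - 1) • mKer (fun u => h (-u)) (-y) x)
      = tw μ s h (-x) * eChar (-x) y := by
    intro x hx
    rw [tw_of_neg μ s h hx, mKer, smul_eq_mul, eChar_neg]; ring
  obtain ⟨hi, he⟩ := integrable_of_halves (g := fun x => tw μ s h x * eChar x y)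
    (IntegrableOn.congr_fun c1 e1 measurableSet_Ioi)
    (IntegrableOn.congr_fun c2 e2 measurableSet_Ioi)
  refine ⟨hi, ?_⟩
  rw [he, ← setIntegral_congr_fun measurableSet_Ioi e1, ← setIntegral_congr_fun measurableSet_Ioi e2,
    integral_const_mul, integral_const_mul]
  rfl

theorem tw_ae_eq (μ s : ℂ) (h : ℝ → ℂ) : tw μ s h =ᵐ[volume] twist μ s h := by
  have : {(0 : ℝ)}ᶜ ∈ ae (volume : Measure ℝ) := compl_mem_ae_iff.2 (by simp)
  filter_upwards [this] with x hx
  exact tw_of_ne μ s h hx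

theorem fourierT_twist (μ s : ℂ) (h : ℝ → ℂ) (y : ℝ) :
    fourierT (twist μ s h) y = ∫ x, tw μ s h x * eChar x y := by
  unfold fourierT
  refine integral_congr_ae ?_
  filter_upwards [tw_ae_eq μ s h] with x hx
  rw [hx]; rfl

theorem TwAdm.differentiableAt (μ : ℂ) {N : ℕ} {h : ℝ → ℂ} (hh : TwAdm N h) (y : ℝ) {s : ℂ}
    (hs : s ∈ halfPl N) : DifferentiableAt ℂ (fun s => ∫ x, tw μ s h x * eChar x y) s := by
  have hz : (-2 * s).re < N := by
    simp only [halfPl, Set.mem_ofPred_eq] at hs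
    simp; linarith
  have hev : (fun s => ∫ x, tw μ s h x * eChar x y) =ᶠ[𝓝 s] fun s =>
      Complex.exp (-(Real.pi * Complex.I * μ / 2)) * mellin (mKer h y) (-2 * s)
      + Complex.exp (Real.pi * Complex.I * μ / 2)
        * mellin (mKer (fun u => h (-u)) (-y)) (-2 * s) := by
    filter_upwards [(isOpen_halfPl N).mem_nhds hs] with z hz using
      (hh.integrable_and_eq μ y hz).2
  refine DifferentiableAt.congr_of_eventuallyEq ?_ hev
  have hl : DifferentiableAt ℂ (fun s : ℂ => -2 * s) s := by fun_prop
  exact (((hh.mellin_differentiableAt y hz).comp s hl).const_mul _).add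
    (((hh.comp_neg.mellin_differentiableAt (-y) hz).comp s hl).const_mul _)

theorem TwAdm.analyticAt (μ : ℂ) {N : ℕ} {h : ℝ → ℂ} (hh : TwAdm N h) (y : ℝ) {s : ℂ}
    (hs : s ∈ halfPl N) : AnalyticAt ℂ (fun s => ∫ x, tw μ s h x * eChar x y) s :=
  DifferentiableOn.analyticAt (fun _ hz => (hh.differentiableAt μ y hz).differentiableWithinAt)
    ((isOpen_halfPl N).mem_nhds hs)

/-! ### Taylor polynomials -/

/-- The Taylor polynomial of degree `< N` at `0`. -/
def tPoly (f : ℝ → ℂ) (N : ℕ) (u : ℝ) : ℂ :=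
  ∑ k ∈ Finset.range N, iteratedDeriv k f 0 / (k.factorial : ℂ) * (u : ℂ) ^ k

theorem norm_sub_tPoly_le_of_nonneg {f : ℝ → ℂ} (hf : ContDiff ℝ ∞ f) {N : ℕ} {C u : ℝ}
    (hC : ∀ v, |v| ≤ 1 → ‖iteratedDeriv N f v‖ ≤ C) (hu0 : 0 ≤ u) (hu : u ≤ 1) :
    ‖f u - tPoly f N u‖ ≤ C * u ^ N := by
  cases N with
  | zero => simpa [tPoly] using hC u (abs_le.2 ⟨by linarith, hu⟩)
  | succ n =>
    have hud : UniqueDiffOn ℝ (Set.Icc (0 : ℝ) 1) := uniqueDiffOn_Icc one_pos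
    have hw : ∀ k : ℕ, ∀ v ∈ Set.Icc (0 : ℝ) 1,
        iteratedDerivWithin k f (Set.Icc 0 1) v = iteratedDeriv k f v := by
      intro k v hv
      exact iteratedDerivWithin_eq_iteratedDeriv hud
        ((hf.of_le (by exact_mod_cast le_top)).contDiffAt) hv
    have h := taylor_mean_remainder_bound (f := f) (a := 0) (b := 1) (C := C) (x := u) (n := n)
      zero_le_one ((hf.of_le (by exact_mod_cast le_top)).contDiffOn) ⟨hu0, hu⟩ (by
        intro v hv
        rw [hw _ v hv]
        exact hC v (abs_le.2 ⟨by linarith [hv.1], hv.2⟩))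
    rw [taylor_within_apply] at h
    have e : ∑ k ∈ Finset.range (n + 1), ((k.factorial : ℝ)⁻¹ * (u - 0) ^ k) •
        iteratedDerivWithin k f (Set.Icc 0 1) 0 = tPoly f (n + 1) u := by
      refine Finset.sum_congr rfl fun k _ => ?_
      rw [hw k 0 ⟨le_rfl, zero_le_one⟩, Complex.real_smul]
      push_cast
      rw [sub_zero]; ring
    rw [e, sub_zero] at h
    have hC0 : 0 ≤ C := (norm_nonneg _).trans (hC 0 (by simp))
    refine h.trans ?_
    exact div_le_self (by positivity) (by exact_mod_cast Nat.one_le_iff_ne_zero.2 n.factorial_ne_zero)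

theorem tPoly_comp_neg (f : ℝ → ℂ) (N : ℕ) (u : ℝ) :
    tPoly (fun v => f (-v)) N u = tPoly f N (-u) := by
  refine Finset.sum_congr rfl fun k _ => ?_
  rw [iteratedDeriv_comp_neg, neg_zero, Complex.real_smul]
  push_cast
  rw [neg_pow (u : ℂ)]; ring

theorem norm_sub_tPoly_le {f : ℝ → ℂ} (hf : ContDiff ℝ ∞ f) {N : ℕ} {C u : ℝ}
    (hC : ∀ v, |v| ≤ 1 → ‖iteratedDeriv N f v‖ ≤ C) (hu : |u| ≤ 1) :
    ‖f u - tPoly f N u‖ ≤ C * |u| ^ N := by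
  rcases le_total 0 u with h | h
  · rw [abs_of_nonneg h] at hu ⊢
    exact norm_sub_tPoly_le_of_nonneg hf hC h hu
  · rw [abs_of_nonpos h] at hu ⊢
    have := norm_sub_tPoly_le_of_nonneg (f := fun v => f (-v)) (hf.comp contDiff_neg) (N := N)
      (C := C) (u := -u) (by
        intro v hv
        rw [iteratedDeriv_comp_neg, norm_smul, norm_pow, norm_neg, norm_one, one_pow, one_mul]
        exact hC _ (by rwa [abs_neg])) (by linarith) hu
    rwa [tPoly_comp_neg, neg_neg] at this

theorem exists_bound_iteratedDeriv {f : ℝ → ℂ} (hf : ContDiff ℝ ∞ f) (N : ℕ) (A : ℝ) :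
    ∃ C, 0 ≤ C ∧ ∀ v, |v| ≤ A → ‖iteratedDeriv N f v‖ ≤ C := by
  obtain ⟨C, hC⟩ := (isCompact_Icc (a := -A) (b := A)).exists_bound_of_continuousOn
    (hf.continuous_iteratedDeriv N (by exact_mod_cast le_top)).continuousOn
  exact ⟨max C 0, le_max_right _ _, fun v hv => (hC v (abs_le.1 hv)).trans (le_max_left _ _)⟩

/-- The Taylor polynomial cut off to `[-1, 1]`. -/
def tCut (f : ℝ → ℂ) (N : ℕ) (u : ℝ) : ℂ := if |u| ≤ 1 then tPoly f N u else 0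

theorem measurable_tCut (f : ℝ → ℂ) (N : ℕ) : Measurable (tCut f N) := by
  have hc : Continuous (tPoly f N) := by
    unfold tPoly
    refine continuous_finsetSum _ fun k _ => ?_
    exact continuous_const.mul (Complex.continuous_ofReal.pow k)
  exact Measurable.ite (measurableSet_le continuous_abs.measurable measurable_const) hc.measurable
    measurable_const

/-- On [-1, 1] the Taylor remainder is O(|u|^N); outside, the cut polynomial is 0 and f is bounded,
hence also O(|u|^N) because |u| > 1. -/
theorem twAdm_sub_tCut {f : ℝ → ℂ} (hf : IsTest f) (N : ℕ) :
    TwAdm N fun u => f u - tCut f N u where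
  measurable := hf.1.continuous.measurable.sub (measurable_tCut f N)
  support := by
    obtain ⟨A, hA, h⟩ := hf.exists_bound
    refine ⟨A, by linarith, fun u hu => ?_⟩
    rw [h u hu, tCut, if_neg (by linarith), sub_zero]
  bound := by
    obtain ⟨C, hC, h⟩ := exists_bound_iteratedDeriv hf.1 N 1
    obtain ⟨A, hA, h2⟩ := hf.exists_bound
    obtain ⟨D, hD, h3⟩ := exists_bound_iteratedDeriv hf.1 0 A
    refine ⟨max C D, hC.trans (le_max_left _ _), fun u => ?_⟩
    by_cases hu : |u| ≤ 1
    · rw [tCut, if_pos hu]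
      refine (norm_sub_tPoly_le hf.1 h hu).trans ?_
      gcongr; exact le_max_left _ _
    · rw [tCut, if_neg hu, sub_zero]
      push Not at hu
      have : ‖f u‖ ≤ D := by
        by_cases hA' : |u| ≤ A
        · simpa using h3 u hA'
        · rw [h2 u (not_le.1 hA'), norm_zero]; exact hD
      calc ‖f u‖ ≤ D := this
        _ ≤ max C D * 1 := by rw [mul_one]; exact le_max_right _ _
        _ ≤ _ := by gcongr; exact one_le_pow₀ hu.le

theorem twAdm_pow_mul_iteratedDeriv {f : ℝ → ℂ} (hf : IsTest f) (N k : ℕ) :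
    TwAdm N fun u => (u : ℂ) ^ (N + k) * iteratedDeriv k f u where
  measurable := by
    have := hf.1.continuous_iteratedDeriv k (by exact_mod_cast le_top)
    exact ((Complex.continuous_ofReal.pow _).mul this).measurable
  support := by
    obtain ⟨A, hA, h⟩ := hf.exists_bound
    refine ⟨A, by linarith, fun u hu => ?_⟩
    have : iteratedDeriv k f u = 0 := by
      have : f =ᶠ[𝓝 u] fun _ => 0 := by
        filter_upwards [(continuous_abs.tendsto u).eventually (lt_mem_nhds hu)] with v hv
        exact h v hv
      rw [this.iteratedDeriv_eq k]
      simp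
    rw [this, mul_zero]
  bound := by
    obtain ⟨A, hA, h⟩ := hf.exists_bound
    obtain ⟨D, hD, h3⟩ := exists_bound_iteratedDeriv hf.1 k A
    refine ⟨A ^ k * D, by positivity, fun u => ?_⟩
    by_cases hA' : |u| ≤ A
    · rw [norm_mul, norm_pow, Complex.norm_real, Real.norm_eq_abs, pow_add]
      calc |u| ^ N * |u| ^ k * ‖iteratedDeriv k f u‖ ≤ |u| ^ N * A ^ k * D := by
            gcongr; exact h3 u hA'
        _ = _ := by ring
    · have : iteratedDeriv k f u = 0 := by
        have : f =ᶠ[𝓝 u] fun _ => 0 := by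
          filter_upwards [(continuous_abs.tendsto u).eventually (lt_mem_nhds (not_le.1 hA'))]
            with v hv
          exact h v hv
        rw [this.iteratedDeriv_eq k]
        simp
      rw [this, mul_zero, norm_zero]
      positivity

/-! ### The continued twisted Fourier transform -/

theorem IsTest.dOp {f : ℝ → ℂ} (hf : IsTest f) (s : ℂ) : IsTest (dOp s f) := by
  refine ⟨contDiff_dOp s hf.1, ?_⟩
  exact (hf.2.deriv.mul_left).add (hf.2.mul_left)

theorem IsTest.dOp_iterate {f : ℝ → ℂ} (hf : IsTest f) (s : ℂ) (N : ℕ) :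
    IsTest ((AutoDist.dOp s)^[N] f) := by
  induction N with
  | zero => exact hf
  | succ N ih => rw [Function.iterate_succ_apply']; exact ih.dOp s

theorem twAdm_dOp_iterate {f : ℝ → ℂ} (hf : IsTest f) (s : ℂ) (N : ℕ) :
    TwAdm N ((dOp s)^[N] f) where
  measurable := (contDiff_dOp_iterate s hf.1 N).continuous.measurable
  support := by
    obtain ⟨A, hA, h⟩ := (hf.dOp_iterate s N).exists_bound
    exact ⟨A, by linarith, h⟩
  bound := by
    have h := fun k => (twAdm_pow_mul_iteratedDeriv hf N k).bound
    choose C hC h using h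
    refine ⟨∑ k ∈ Finset.range (N + 1), ‖dCoeff s N k‖ * C k,
      Finset.sum_nonneg fun k _ => mul_nonneg (norm_nonneg _) (hC k), fun u => ?_⟩
    rw [dOp_iterate s hf.1 N, Finset.sum_mul]
    refine (norm_sum_le _ _).trans (Finset.sum_le_sum fun k _ => ?_)
    rw [norm_mul, mul_assoc]
    exact mul_le_mul_of_nonneg_left (h k u) (norm_nonneg _)

/-- For a test function the derivative formula extends across x = 0, since -1/x leaves the support
and the twist vanishes near 0. This permits integration by parts over the whole line. -/
theorem IsTest.hasDerivAt_tw {f : ℝ → ℂ} (hf : IsTest f) (μ s : ℂ) (x : ℝ) :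
    HasDerivAt (tw μ s f) (tw μ s (AutoDist.dOp s f) x) x := by
  by_cases hx : x = 0
  · obtain ⟨A, hA, h⟩ := hf.exists_bound
    have hA0 : 0 < A := by linarith
    have : ∀ᶠ v : ℝ in 𝓝 x, |v| < A⁻¹ :=
      (continuous_abs.tendsto x).eventually (gt_mem_nhds (by rw [hx, abs_zero]; positivity))
    have h2 : tw μ s f =ᶠ[𝓝 x] fun _ => 0 := by
      filter_upwards [this] with u hu using tw_eventually_eq_zero hA0 h hu
    rw [hx, tw_zero_right, ← hx]
    exact (hasDerivAt_const x (0 : ℂ)).congr_of_eventuallyEq h2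
  · exact AutoDist.hasDerivAt_tw μ s (hf.1.differentiable (by simp)) hx

theorem hasDerivAt_eChar (x y : ℝ) :
    HasDerivAt (fun x => eChar x y) (2 * Real.pi * Complex.I * y * eChar x y) x := by
  have h : HasDerivAt (fun x : ℝ => (2 * Real.pi * Complex.I * x * y : ℂ))
      (2 * Real.pi * Complex.I * ((1 : ℝ) : ℂ) * y) x :=
    (((hasDerivAt_id x).ofReal_comp).const_mul _).mul_const _
  refine h.cexp.congr_deriv ?_
  rw [eChar]; push_cast; ring

theorem integral_mul_eChar_of_hasDerivAt {g g' : ℝ → ℂ} (hg : ∀ x, HasDerivAt g (g' x) x) (y : ℝ)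
    (h1 : Integrable fun x => g x * eChar x y) (h2 : Integrable fun x => g' x * eChar x y) :
    ∫ x, g' x * eChar x y = -(2 * Real.pi * Complex.I * y) * ∫ x, g x * eChar x y := by
  have h3 : Integrable fun x => g x * (2 * Real.pi * Complex.I * y * eChar x y) := by
    have := h1.const_mul (2 * Real.pi * Complex.I * y)
    refine this.congr (Eventually.of_forall fun x => ?_)
    simp only; ring
  have := integral_mul_deriv_eq_deriv_mul_of_integrable (u := g) (u' := g')
    (v := fun x => eChar x y) (fun x _ => hg x) (fun x _ => hasDerivAt_eChar x y) h3 h2 h1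
  have e : ∫ x, g x * (2 * Real.pi * Complex.I * y * eChar x y)
      = 2 * Real.pi * Complex.I * y * ∫ x, g x * eChar x y := by
    rw [← integral_const_mul]
    congr 1; funext x; ring
  rw [e] at this
  rw [neg_mul, this, neg_neg]

theorem mem_halfPl_of_re_pos {s : ℂ} (hs : 0 < s.re) (N : ℕ) : s ∈ halfPl N := by
  have : (0 : ℝ) ≤ N := N.cast_nonneg
  simp only [halfPl, Set.mem_ofPred_eq]; linarith

theorem halfPl_mono {N M : ℕ} (h : N ≤ M) : halfPl N ⊆ halfPl M := by
  intro z hz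
  simp only [halfPl, Set.mem_ofPred_eq] at hz ⊢
  have : (N : ℝ) ≤ M := by exact_mod_cast h
  linarith

theorem IsTest.twAdm_zero {f : ℝ → ℂ} (hf : IsTest f) : TwAdm 0 f := by
  have := twAdm_dOp_iterate hf 0 0
  simpa using this

/-- The analytic function on `-N < 2 Re s` that continues the twisted Fourier transform. -/
def contFn (μ : ℂ) (f : ℝ → ℂ) (y : ℝ) (N : ℕ) (s : ℂ) : ℂ :=
  ((-(2 * Real.pi * Complex.I * y)) ^ N)⁻¹ * ∫ x, tw μ s ((dOp s)^[N] f) x * eChar x y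

theorem two_pi_I_mul_ne_zero {y : ℝ} (hy : y ≠ 0) : -(2 * Real.pi * Complex.I * y : ℂ) ≠ 0 := by
  have : (y : ℂ) ≠ 0 := by exact_mod_cast hy
  simp [Real.pi_ne_zero, this]

/-- N-fold integration by parts: for Re s > 0 all the integrals converge absolutely, each derivative
of the twist is a `dOp`, and each step costs a factor -2πiy. -/
theorem contFn_of_re_pos (μ : ℂ) {f : ℝ → ℂ} (hf : IsTest f) {y : ℝ} (hy : y ≠ 0) (N : ℕ) {s : ℂ}
    (hs : 0 < s.re) : contFn μ f y N s = fourierT (twist μ s f) y := by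
  rw [fourierT_twist, contFn]
  have hne := two_pi_I_mul_ne_zero hy
  rw [inv_mul_eq_iff_eq_mul₀ (pow_ne_zero _ hne)]
  induction N with
  | zero => simp
  | succ N ih =>
    rw [Function.iterate_succ_apply', integral_mul_eChar_of_hasDerivAt
      ((hf.dOp_iterate s N).hasDerivAt_tw μ s) y, ih]
    · ring
    · exact ((hf.dOp_iterate s N).twAdm_zero.integrable_and_eq μ y (mem_halfPl_of_re_pos hs 0)).1
    · exact (((hf.dOp_iterate s N).dOp s).twAdm_zero.integrable_and_eq μ y
        (mem_halfPl_of_re_pos hs 0)).1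

/-- The integrand depends on s through the twist and also through `dOp s`. Expanding the iterate
separates the two: entire coefficients times twisted integrals of functions independent of s, which
are analytic as Mellin transforms. -/
theorem analyticAt_contFn (μ : ℂ) {f : ℝ → ℂ} (hf : IsTest f) (y : ℝ) (N : ℕ) {s : ℂ}
    (hs : s ∈ halfPl N) : AnalyticAt ℂ (contFn μ f y N) s := by
  have hev : contFn μ f y N =ᶠ[𝓝 s] fun s => ((-(2 * Real.pi * Complex.I * y)) ^ N)⁻¹ *
      ∑ k ∈ Finset.range (N + 1), dCoeff s N k *
        ∫ x, tw μ s (fun u => (u : ℂ) ^ (N + k) * iteratedDeriv k f u) x * eChar x y := by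
    filter_upwards [(isOpen_halfPl N).mem_nhds hs] with z hz
    rw [contFn, dOp_iterate z hf.1 N]
    congr 1
    simp only [← integral_const_mul]
    rw [← integral_finsetSum]
    · congr 1; funext x
      rw [tw_sum, Finset.sum_mul]
      refine Finset.sum_congr rfl fun k _ => ?_
      rw [tw_const_mul, mul_assoc]
    · intro k _
      exact ((twAdm_pow_mul_iteratedDeriv hf N k).integrable_and_eq μ y hz).1.const_mul _
  refine AnalyticAt.congr ?_ hev.symm
  refine analyticAt_const.mul (Finset.analyticAt_fun_sum _ fun k _ => ?_)
  exact ((differentiable_dCoeff N k).analyticAt s).mul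
    ((twAdm_pow_mul_iteratedDeriv hf N k).analyticAt μ y hs)

theorem analyticOnNhd_fourierT_twist (μ : ℂ) {f : ℝ → ℂ} (hf : IsTest f) (y : ℝ) :
    AnalyticOnNhd ℂ (fun s => fourierT (twist μ s f) y) {s | 0 < s.re} := by
  intro s hs
  simp only [fourierT_twist]
  exact hf.twAdm_zero.analyticAt μ y (mem_halfPl_of_re_pos hs 0)

theorem twistFourier_of_ne_zero (μ : ℂ) {f : ℝ → ℂ} (hf : IsTest f) {y : ℝ} (hy : y ≠ 0) {N : ℕ}
    {ν : ℂ} (hν : ν ∈ halfPl N) : twistFourier μ ν f y = contFn μ f y N ν := by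
  rw [twistFourier, dif_neg (fun h => hy h.1), twistFourierCont]
  exact meroCont_eq (G := contFn μ f y)
    (fun N s hs => (analyticAt_contFn μ hf y N hs).meromorphicAt)
    (fun N s hs => contFn_of_re_pos μ hf hy N hs) (analyticOnNhd_fourierT_twist μ hf y) hν
    (analyticAt_contFn μ hf y N hν)

/-- The monomial `u ^ k` cut off to `[-1, 1]`. -/
def mCut (k : ℕ) (u : ℝ) : ℂ := if |u| ≤ 1 then (u : ℂ) ^ k else 0

theorem twAdm_mCut (k : ℕ) : TwAdm k (mCut k) where
  measurable := Measurable.ite (measurableSet_le continuous_abs.measurable measurable_const)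
    (Complex.continuous_ofReal.pow k).measurable measurable_const
  support := ⟨1, one_pos, fun u hu => if_neg (not_le.2 hu)⟩
  bound := by
    refine ⟨1, zero_le_one, fun u => ?_⟩
    unfold mCut
    split_ifs
    · simp
    · rw [norm_zero]; positivity

theorem tCut_eq_sum (f : ℝ → ℂ) (N : ℕ) : tCut f N = fun u => ∑ k ∈ Finset.range N,
    iteratedDeriv k f 0 / (k.factorial : ℂ) * mCut k u := by
  funext u
  unfold tCut tPoly mCut
  split_ifs <;> simp

/-- The constant `e^{πiμ/2} + (-1)^k e^{-πiμ/2}`. -/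
def cConst (μ : ℂ) (k : ℕ) : ℂ := Complex.exp (Real.pi * Complex.I * μ / 2)
  + (-1) ^ k * Complex.exp (-(Real.pi * Complex.I * μ / 2))

/-- The condition |-1/x| ≤ 1 restricts each half to |x| ≥ 1, where the integral of |x|^{-2s-1-k} is
1/(2s+k). The signs of (-1/x)^k on the two halves, together with the sign factors, add up to `cConst
μ k`. -/
theorem integral_tw_mCut (μ : ℂ) (k : ℕ) {s : ℂ} (hs : s ∈ halfPl k) :
    Integrable (tw μ s (mCut k)) ∧ ∫ x, tw μ s (mCut k) x = cConst μ k / (2 * s + k) := by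
  obtain ⟨h1, h2⟩ := (twAdm_mCut k).integrable_and_eq μ 0 hs
  have e0 : ∀ x : ℝ, eChar x 0 = 1 := by intro x; simp [eChar]
  have hs' : -(k : ℝ) < 2 * s.re := hs
  -- The sign σ treats both half-lines at once. The variable y is kept with y = 0 as an equation
  -- because the reflected half produces -0.
  have hm : ∀ σ : ℝ, (σ = 1 ∨ σ = -1) → ∀ y : ℝ, y = 0 →
      mellin (mKer (fun u => mCut k (σ * u)) y) (-2 * s) = (-σ : ℂ) ^ k / (2 * s + k) := by
    intro σ hσ y hy
    have habs : |σ| = 1 := by rcases hσ with rfl | rfl <;> simp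
    have key : ∀ x ∈ Set.Ioi (0 : ℝ), (x : ℂ) ^ (-2 * s - 1) • mKer (fun u => mCut k (σ * u)) y x
        = Set.indicator (Set.Ici (1 : ℝ)) (fun x : ℝ => (-σ : ℂ) ^ k * (x : ℂ) ^ (-2 * s - 1 - k)) x := by
      intro x hx
      have hx0 : (0 : ℝ) < x := hx
      have hxc : (x : ℂ) ≠ 0 := by exact_mod_cast hx0.ne'
      have hab : |σ * (-1 / x)| = 1 / x := by
        rw [abs_mul, habs, one_mul, abs_div, abs_neg, abs_one, abs_of_pos hx0]
      rw [mKer, hy, e0, mul_one, mCut, smul_eq_mul]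
      by_cases h : 1 ≤ x
      · rw [if_pos (by rw [hab, div_le_one hx0]; exact h), Set.indicator_of_mem (Set.mem_Ici.2 h), Complex.cpow_sub _ (k : ℂ) hxc,
          Complex.cpow_natCast]
        have : ((σ * (-1 / x) : ℝ) : ℂ) = -σ / x := by push_cast; ring
        rw [this, div_pow]
        ring
      · rw [if_neg (by rw [hab, div_le_one hx0]; exact h), Set.indicator_of_notMem (by simpa using h), mul_zero]
    rw [mellin, setIntegral_congr_fun measurableSet_Ioi key,
      setIntegral_indicator measurableSet_Ici]
    have e1 : Set.Ioi (0 : ℝ) ∩ Set.Ici 1 = Set.Ici 1 := by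
      ext x; simp only [Set.mem_inter_iff, Set.mem_Ioi, Set.mem_Ici]
      constructor
      · exact fun h => h.2
      · exact fun h => ⟨by linarith, h⟩
    have hre : (-2 * s - 1 - k).re < -1 := by simp; linarith
    rw [e1, integral_Ici_eq_integral_Ioi, integral_const_mul, integral_Ioi_cpow_of_lt hre one_pos]
    have : -2 * s - 1 - k + 1 = -(2 * s + k) := by ring
    rw [this, Complex.ofReal_one, Complex.one_cpow, neg_div_neg_eq, mul_one_div]
  simp only [e0, mul_one] at h1 h2
  refine ⟨h1, ?_⟩
  have m1 := hm 1 (Or.inl rfl) 0 rfl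
  have m2 := hm (-1) (Or.inr rfl) (-0) (by simp)
  simp only [one_mul, neg_mul] at m1 m2
  rw [h2]
  have e3 : mellin (mKer (mCut k) 0) (-2 * s) = (-1) ^ k / (2 * s + k) := by
    rw [neg_mul, m1]; simp
  have e4 : mellin (mKer (fun u => mCut k (-u)) (-0)) (-2 * s) = 1 / (2 * s + k) := by
    rw [neg_mul, m2]; simp
  rw [e3, e4, cConst]
  ring

/-- The continuation of the twisted integral on `-N < 2 Re s`. -/
def contZero (μ : ℂ) (f : ℝ → ℂ) (N : ℕ) (s : ℂ) : ℂ :=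
  (∫ x, tw μ s (fun u => f u - tCut f N u) x)
    + ∑ k ∈ Finset.range N, cConst μ k * (iteratedDeriv k f 0 / (k.factorial : ℂ)) / (2 * s + k)

theorem contZero_of_re_pos (μ : ℂ) {f : ℝ → ℂ} (hf : IsTest f) (N : ℕ) {s : ℂ}
    (hs : 0 < s.re) : contZero μ f N s = fourierT (twist μ s f) 0 := by
  have e0 : ∀ x : ℝ, eChar x 0 = 1 := by intro x; simp [eChar]
  rw [fourierT_twist, contZero]
  have h1 := ((twAdm_sub_tCut hf N).integrable_and_eq μ 0 (mem_halfPl_of_re_pos hs N)).1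
  simp only [e0, mul_one] at h1 ⊢
  have h2 : ∫ x, tw μ s (tCut f N) x = ∑ k ∈ Finset.range N,
      cConst μ k * (iteratedDeriv k f 0 / (k.factorial : ℂ)) / (2 * s + k) := by
    rw [tCut_eq_sum]
    simp only [tw_sum, tw_const_mul]
    rw [integral_finsetSum _ fun k _ =>
      (integral_tw_mCut μ k (mem_halfPl_of_re_pos hs k)).1.const_mul _]
    refine Finset.sum_congr rfl fun k _ => ?_
    rw [integral_const_mul, (integral_tw_mCut μ k (mem_halfPl_of_re_pos hs k)).2]
    ring
  have h3 : Integrable (tw μ s (tCut f N)) := by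
    rw [tCut_eq_sum]
    have : (tw μ s fun u => ∑ k ∈ Finset.range N,
        iteratedDeriv k f 0 / (k.factorial : ℂ) * mCut k u)
        = fun x => ∑ k ∈ Finset.range N, iteratedDeriv k f 0 / (k.factorial : ℂ)
          * tw μ s (mCut k) x := by
      funext x; rw [tw_sum]; simp only [tw_const_mul]
    rw [this]
    exact integrable_finsetSum _ fun k _ =>
      (integral_tw_mCut μ k (mem_halfPl_of_re_pos hs k)).1.const_mul _
  rw [← h2, ← integral_add h1 h3]
  congr 1; funext x
  rw [tw_sub]; ring

/-- Euler's formula for the cosine with e^{±πin/2} = (±i)^n. This matches the pole of `contZero`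
with the term subtracted in the definition of the finite part. -/
theorem cConst_eq (μ : ℂ) (n : ℕ) : cConst μ n
    = Complex.I ^ n * (2 * Complex.cos (Real.pi * (n + μ) / 2)) * (-1) ^ n := by
  have h1 : Complex.exp (Real.pi * (n + μ) / 2 * Complex.I)
      = Complex.I ^ n * Complex.exp (Real.pi * Complex.I * μ / 2) := by
    have : (Real.pi * (n + μ) / 2 * Complex.I : ℂ)
        = n * (Real.pi / 2 * Complex.I) + Real.pi * Complex.I * μ / 2 := by ring
    rw [this, Complex.exp_add, Complex.exp_nat_mul, Complex.exp_pi_div_two_mul_I]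
  have h2 : Complex.exp (-(Real.pi * (n + μ) / 2) * Complex.I)
      = (-Complex.I) ^ n * Complex.exp (-(Real.pi * Complex.I * μ / 2)) := by
    have : (-(Real.pi * (n + μ) / 2) * Complex.I : ℂ)
        = n * (-Real.pi / 2 * Complex.I) + -(Real.pi * Complex.I * μ / 2) := by ring
    rw [this, Complex.exp_add, Complex.exp_nat_mul, Complex.exp_neg_pi_div_two_mul_I]
  have h3 : Complex.I ^ n * Complex.I ^ n = (-1) ^ n := by rw [← mul_pow, Complex.I_mul_I]
  have h4 : Complex.I ^ n * (-Complex.I) ^ n = 1 := by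
    rw [← mul_pow, mul_neg, Complex.I_mul_I]; simp
  have h5 : ((-1 : ℂ)) ^ n * (-1) ^ n = 1 := by rw [← mul_pow]; simp
  rw [Complex.two_cos, h1, h2, cConst]
  linear_combination (-(-1) ^ n * Complex.exp (Real.pi * Complex.I * μ / 2)) * h3
    - ((-1) ^ n * Complex.exp (-(Real.pi * Complex.I * μ / 2))) * h4
    - Complex.exp (Real.pi * Complex.I * μ / 2) * h5

theorem two_mul_add_ne_zero_eventually (ν : ℂ) (k : ℕ) : ∀ᶠ s : ℂ in 𝓝[≠] ν, 2 * s + k ≠ 0 := by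
  have : ∀ᶠ s : ℂ in 𝓝[≠] ν, s ≠ -(k : ℂ) / 2 := by
    by_cases h : ν = -(k : ℂ) / 2
    · rw [← h]; exact self_mem_nhdsWithin
    · exact mem_nhdsWithin_of_mem_nhds (isOpen_ne.mem_nhds h)
  filter_upwards [this] with s hs h0
  apply hs
  linear_combination h0 / 2

theorem meromorphicOn_contZero (μ : ℂ) {f : ℝ → ℂ} (hf : IsTest f) (N : ℕ) :
    MeromorphicOn (contZero μ f N) (halfPl N) := by
  intro s hs
  have e0 : ∀ x : ℝ, eChar x 0 = 1 := by intro x; simp [eChar]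
  have h1 := (twAdm_sub_tCut hf N).analyticAt μ 0 hs
  simp only [e0, mul_one] at h1
  refine h1.meromorphicAt.add (MeromorphicAt.fun_sum fun k _ => ?_)
  have h2 : AnalyticAt ℂ (fun s : ℂ => 2 * s + (k : ℂ)) s := by fun_prop
  exact (MeromorphicAt.const _ s).div h2.meromorphicAt

/-- A single formula covers the regular and the exceptional case. If -2ν = n, the finite part
removes exactly the k = n pole term of `contZero`, and in the value of `contZero` at ν that term is
a division by zero, hence 0. -/
theorem twistFourier_zero (μ : ℂ) {f : ℝ → ℂ} (hf : IsTest f) {N : ℕ}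
    {ν : ℂ} (hν : ν ∈ halfPl N) : twistFourier μ ν f 0 = contZero μ f N ν := by
  have e0 : ∀ x : ℝ, eChar x 0 = 1 := by intro x; simp [eChar]
  have h1 := (twAdm_sub_tCut hf N).analyticAt μ 0 hν
  simp only [e0, mul_one] at h1
  have hmer : ∀ N, MeromorphicOn (contZero μ f N) (halfPl N) := meromorphicOn_contZero μ hf
  have hpos : ∀ N s, 0 < s.re → contZero μ f N s = fourierT (twist μ s f) 0 :=
    fun N s hs => contZero_of_re_pos μ hf N hs
  by_cases h : ∃ n : ℕ, -2 * ν = n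
  · rw [twistFourier, dif_pos ⟨rfl, h⟩]
    set n := h.choose with hn
    have hnν : -2 * ν = n := h.choose_spec
    -- Since -N < 2 Re ν = -n, the polar term k = n does occur in the sum.
    have hnN : n < N := by
      have h2 : -(N : ℝ) < 2 * ν.re := hν
      have h3 := congrArg Complex.re hnν
      simp at h3
      have : (n : ℝ) < N := by rw [← h3]; linarith
      exact_mod_cast this
    have hev := meroCont_eventuallyEq hmer hpos (analyticOnNhd_fourierT_twist μ hf 0) hν
    have hν0 : 2 * ν + n = 0 := by rw [← hnν]; ring
    -- R is `contZero` without its polar term; it is continuous at ν and agrees near ν with the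
    -- expression under the limit.
    set R : ℂ → ℂ := fun s => (∫ x, tw μ s (fun u => f u - tCut f N u) x)
      + ∑ k ∈ (Finset.range N).erase n,
        cConst μ k * (iteratedDeriv k f 0 / (k.factorial : ℂ)) / (2 * s + k) with hR
    have hRc : ContinuousAt R ν := by
      refine h1.continuousAt.add (tendsto_finsetSum _ fun k hk => ?_)
      have hk' := (Finset.mem_erase.1 hk).1
      have hne : 2 * ν + k ≠ 0 := by
        intro h0
        apply hk'
        have : (k : ℂ) = n := by linear_combination h0 - hν0
        exact_mod_cast this
      exact (continuousAt_const.div (by fun_prop) hne)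
    have hval : R ν = contZero μ f N ν := by
      rw [hR, contZero, ← Finset.add_sum_erase _ _ (Finset.mem_range.2 hnN), hν0, div_zero, zero_add]
    rw [← hval]
    refine Tendsto.limUnder_eq ?_
    refine (hRc.tendsto.mono_left nhdsWithin_le_nhds).congr' ?_
    filter_upwards [hev, two_mul_add_ne_zero_eventually ν n] with s hs hs0
    rw [twistFourierCont, hs, contZero, ← Finset.add_sum_erase _ _ (Finset.mem_range.2 hnN),
      cConst_eq, delta]
    have hfac : (n.factorial : ℂ) ≠ 0 := by exact_mod_cast n.factorial_ne_zero
    have : Complex.I ^ n * (2 * Complex.cos (Real.pi * (n + μ) / 2)) * (-1) ^ n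
        * (iteratedDeriv n f 0 / (n.factorial : ℂ)) / (2 * s + n)
        = Complex.I ^ n * (2 * Complex.cos (Real.pi * (n + μ) / 2))
          / (n.factorial * (2 * s + n)) * ((-1) ^ n * iteratedDeriv n f 0) := by
      field_simp
    rw [this, hR]
    ring
  · rw [twistFourier, dif_neg (fun h' => h h'.2), twistFourierCont]
    refine meroCont_eq hmer hpos (analyticOnNhd_fourierT_twist μ hf 0) hν ?_
    refine h1.add (Finset.analyticAt_fun_sum _ fun k _ => ?_)
    have hne : 2 * ν + k ≠ 0 := fun h0 => h ⟨k, by linear_combination -h0⟩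
    exact analyticAt_const.div (by fun_prop) hne

/-! ### Formulas for the Jacquet integrals -/

theorem isTest_iteratedDeriv {f : ℝ → ℂ} (hf : IsTest f) (N : ℕ) : IsTest (iteratedDeriv N f) := by
  induction N with
  | zero => simpa using hf
  | succ N ih =>
    rw [iteratedDeriv_succ]
    exact ⟨(contDiff_infty_iff_deriv.1 ih.1).2, ih.2.deriv⟩

theorem IsTest.integrable_mul_eChar {f : ℝ → ℂ} (hf : IsTest f) (y : ℝ) :
    Integrable fun x => f x * eChar x y :=
  (hf.1.continuous.mul (continuous_eChar y)).integrable_of_hasCompactSupport hf.2.mul_right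

theorem hasDerivAt_iteratedDeriv {f : ℝ → ℂ} (hf : ContDiff ℝ ∞ f) (N : ℕ) (x : ℝ) :
    HasDerivAt (iteratedDeriv N f) (iteratedDeriv (N + 1) f x) x := by
  rw [iteratedDeriv_succ]
  exact (hf.differentiable_iteratedDeriv N (by exact_mod_cast ENat.natCast_lt_top N) x).hasDerivAt

theorem contDiffAt_of_smooth {f : ℝ → ℂ} (hf : ContDiff ℝ ∞ f) (N : ℕ) (x : ℝ) :
    ContDiffAt ℝ N f x :=
  (hf.of_le (by exact_mod_cast le_top)).contDiffAt

theorem integral_mul_eChar_eq (f : ℝ → ℂ) (y : ℝ) : fourierT f y = ∫ x, f x * eChar x y := rfl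

theorem IsTest.fourierT_eq {f : ℝ → ℂ} (hf : IsTest f) {y : ℝ} (hy : y ≠ 0) (N : ℕ) :
    fourierT f y = ((-(2 * Real.pi * Complex.I * y)) ^ N)⁻¹
      * ∫ x, iteratedDeriv N f x * eChar x y := by
  have hne := two_pi_I_mul_ne_zero hy
  rw [eq_inv_mul_iff_mul_eq₀ (pow_ne_zero _ hne)]
  induction N with
  | zero => simp [integral_mul_eChar_eq]
  | succ N ih =>
    rw [integral_mul_eChar_of_hasDerivAt (hasDerivAt_iteratedDeriv hf.1 N) y
      ((isTest_iteratedDeriv hf N).integrable_mul_eChar y)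
      ((isTest_iteratedDeriv hf (N + 1)).integrable_mul_eChar y), ← ih]
    ring

theorem ae_ne_zero : ∀ᵐ x : ℝ, x ≠ 0 := by
  have : {(0 : ℝ)}ᶜ ∈ ae (volume : Measure ℝ) := compl_mem_ae_iff.2 (by simp)
  filter_upwards [this] with x hx using hx

section Jacquet

variable {μ ν : ℂ}

theorem iteratedDeriv_lineFn_of_isPartition {F : PS μ ν} {f : (ℝ → ℂ) × (ℝ → ℂ)}
    (h : IsPartition μ ν F f) (N : ℕ) {x : ℝ} (hx : x ≠ 0) :
    iteratedDeriv N (lineFn F) x = iteratedDeriv N f.1 x + tw μ ν ((dOp ν)^[N] f.2) x := by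
  have e : tw μ ν f.2 = fun x => lineFn F x - f.1 x := by
    funext x; rw [lineFn_eq_of_isPartition h x]; ring
  rw [← iteratedDeriv_tw μ ν h.2.1.1 N hx, e, iteratedDeriv_fun_sub
    (contDiffAt_of_smooth (contDiff_lineFn F.2.2) N x) (contDiffAt_of_smooth h.1.1 N x)]
  ring

theorem integrable_iteratedDeriv_lineFn (F : PS μ ν) {N : ℕ} (hN : ν ∈ halfPl N) (l : ℝ) :
    Integrable fun x => iteratedDeriv N (lineFn F) x * eChar x l := by
  have h := partition_spec F
  refine (((isTest_iteratedDeriv h.1 N).integrable_mul_eChar l).add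
    ((twAdm_dOp_iterate h.2.1 ν N).integrable_and_eq μ l hN).1).congr ?_
  filter_upwards [ae_ne_zero] with x hx
  simp only [Pi.add_apply]
  rw [iteratedDeriv_lineFn_of_isPartition h N hx]; ring

/-- After N integrations by parts the contributions of f₁ and f₂ recombine into the N-th derivative
of the line function. The chosen partition drops out, which makes linearity, bounds and equivariance
accessible. -/
theorem jacquet_of_ne_zero (F : PS μ ν) {N : ℕ} (hN : ν ∈ halfPl N) {l : ℝ} (hl : l ≠ 0) :
    jacquet μ ν l F = ((-(2 * Real.pi * Complex.I * l)) ^ N)⁻¹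
      * ∫ x, iteratedDeriv N (lineFn F) x * eChar x l := by
  have h := partition_spec F
  rw [jacquet, h.1.fourierT_eq hl N, twistFourier_of_ne_zero μ h.2.1 hl hN, contFn, ← mul_add,
    ← integral_add ((isTest_iteratedDeriv h.1 N).integrable_mul_eChar l)
      ((twAdm_dOp_iterate h.2.1 ν N).integrable_and_eq μ l hN).1]
  congr 1
  refine integral_congr_ae ?_
  filter_upwards [ae_ne_zero] with x hx
  rw [iteratedDeriv_lineFn_of_isPartition h N hx]; ring

theorem iteratedDeriv_inftyFn_of_isPartition {F : PS μ ν} {f : (ℝ → ℂ) × (ℝ → ℂ)}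
    (h : IsPartition μ ν F f) (k : ℕ) : iteratedDeriv k f.2 0 = iteratedDeriv k (inftyFn μ F) 0 :=
  ((inftyFn_eventuallyEq h).iteratedDeriv_eq k).symm

theorem tCut_congr {f g : ℝ → ℂ} (h : ∀ k, iteratedDeriv k f 0 = iteratedDeriv k g 0) (N : ℕ) :
    tCut f N = tCut g N := by
  rw [tCut_eq_sum, tCut_eq_sum]; simp only [h]

/-- The regularised integrand of the constant term. -/
def regFn (μ ν : ℂ) (N : ℕ) (F : Gtilde → ℂ) (x : ℝ) : ℂ :=
  lineFn F x - tw μ ν (tCut (inftyFn μ F) N) x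

theorem regFn_of_isPartition {F : PS μ ν} {f : (ℝ → ℂ) × (ℝ → ℂ)}
    (h : IsPartition μ ν F f) (N : ℕ) (x : ℝ) :
    regFn μ ν N F x = f.1 x + tw μ ν (fun u => f.2 u - tCut f.2 N u) x := by
  rw [regFn, lineFn_eq_of_isPartition h, tw_sub,
    tCut_congr (fun k => (iteratedDeriv_inftyFn_of_isPartition h k).symm)]
  ring

theorem IsTest.integrable {f : ℝ → ℂ} (hf : IsTest f) : Integrable f :=
  hf.1.continuous.integrable_of_hasCompactSupport hf.2

theorem eChar_zero_right (x : ℝ) : eChar x 0 = 1 := by simp [eChar]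

theorem integrable_tw_sub_tCut (μ : ℂ) {f : ℝ → ℂ} (hf : IsTest f) {N : ℕ} (hN : ν ∈ halfPl N) :
    Integrable (tw μ ν fun u => f u - tCut f N u) := by
  have h1 := ((twAdm_sub_tCut hf N).integrable_and_eq μ 0 hN).1
  simpa only [eChar_zero_right, mul_one] using h1

theorem integrable_regFn (F : PS μ ν) {N : ℕ} (hN : ν ∈ halfPl N) :
    Integrable (regFn μ ν N F) := by
  have h := partition_spec F
  refine (h.1.integrable.add (integrable_tw_sub_tCut μ h.2.1 hN)).congr
    (Eventually.of_forall fun x => ?_)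
  exact (regFn_of_isPartition h N x).symm

/-- Here too the partition drops out: the regularisation and the pole terms involve f₂ only through
its jets at 0, which are those of F at infinity. A summand with 2ν + k = 0 counts as 0, in
accordance with the finite part. -/
theorem jacquet_zero (F : PS μ ν) {N : ℕ} (hN : ν ∈ halfPl N) :
    jacquet μ ν 0 F = (∫ x, regFn μ ν N F x) + ∑ k ∈ Finset.range N,
      cConst μ k * (iteratedDeriv k (inftyFn μ F) 0 / (k.factorial : ℂ)) / (2 * ν + k) := by
  have h := partition_spec F
  rw [jacquet, twistFourier_zero μ h.2.1 hN, contZero, integral_mul_eChar_eq, ← add_assoc]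
  simp only [eChar_zero_right, mul_one]
  rw [← integral_add h.1.integrable (integrable_tw_sub_tCut μ h.2.1 hN)]
  simp only [regFn_of_isPartition h, iteratedDeriv_inftyFn_of_isPartition h]

/-! ### Linearity -/

theorem lineFn_add (F G : PS μ ν) :
    lineFn ((F + G : PS μ ν) : Gtilde → ℂ) = fun x => lineFn F x + lineFn G x := rfl

theorem lineFn_smul (c : ℂ) (F : PS μ ν) :
    lineFn ((c • F : PS μ ν) : Gtilde → ℂ) = fun x => c * lineFn F x := rfl

theorem inftyFn_add (F G : PS μ ν) :
    inftyFn μ ((F + G : PS μ ν) : Gtilde → ℂ) = fun x => inftyFn μ F x + inftyFn μ G x := by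
  funext x; exact mul_add _ _ _

theorem inftyFn_smul (c : ℂ) (F : PS μ ν) :
    inftyFn μ ((c • F : PS μ ν) : Gtilde → ℂ) = fun x => c * inftyFn μ F x := by
  funext x; exact mul_left_comm _ _ _

theorem jet_add (F G : PS μ ν) (k : ℕ) : iteratedDeriv k (inftyFn μ ((F + G : PS μ ν) : Gtilde → ℂ)) 0
    = iteratedDeriv k (inftyFn μ F) 0 + iteratedDeriv k (inftyFn μ G) 0 := by
  rw [inftyFn_add, iteratedDeriv_fun_add
    (contDiffAt_of_smooth (contDiff_inftyFn μ F.2.2) k 0)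
    (contDiffAt_of_smooth (contDiff_inftyFn μ G.2.2) k 0)]

theorem jet_smul (c : ℂ) (F : PS μ ν) (k : ℕ) :
    iteratedDeriv k (inftyFn μ ((c • F : PS μ ν) : Gtilde → ℂ)) 0
      = c * iteratedDeriv k (inftyFn μ F) 0 := by
  rw [inftyFn_smul, iteratedDeriv_const_mul_field]

theorem regFn_add (F G : PS μ ν) (N : ℕ) (x : ℝ) :
    regFn μ ν N ((F + G : PS μ ν) : Gtilde → ℂ) x = regFn μ ν N F x + regFn μ ν N G x := by
  have : tCut (inftyFn μ ((F + G : PS μ ν) : Gtilde → ℂ)) N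
      = fun u => tCut (inftyFn μ F) N u + tCut (inftyFn μ G) N u := by
    simp only [tCut_eq_sum, jet_add]
    funext u
    rw [← Finset.sum_add_distrib]
    refine Finset.sum_congr rfl fun k _ => ?_
    ring
  rw [regFn, regFn, regFn, this, tw_add, lineFn_add]
  ring

theorem regFn_smul (c : ℂ) (F : PS μ ν) (N : ℕ) (x : ℝ) :
    regFn μ ν N ((c • F : PS μ ν) : Gtilde → ℂ) x = c * regFn μ ν N F x := by
  have : tCut (inftyFn μ ((c • F : PS μ ν) : Gtilde → ℂ)) N
      = fun u => c * tCut (inftyFn μ F) N u := by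
    simp only [tCut_eq_sum, jet_smul]
    funext u
    rw [Finset.mul_sum]
    refine Finset.sum_congr rfl fun k _ => ?_
    ring
  rw [regFn, regFn, this, tw_const_mul, lineFn_smul]
  ring

theorem exists_mem_halfPl (ν : ℂ) : ∃ N, ν ∈ halfPl N := by
  obtain ⟨N, hN⟩ := exists_nat_gt (-(2 * ν.re))
  exact ⟨N, by simp only [halfPl, Set.mem_ofPred_eq]; linarith⟩

theorem jacquet_add (l : ℝ) (F G : PS μ ν) :
    jacquet μ ν l (F + G) = jacquet μ ν l F + jacquet μ ν l G := by
  obtain ⟨N, hN⟩ := exists_mem_halfPl ν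
  by_cases hl : l = 0
  · subst hl
    rw [jacquet_zero _ hN, jacquet_zero _ hN, jacquet_zero _ hN]
    simp only [regFn_add, jet_add]
    rw [integral_add (integrable_regFn F hN) (integrable_regFn G hN)]
    have : ∀ k ∈ Finset.range N, cConst μ k * ((iteratedDeriv k (inftyFn μ F) 0
        + iteratedDeriv k (inftyFn μ G) 0) / (k.factorial : ℂ)) / (2 * ν + k)
        = cConst μ k * (iteratedDeriv k (inftyFn μ F) 0 / (k.factorial : ℂ)) / (2 * ν + k)
        + cConst μ k * (iteratedDeriv k (inftyFn μ G) 0 / (k.factorial : ℂ)) / (2 * ν + k) := by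
      intro k _; ring
    rw [Finset.sum_congr rfl this, Finset.sum_add_distrib]
    ring
  · rw [jacquet_of_ne_zero _ hN hl, jacquet_of_ne_zero _ hN hl, jacquet_of_ne_zero _ hN hl, ← mul_add,
      ← integral_add (integrable_iteratedDeriv_lineFn F hN l) (integrable_iteratedDeriv_lineFn G hN l)]
    congr 2
    funext x
    rw [lineFn_add, iteratedDeriv_fun_add (contDiffAt_of_smooth (contDiff_lineFn F.2.2) N x)
      (contDiffAt_of_smooth (contDiff_lineFn G.2.2) N x)]
    ring

theorem jacquet_smul (l : ℝ) (c : ℂ) (F : PS μ ν) :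
    jacquet μ ν l (c • F) = c * jacquet μ ν l F := by
  obtain ⟨N, hN⟩ := exists_mem_halfPl ν
  by_cases hl : l = 0
  · subst hl
    rw [jacquet_zero _ hN, jacquet_zero _ hN]
    simp only [regFn_smul, jet_smul]
    rw [integral_const_mul, mul_add, Finset.mul_sum]
    congr 1
    refine Finset.sum_congr rfl fun k _ => ?_
    ring
  · rw [jacquet_of_ne_zero _ hN hl, jacquet_of_ne_zero _ hN hl, mul_left_comm]
    congr 1
    rw [← integral_const_mul]
    congr 1
    funext x
    rw [lineFn_smul, iteratedDeriv_const_mul_field]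
    ring

theorem deltaInfty_add (m : ℕ) (F G : PS μ ν) :
    deltaInfty μ ν m (F + G) = deltaInfty μ ν m F + deltaInfty μ ν m G := by
  rw [deltaInfty_eq, deltaInfty_eq, deltaInfty_eq, jet_add]; ring

theorem deltaInfty_smul (m : ℕ) (c : ℂ) (F : PS μ ν) :
    deltaInfty μ ν m (c • F) = c * deltaInfty μ ν m F := by
  rw [deltaInfty_eq, deltaInfty_eq, jet_smul]; ring

end Jacquet

/-! ### Continuity of the Jacquet integrals -/

open Classical in
/-- The words `E₊^k` and `E₋^k` with `k ≤ N`. -/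
def stdWords (N : ℕ) : Finset (List Sl2Basis) :=
  (Finset.range (N + 1)).image (fun k => List.replicate k .Ep)
    ∪ (Finset.range (N + 1)).image (fun k => List.replicate k .Em)

/-- The sum of the seminorms of the standard words. -/
def stdNorm (N : ℕ) (F : Gtilde → ℂ) : ℝ := ∑ w ∈ stdWords N, seminormQ w F

theorem stdNorm_nonneg (N : ℕ) (F : Gtilde → ℂ) : 0 ≤ stdNorm N F :=
  Finset.sum_nonneg fun w _ => seminormQ_nonneg F w

open Classical in
theorem seminormQ_Ep_le {N k : ℕ} (hk : k ≤ N) (F : Gtilde → ℂ) :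
    seminormQ (List.replicate k .Ep) F ≤ stdNorm N F := by
  refine Finset.single_le_sum (f := fun w => seminormQ w F) (fun w _ => seminormQ_nonneg F w) ?_
  exact Finset.mem_union_left _ (Finset.mem_image_of_mem _ (Finset.mem_range.2 (by omega)))

open Classical in
theorem seminormQ_Em_le {N k : ℕ} (hk : k ≤ N) (F : Gtilde → ℂ) :
    seminormQ (List.replicate k .Em) F ≤ stdNorm N F := by
  refine Finset.single_le_sum (f := fun w => seminormQ w F) (fun w _ => seminormQ_nonneg F w) ?_
  exact Finset.mem_union_right _ (Finset.mem_image_of_mem (fun k => List.replicate k Sl2Basis.Em)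
    (Finset.mem_range.2 (by omega)))

theorem cmpConst_pos (ν : ℂ) : 0 < cmpConst ν := Real.exp_pos _

/-- The integral that bounds functions which decay like `|x|^{-a}`. -/
def decayConst (a : ℝ) : ℝ := ∫ x : ℝ, 2 ^ a * (1 + ‖x‖) ^ (-a)

theorem decayConst_nonneg (a : ℝ) : 0 ≤ decayConst a :=
  integral_nonneg fun x => by positivity

theorem norm_integral_le_of_decay {g : ℝ → ℂ} {a K : ℝ} (ha : 1 < a) (hK : 0 ≤ K)
    (h1 : ∀ x, |x| < 1 → ‖g x‖ ≤ K) (h2 : ∀ x, 1 ≤ |x| → ‖g x‖ ≤ K * |x| ^ (-a)) :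
    ‖∫ x, g x‖ ≤ K * decayConst a := by
  have hint : Integrable fun x : ℝ => K * (2 ^ a * (1 + ‖x‖) ^ (-a)) :=
    ((integrable_one_add_norm (E := ℝ) (r := a) (by simpa using ha)).const_mul _).const_mul _
  rw [decayConst, ← integral_const_mul]
  refine norm_integral_le_of_norm_le hint (Eventually.of_forall fun x => ?_)
  -- Used with t = 1 for |x| < 1 and with t = |x| otherwise, so that one integrable function
  -- dominates both bounds.
  have key : ∀ t : ℝ, 0 < t → 1 + |x| ≤ 2 * t → t ^ (-a) ≤ 2 ^ a * (1 + ‖x‖) ^ (-a) := by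
    intro t ht hxt
    have hpos : 0 < 1 + |x| := by positivity
    have : (2 : ℝ) ^ a = (2⁻¹ : ℝ) ^ (-a) := by
      rw [Real.inv_rpow zero_le_two, Real.rpow_neg zero_le_two, inv_inv]
    rw [Real.norm_eq_abs, this, ← Real.mul_rpow (by norm_num) hpos.le]
    exact Real.rpow_le_rpow_of_nonpos (by positivity) (by linarith) (by linarith)
  by_cases hx : |x| < 1
  · refine (h1 x hx).trans ?_
    have := key 1 one_pos (by linarith)
    rw [Real.one_rpow] at this
    calc K = K * 1 := (mul_one K).symm
      _ ≤ _ := by gcongr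
  · push Not at hx
    refine (h2 x hx).trans ?_
    have := key |x| (by linarith) (by linarith)
    gcongr

/-- A bound for the sign factor. -/
def sgnBound (μ : ℂ) : ℝ := Real.exp (Real.pi * ‖μ‖)

theorem sgnBound_pos (μ : ℂ) : 0 < sgnBound μ := Real.exp_pos _

theorem norm_exp_half_le (μ : ℂ) (z : ℂ) (hz : ‖z‖ ≤ Real.pi * ‖μ‖) :
    ‖Complex.exp z‖ ≤ sgnBound μ := by
  rw [Complex.norm_exp]
  exact Real.exp_le_exp.2 ((Complex.re_le_norm z).trans hz)

theorem norm_half_le (μ : ℂ) : ‖(Real.pi * Complex.I * μ / 2 : ℂ)‖ ≤ Real.pi * ‖μ‖ := by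
  rw [norm_div, norm_mul, norm_mul, Complex.norm_real, Complex.norm_I, Real.norm_of_nonneg
    Real.pi_pos.le]
  have : 0 ≤ Real.pi * ‖μ‖ := by positivity
  simp only [mul_one, RCLike.norm_ofNat]
  linarith

theorem norm_sgnFactor_le (μ : ℂ) {x : ℝ} (hx : x ≠ 0) : ‖sgnFactor μ x‖ ≤ sgnBound μ := by
  rcases lt_or_gt_of_ne hx with h | h
  · rw [sgnFactor_neg μ h]; exact norm_exp_half_le μ _ (norm_half_le μ)
  · rw [sgnFactor_pos μ h]
    exact norm_exp_half_le μ _ (by rw [norm_neg]; exact norm_half_le μ)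

theorem norm_tw_le (μ s : ℂ) (h : ℝ → ℂ) {x : ℝ} (hx : x ≠ 0) :
    ‖tw μ s h x‖ ≤ sgnBound μ * (|x| ^ (-2 * s.re - 1) * ‖h (-1 / x)‖) := by
  rw [tw_eq_exp μ s h hx, norm_mul, norm_mul, ← abs_cpow hx, mul_assoc,
    Complex.norm_cpow_eq_rpow_re_of_pos (abs_pos.2 hx)]
  have : (-2 * s - 1).re = -2 * s.re - 1 := by simp
  rw [this]
  exact mul_le_mul_of_nonneg_right (norm_sgnFactor_le μ hx) (by positivity)

section Bounds

variable {μ ν : ℂ}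

theorem norm_iteratedDeriv_lineFn_le (F : PS μ ν) {N k : ℕ} (hk : k ≤ N) {x : ℝ} (hx : |x| ≤ 1) :
    ‖iteratedDeriv k (lineFn F) x‖ ≤ cmpConst ν * stdNorm N F := by
  have h1 := congrFun (lineFn_wordDeriv (F : Gtilde → ℂ) k) x
  have h2 := norm_wordDeriv_wT_le F (List.replicate k .Ep) hx
  have h3 : ‖iteratedDeriv k (lineFn F) x‖
      = ‖wordDeriv (List.replicate k .Ep) F (wT * uT (-x))‖ := by
    change _ = ‖lineFn (wordDeriv (List.replicate k .Ep) F) x‖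
    rw [h1, norm_mul, norm_pow, norm_neg, norm_one, one_pow, one_mul]
  rw [h3]
  exact h2.trans (mul_le_mul_of_nonneg_left (seminormQ_Ep_le hk _) (cmpConst_pos ν).le)

theorem norm_iteratedDeriv_inftyFn_le (F : PS μ ν) {N k : ℕ} (hk : k ≤ N) {u : ℝ} (hu : |u| ≤ 1) :
    ‖iteratedDeriv k (inftyFn μ F) u‖ ≤ sgnBound μ * (cmpConst ν * stdNorm N F) := by
  rw [iteratedDeriv_inftyFn, norm_mul]
  have h1 := norm_exp_half_le μ (-(Real.pi * Complex.I * μ / 2))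
    (by rw [norm_neg]; exact norm_half_le μ)
  have h2 := norm_wordDeriv_ubT_le F (List.replicate k .Em) hu
  have h3 := h2.trans (mul_le_mul_of_nonneg_left (seminormQ_Em_le hk F) (cmpConst_pos ν).le)
  exact mul_le_mul h1 h3 (norm_nonneg _) (sgnBound_pos μ).le

theorem abs_inv_le_one {x : ℝ} (hx : 1 ≤ |x|) : |-1 / x| ≤ 1 := by
  rw [abs_div, abs_neg, abs_one, div_le_one (by linarith)]; exact hx

theorem pow_inv_mul_rpow {x : ℝ} (hx : x ≠ 0) (b : ℝ) (N : ℕ) :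
    |x| ^ (-2 * b - 1) * |-1 / x| ^ N = |x| ^ (-(2 * b + 1 + N)) := by
  have h0 := abs_pos.2 hx
  rw [abs_div, abs_neg, abs_one, one_div, inv_pow, ← Real.rpow_natCast, ← Real.rpow_neg h0.le,
    ← Real.rpow_add h0]
  congr 1; ring

/-- For large |x| the derivatives become `dOp`^N at u = -1/x, whose factor u^N improves the decay by
|x|^{-N}. The exponent 2 Re ν + 1 + N exceeds 1 precisely on `halfPl N`. -/
theorem norm_iteratedDeriv_lineFn_le_of_one_le (F : PS μ ν) (N : ℕ) {x : ℝ} (hx : 1 ≤ |x|) :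
    ‖iteratedDeriv N (lineFn F) x‖ ≤ sgnBound μ * ((∑ k ∈ Finset.range (N + 1), ‖dCoeff ν N k‖)
      * (sgnBound μ * (cmpConst ν * stdNorm N F))) * |x| ^ (-(2 * ν.re + 1 + N)) := by
  have hx0 : x ≠ 0 := by rintro rfl; simp at hx; linarith
  have hψ := contDiff_inftyFn μ F.2.2
  have hev : lineFn F =ᶠ[𝓝 x] tw μ ν (inftyFn μ F) := by
    filter_upwards [isOpen_ne.mem_nhds hx0] with y hy using lineFn_eq_tw F.2.1 hy
  rw [hev.iteratedDeriv_eq N, iteratedDeriv_tw μ ν hψ N hx0]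
  refine (norm_tw_le μ ν _ hx0).trans ?_
  have hb : ‖(dOp ν)^[N] (inftyFn μ F) (-1 / x)‖ ≤ (∑ k ∈ Finset.range (N + 1), ‖dCoeff ν N k‖)
      * (sgnBound μ * (cmpConst ν * stdNorm N F)) * |-1 / x| ^ N := by
    rw [dOp_iterate ν hψ N, Finset.sum_mul, Finset.sum_mul]
    refine (norm_sum_le _ _).trans (Finset.sum_le_sum fun k hk => ?_)
    have hk' : k ≤ N := by have := Finset.mem_range.1 hk; omega
    rw [norm_mul, norm_mul, norm_pow, Complex.norm_real, Real.norm_eq_abs, mul_assoc]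
    refine mul_le_mul_of_nonneg_left ?_ (norm_nonneg _)
    rw [mul_comm]
    refine mul_le_mul (norm_iteratedDeriv_inftyFn_le F hk' (abs_inv_le_one hx)) ?_ (by positivity)
      ((norm_nonneg _).trans (norm_iteratedDeriv_inftyFn_le F hk' (abs_inv_le_one hx)))
    exact pow_le_pow_of_le_one (abs_nonneg _) (abs_inv_le_one hx) (by omega)
  rw [← pow_inv_mul_rpow hx0]
  have hs := sgnBound_pos μ
  calc sgnBound μ * (|x| ^ (-2 * ν.re - 1) * ‖(dOp ν)^[N] (inftyFn μ F) (-1 / x)‖)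
      ≤ sgnBound μ * (|x| ^ (-2 * ν.re - 1) * ((∑ k ∈ Finset.range (N + 1), ‖dCoeff ν N k‖)
      * (sgnBound μ * (cmpConst ν * stdNorm N F)) * |-1 / x| ^ N)) := by gcongr
    _ = _ := by ring

/-- The factor |l|^{-N} comes from the integrations by parts and N may be arbitrarily large, which
will absorb any polynomial growth of α. The constant B is uniform in F and l. -/
theorem exists_jacquet_bound_of_ne_zero {N : ℕ} (hN : ν ∈ halfPl N) :
    ∃ B : ℝ, 0 ≤ B ∧ ∀ (F : PS μ ν) (l : ℝ), l ≠ 0 →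
      ‖jacquet μ ν l F‖ ≤ B * (|l| ^ N)⁻¹ * stdNorm N F := by
  set D := ∑ k ∈ Finset.range (N + 1), ‖dCoeff ν N k‖ with hD
  have hD0 : 0 ≤ D := Finset.sum_nonneg fun _ _ => norm_nonneg _
  have hs := sgnBound_pos μ
  have hc := cmpConst_pos ν
  set M := cmpConst ν + sgnBound μ * (D * (sgnBound μ * cmpConst ν)) with hM
  have hM0 : 0 ≤ M := by positivity
  refine ⟨((2 * Real.pi) ^ N)⁻¹ * (M * decayConst (2 * ν.re + 1 + N)),
    mul_nonneg (by positivity) (mul_nonneg hM0 (decayConst_nonneg _)), fun F l hl => ?_⟩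
  have hp := stdNorm_nonneg N F
  rw [jacquet_of_ne_zero F hN hl, norm_mul, norm_inv, norm_pow, norm_neg]
  have h1 : ‖(2 * Real.pi * Complex.I * l : ℂ)‖ = 2 * Real.pi * |l| := by
    simp [abs_of_pos Real.pi_pos]
  have h2 : ‖∫ x, iteratedDeriv N (lineFn F) x * eChar x l‖
      ≤ M * stdNorm N F * decayConst (2 * ν.re + 1 + N) := by
    refine norm_integral_le_of_decay ?_ (by positivity) (fun x hx => ?_) (fun x hx => ?_)
    · have : -(N : ℝ) < 2 * ν.re := hN
      linarith
    · rw [norm_mul, norm_eChar, mul_one]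
      refine (norm_iteratedDeriv_lineFn_le F le_rfl hx.le).trans ?_
      refine mul_le_mul_of_nonneg_right ?_ hp
      rw [hM]; linarith [show 0 ≤ sgnBound μ * (D * (sgnBound μ * cmpConst ν)) by positivity]
    · rw [norm_mul, norm_eChar, mul_one]
      refine (norm_iteratedDeriv_lineFn_le_of_one_le F N hx).trans ?_
      refine mul_le_mul_of_nonneg_right ?_ (by positivity)
      rw [← hD]
      calc sgnBound μ * (D * (sgnBound μ * (cmpConst ν * stdNorm N F)))
          = sgnBound μ * (D * (sgnBound μ * cmpConst ν)) * stdNorm N F := by ring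
        _ ≤ M * stdNorm N F := mul_le_mul_of_nonneg_right (by rw [hM]; linarith) hp
  rw [h1, mul_pow, mul_inv]
  calc ((2 * Real.pi) ^ N)⁻¹ * (|l| ^ N)⁻¹ * ‖∫ x, iteratedDeriv N (lineFn F) x * eChar x l‖
      ≤ ((2 * Real.pi) ^ N)⁻¹ * (|l| ^ N)⁻¹ * (M * stdNorm N F * decayConst (2 * ν.re + 1 + N)) := by
        have := Real.pi_pos
        gcongr
    _ = _ := by ring

theorem norm_regFn_le_of_one_le (F : PS μ ν) (N : ℕ) {x : ℝ} (hx : 1 ≤ |x|) :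
    ‖regFn μ ν N F x‖ ≤ sgnBound μ * (sgnBound μ * (cmpConst ν * stdNorm N F))
      * |x| ^ (-(2 * ν.re + 1 + N)) := by
  have hx0 : x ≠ 0 := by rintro rfl; simp at hx; linarith
  have hψ := contDiff_inftyFn μ F.2.2
  rw [regFn, lineFn_eq_tw F.2.1 hx0, ← tw_sub]
  refine (norm_tw_le μ ν _ hx0).trans ?_
  rw [tCut, if_pos (abs_inv_le_one hx), ← pow_inv_mul_rpow hx0]
  have h := norm_sub_tPoly_le hψ (N := N) (fun v hv => norm_iteratedDeriv_inftyFn_le F le_rfl hv)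
    (abs_inv_le_one hx)
  have hs := sgnBound_pos μ
  calc _ ≤ sgnBound μ * (|x| ^ (-2 * ν.re - 1)
        * (sgnBound μ * (cmpConst ν * stdNorm N F) * |-1 / x| ^ N)) := by gcongr
    _ = _ := by ring

/-- For 0 < |x| < 1 the point -1/x lies outside [-1, 1], where the cut Taylor polynomial vanishes;
at x = 0 the twist is 0 by definition. -/
theorem regFn_of_abs_lt_one (F : Gtilde → ℂ) (N : ℕ) {x : ℝ} (hx : |x| < 1) :
    regFn μ ν N F x = lineFn F x := by
  have : tw μ ν (tCut (inftyFn μ F) N) x = 0 := by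
    by_cases hx0 : x = 0
    · rw [hx0, tw_zero_right]
    · rw [tw_eq_exp _ _ _ hx0, tCut, if_neg, mul_zero]
      rw [abs_div, abs_neg, abs_one, div_le_one (abs_pos.2 hx0)]
      exact not_le.2 hx
  rw [regFn, this, sub_zero]

theorem exists_jacquet_bound_zero {N : ℕ} (hN : ν ∈ halfPl N) :
    ∃ B : ℝ, 0 ≤ B ∧ ∀ F : PS μ ν, ‖jacquet μ ν 0 F‖ ≤ B * stdNorm N F := by
  have hs := sgnBound_pos μ
  have hc := cmpConst_pos ν
  set M := cmpConst ν + sgnBound μ * (sgnBound μ * cmpConst ν) with hM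
  have hM0 : 0 ≤ M := by positivity
  set S := ∑ k ∈ Finset.range N, ‖cConst μ k / (k.factorial : ℂ) / (2 * ν + k)‖
    * (sgnBound μ * cmpConst ν) with hS
  refine ⟨M * decayConst (2 * ν.re + 1 + N) + S, add_nonneg (mul_nonneg hM0 (decayConst_nonneg _))
    (Finset.sum_nonneg fun _ _ => by positivity), fun F => ?_⟩
  have hp := stdNorm_nonneg N F
  rw [jacquet_zero F hN, add_mul]
  refine (norm_add_le _ _).trans (add_le_add ?_ ?_)
  · have h2 : ‖∫ x, regFn μ ν N F x‖ ≤ M * stdNorm N F * decayConst (2 * ν.re + 1 + N) := by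
      refine norm_integral_le_of_decay ?_ (by positivity) (fun x hx => ?_) (fun x hx => ?_)
      · have : -(N : ℝ) < 2 * ν.re := hN
        linarith
      · rw [regFn_of_abs_lt_one _ _ hx]
        have := norm_iteratedDeriv_lineFn_le F (Nat.zero_le N) hx.le
        rw [iteratedDeriv_zero] at this
        refine this.trans (mul_le_mul_of_nonneg_right ?_ hp)
        rw [hM]; linarith [show 0 ≤ sgnBound μ * (sgnBound μ * cmpConst ν) by positivity]
      · refine (norm_regFn_le_of_one_le F N hx).trans ?_
        refine mul_le_mul_of_nonneg_right ?_ (by positivity)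
        calc sgnBound μ * (sgnBound μ * (cmpConst ν * stdNorm N F))
            = sgnBound μ * (sgnBound μ * cmpConst ν) * stdNorm N F := by ring
          _ ≤ M * stdNorm N F := mul_le_mul_of_nonneg_right (by rw [hM]; linarith) hp
    refine h2.trans_eq (by ring)
  · rw [hS, Finset.sum_mul]
    refine (norm_sum_le _ _).trans (Finset.sum_le_sum fun k hk => ?_)
    have hk' : k ≤ N := (Finset.mem_range.1 hk).le
    have h1 := norm_iteratedDeriv_inftyFn_le F hk' (u := 0) (by simp)
    have e : cConst μ k * (iteratedDeriv k (inftyFn μ F) 0 / (k.factorial : ℂ)) / (2 * ν + k)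
        = cConst μ k / (k.factorial : ℂ) / (2 * ν + k) * iteratedDeriv k (inftyFn μ F) 0 := by ring
    rw [e, norm_mul, mul_assoc]
    refine mul_le_mul_of_nonneg_left (h1.trans_eq (by ring)) (norm_nonneg _)

theorem norm_deltaInfty_le (m : ℕ) (F : PS μ ν) :
    ‖deltaInfty μ ν m F‖ ≤ sgnBound μ * cmpConst ν * stdNorm m F := by
  rw [deltaInfty_eq, norm_mul, norm_pow, norm_neg, norm_one, one_pow, one_mul, mul_assoc]
  exact norm_iteratedDeriv_inftyFn_le F le_rfl (by simp)

end Bounds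

/-! ### Convergence and continuity of the expansion -/

theorem stdNorm_mono {N M : ℕ} (h : N ≤ M) (F : Gtilde → ℂ) : stdNorm N F ≤ stdNorm M F := by
  classical
  refine Finset.sum_le_sum_of_subset_of_nonneg ?_ fun w _ _ => seminormQ_nonneg F w
  have : Finset.range (N + 1) ⊆ Finset.range (M + 1) := Finset.range_mono (by omega)
  unfold stdWords
  exact Finset.union_subset_union (Finset.image_subset_image this) (Finset.image_subset_image this)

namespace ShiftedLattice

variable (L : ShiftedLattice)

theorem exists_param : ∃ u₁ u₂ : ℝ, u₂ ≠ 0 ∧ ∃ e : ℤ ≃ L.carrier,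
    ∀ n : ℤ, ((e n : L.carrier) : ℝ) = u₁ + u₂ * n := by
  obtain ⟨u₁, u₂, h2, h⟩ := L.exists_eq
  have hinj : Function.Injective fun n : ℤ => u₁ + u₂ * n := by
    intro n m hnm
    have : (n : ℝ) = m := mul_left_cancel₀ h2 (add_left_cancel hnm)
    exact_mod_cast this
  exact ⟨u₁, u₂, h2, (Equiv.ofInjective _ hinj).trans (Equiv.setCongr h.symm), fun n => rfl⟩

theorem tendsto_abs_cofinite : Tendsto (fun l : L.carrier => |(l : ℝ)|) cofinite atTop := by
  obtain ⟨u₁, u₂, h2, e, he⟩ := L.exists_param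
  have h1 : Tendsto (fun n : ℤ => |u₁ + u₂ * n|) cofinite atTop := by
    have hc : Tendsto (fun x : ℝ => u₁ + u₂ * x) (cocompact ℝ) (cocompact ℝ) :=
      ((Homeomorph.mulLeft₀ u₂ h2).trans (Homeomorph.addLeft u₁)).isClosedEmbedding.tendsto_cocompact
    exact (tendsto_norm_cocompact_atTop.comp hc).comp Int.tendsto_coe_cofinite
  have h3 : (fun l : L.carrier => |(l : ℝ)|) = (fun n : ℤ => |u₁ + u₂ * n|) ∘ e.symm := by
    funext l
    simp only [Function.comp, ← he, Equiv.apply_symm_apply]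
  rw [h3]
  exact h1.comp e.symm.injective.tendsto_cofinite

theorem summable_inv_sq : Summable fun l : L.carrier => (|(l : ℝ)| ^ 2)⁻¹ := by
  obtain ⟨u₁, u₂, h2, e, he⟩ := L.exists_param
  rw [← e.summable_iff]
  have h := (Real.summable_one_div_int_add_rpow (u₁ / u₂) 2).2 one_lt_two
  refine (h.mul_left ((|u₂| ^ 2)⁻¹)).congr fun n => ?_
  simp only [Function.comp, he]
  have : u₁ + u₂ * n = u₂ * (n + u₁ / u₂) := by field_simp; ring
  rw [this, abs_mul, mul_pow, mul_inv, one_div]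
  norm_cast

/-- With growth exponent r any N > r + 2 suffices, because the terms are then eventually dominated
by multiples of |l|^{-2}, which is summable over a shifted lattice. -/
theorem exists_summable {α : L.carrier → ℂ} (hα : α ∈ L.polyGrowth) :
    ∃ N₀ : ℕ, ∀ N ≥ N₀, Summable fun l : L.carrier => ‖α l‖ * (|(l : ℝ)| ^ N)⁻¹ := by
  obtain ⟨r, hr⟩ := hα
  obtain ⟨N₀, hN₀⟩ := exists_nat_gt (r + 2)
  refine ⟨N₀, fun N hN => ?_⟩
  have hle : cofinite ≤ comap (fun l : L.carrier => |(l : ℝ)|) atTop :=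
    tendsto_iff_comap.1 L.tendsto_abs_cofinite
  obtain ⟨C, hC⟩ := (hr.mono hle).bound
  refine summable_of_isBigO L.summable_inv_sq (Asymptotics.IsBigO.of_bound |C| ?_)
  filter_upwards [hC, L.tendsto_abs_cofinite.eventually_ge_atTop 1] with l h1 h2
  have h0 : 0 < |(l : ℝ)| := by linarith
  rw [norm_mul, norm_norm, norm_inv, norm_inv, norm_pow, norm_pow, Real.norm_eq_abs, abs_abs]
  have h3 : ‖|(l : ℝ)| ^ r‖ ≤ |(l : ℝ)| ^ N * (|(l : ℝ)| ^ 2)⁻¹ := by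
    rw [Real.norm_of_nonneg (by positivity), ← Real.rpow_natCast, ← Real.rpow_natCast,
      ← Real.rpow_neg h0.le, ← Real.rpow_add h0]
    refine Real.rpow_le_rpow_of_exponent_le h2 ?_
    have : (N₀ : ℝ) ≤ N := by exact_mod_cast hN
    push_cast
    linarith
  have h4 : C * ‖|(l : ℝ)| ^ r‖ ≤ |C| * (|(l : ℝ)| ^ N * (|(l : ℝ)| ^ 2)⁻¹) :=
    mul_le_mul (le_abs_self C) h3 (norm_nonneg _) (abs_nonneg C)
  calc ‖α l‖ * (|(l : ℝ)| ^ N)⁻¹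
      ≤ |C| * (|(l : ℝ)| ^ N * (|(l : ℝ)| ^ 2)⁻¹) * (|(l : ℝ)| ^ N)⁻¹ := by
        gcongr; exact h1.trans h4
    _ = |C| * (|(l : ℝ)| ^ 2)⁻¹ := by field_simp

end ShiftedLattice

section Expansion

variable {L : ShiftedLattice} {μ ν : ℂ} {α : L.carrier → ℂ}

/-- One order N serves both the convergence of the Jacquet integrals and the summability against α.
The point l = 0 needs its own constant; being a single point it does not affect summability. -/
theorem exists_jacquet_bounds (hα : α ∈ L.polyGrowth) (μ ν : ℂ) :
    ∃ (N : ℕ) (K : L.carrier → ℝ), (∀ l, 0 ≤ K l) ∧ (Summable fun l => ‖α l‖ * K l) ∧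
      ∀ (F : PS μ ν) (l : L.carrier), ‖jacquet μ ν l F‖ ≤ K l * stdNorm N F := by
  classical
  obtain ⟨N₁, h1⟩ := exists_mem_halfPl ν
  obtain ⟨N₂, h2⟩ := L.exists_summable hα
  set N := max N₁ N₂
  have hN : ν ∈ halfPl N := halfPl_mono (le_max_left _ _) h1
  obtain ⟨B, hB, hB'⟩ := exists_jacquet_bound_of_ne_zero (μ := μ) hN
  obtain ⟨C, hC, hC'⟩ := exists_jacquet_bound_zero (μ := μ) hN
  refine ⟨N, fun l => if (l : ℝ) = 0 then C else B * (|(l : ℝ)| ^ N)⁻¹, fun l => ?_, ?_,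
    fun F l => ?_⟩
  · dsimp only; split_ifs <;> positivity
  · have h3 := (h2 N (le_max_right _ _)).mul_left B
    refine (h3.norm).of_norm_bounded_eventually (g := fun l => ‖B * (‖α l‖ * (|(l : ℝ)| ^ N)⁻¹)‖) ?_
    have : ∀ᶠ l : L.carrier in cofinite, (1 : ℝ) ≤ |(l : ℝ)| :=
      L.tendsto_abs_cofinite.eventually_ge_atTop 1
    filter_upwards [this] with l hl
    have : (l : ℝ) ≠ 0 := by rintro h; rw [h] at hl; norm_num at hl
    rw [if_neg this]
    exact le_of_eq (by congr 1; ring)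
  · dsimp only
    split_ifs with h
    · rw [h]; exact hC' F
    · exact hB' F l h

theorem summable_expansion (hα : α ∈ L.polyGrowth) (F : PS μ ν) :
    Summable fun l : L.carrier => α l * jacquet μ ν l F := by
  obtain ⟨N, K, hK, hs, hb⟩ := exists_jacquet_bounds hα μ ν
  refine (hs.mul_right (stdNorm N F)).of_norm_bounded fun l => ?_
  rw [norm_mul, mul_assoc]
  exact mul_le_mul_of_nonneg_left (hb F l) (norm_nonneg _)

theorem lambdaDist_mem_distributions (hα : α ∈ L.polyGrowth) (β : ℕ →₀ ℂ) :
    lambdaDist μ ν L α β ∈ distributions μ ν := by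
  refine ⟨⟨fun F G => ?_, fun c F => ?_⟩, ?_⟩
  · simp only [lambdaDist, jacquet_add, deltaInfty_add, mul_add]
    rw [(summable_expansion hα F).tsum_add (summable_expansion hα G), Finsupp.sum_add]
    ring
  · simp only [lambdaDist, jacquet_smul, deltaInfty_smul, mul_left_comm _ c, smul_eq_mul]
    rw [tsum_mul_left, mul_add, Finsupp.mul_sum]
  · obtain ⟨N, K, hK, hs, hb⟩ := exists_jacquet_bounds hα μ ν
    set M := max N (β.support.sup id) with hM
    set D := ∑ m ∈ β.support, ‖β m‖ * (sgnBound μ * cmpConst ν) with hD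
    have hsg := sgnBound_pos μ
    have hcm := cmpConst_pos ν
    have hD0 : 0 ≤ D := Finset.sum_nonneg fun _ _ => by positivity
    have hT0 : 0 ≤ ∑' l, ‖α l‖ * K l := tsum_nonneg fun l => mul_nonneg (norm_nonneg _) (hK l)
    -- The summand 1 makes the constant strictly positive, as the definition of continuity demands.
    -- M dominates both the order of the Jacquet bounds and every m in the support of β.
    refine ⟨(∑' l, ‖α l‖ * K l) + D + 1, by positivity, stdWords M, fun F => ?_⟩
    change _ ≤ _ * stdNorm M F
    have hp := stdNorm_nonneg M F
    have h1 : ‖∑' l : L.carrier, α l * jacquet μ ν l F‖ ≤ (∑' l, ‖α l‖ * K l) * stdNorm M F := by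
      rw [← tsum_mul_right]
      refine tsum_of_norm_bounded (hs.mul_right _).hasSum fun l => ?_
      rw [norm_mul, mul_assoc]
      refine mul_le_mul_of_nonneg_left ((hb F l).trans ?_) (norm_nonneg _)
      exact mul_le_mul_of_nonneg_left (stdNorm_mono (le_max_left _ _) F) (hK l)
    have h2 : ‖β.sum fun m b => b * deltaInfty μ ν m F‖ ≤ D * stdNorm M F := by
      rw [Finsupp.sum, hD, Finset.sum_mul]
      refine (norm_sum_le _ _).trans (Finset.sum_le_sum fun m hm => ?_)
      rw [norm_mul, mul_assoc]
      refine mul_le_mul_of_nonneg_left ((norm_deltaInfty_le m F).trans ?_) (norm_nonneg _)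
      refine mul_le_mul_of_nonneg_left (stdNorm_mono ?_ F) (by positivity)
      exact (Finset.le_sup (f := id) hm).trans (le_max_right _ _)
    rw [lambdaDist]
    refine (norm_add_le _ _).trans ((add_le_add h1 h2).trans ?_)
    nlinarith

end Expansion

/-! ### Integrals of translates -/

section Parametric

variable {E : Type} [NormedAddCommGroup E] [NormedSpace ℝ E] [ProperSpace E]

theorem hasFDerivAt_parametric {G : Type} [NormedAddCommGroup G] [NormedSpace ℝ G]
    [CompleteSpace G] {Φ : E × ℝ → G} (hΦ : ContDiff ℝ 1 Φ) (a b : ℝ) (e : E) :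
    HasFDerivAt (fun e => ∫ τ in a..b, Φ (e, τ))
      (∫ τ in a..b, (fderiv ℝ Φ (e, τ)).comp (ContinuousLinearMap.inl ℝ E ℝ)) e := by
  have hc : Continuous fun q : E × ℝ => (fderiv ℝ Φ q).comp (ContinuousLinearMap.inl ℝ E ℝ) :=
    (hΦ.continuous_fderiv one_ne_zero).clm_comp continuous_const
  obtain ⟨C, hC⟩ := ((isCompact_closedBall e 1).prod (isCompact_uIcc (a := a) (b := b))).exists_bound_of_continuousOn
    hc.continuousOn
  refine intervalIntegral.hasFDerivAt_integral_of_dominated_of_fderiv_le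
    (F' := fun e τ => (fderiv ℝ Φ (e, τ)).comp (ContinuousLinearMap.inl ℝ E ℝ))
    (bound := fun _ => C) (Metric.closedBall_mem_nhds e one_pos) ?_ ?_ ?_ ?_ ?_ ?_
  · exact Eventually.of_forall fun e' =>
      (hΦ.continuous.comp (Continuous.prodMk_right e')).aestronglyMeasurable
  · exact (hΦ.continuous.comp (Continuous.prodMk_right e)).intervalIntegrable _ _
  · exact (hc.comp (Continuous.prodMk_right e)).aestronglyMeasurable
  · exact Eventually.of_forall fun τ hτ e' he' => hC (e', τ) ⟨he', Set.uIoc_subset_uIcc hτ⟩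
  · exact intervalIntegrable_const
  · refine Eventually.of_forall fun τ hτ e' he' => ?_
    exact ((hΦ.differentiable one_ne_zero) (e', τ)).hasFDerivAt.comp e'
      (hasFDerivAt_prodMk_left e' τ)

/-- The target space is generalised because the induction passes to the derivative, which is again a
parametric integral but with values in a space of linear maps. -/
theorem contDiff_parametric_nat (n : ℕ) {G : Type} [NormedAddCommGroup G] [NormedSpace ℝ G]
    [CompleteSpace G] {Φ : E × ℝ → G} (hΦ : ContDiff ℝ ∞ Φ) (a b : ℝ) :
    ContDiff ℝ n fun e => ∫ τ in a..b, Φ (e, τ) := by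
  induction n generalizing G with
  | zero =>
    rw [Nat.cast_zero, contDiff_zero]
    exact intervalIntegral.continuous_parametric_intervalIntegral_of_continuous'
      (f := fun e τ => Φ (e, τ)) hΦ.continuous a b
  | succ n ih =>
    have h1 := fun e => hasFDerivAt_parametric (hΦ.of_le (by simp)) a b e
    rw [Nat.cast_succ, contDiff_succ_iff_fderiv]
    refine ⟨fun e => (h1 e).differentiableAt, by simp, ?_⟩
    rw [funext fun e => (h1 e).fderiv]
    exact ih ((hΦ.fderiv_right (m := ∞) (by simp)).clm_comp contDiff_const)

theorem contDiff_parametric {Φ : E × ℝ → ℂ} (hΦ : ContDiff ℝ ∞ Φ) (a b : ℝ) :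
    ContDiff ℝ ∞ fun e => ∫ τ in a..b, Φ (e, τ) :=
  contDiff_infty.2 fun n => contDiff_parametric_nat n hΦ a b

theorem deriv_parametric {Φ : ℝ × ℝ → ℂ} (hΦ : ContDiff ℝ ∞ Φ) (a b u : ℝ) :
    deriv (fun u => ∫ τ in a..b, Φ (u, τ)) u
      = ∫ τ in a..b, deriv (fun u => Φ (u, τ)) u := by
  have h1 : ContDiff ℝ 1 Φ := hΦ.of_le (by simp)
  have hc : Continuous fun q : ℝ × ℝ => (fderiv ℝ Φ q).comp (ContinuousLinearMap.inl ℝ ℝ ℝ) :=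
    (h1.continuous_fderiv one_ne_zero).clm_comp continuous_const
  rw [(hasFDerivAt_parametric h1 a b u).hasDerivAt.deriv,
    ContinuousLinearMap.intervalIntegral_apply (φ := fun τ =>
      (fderiv ℝ Φ (u, τ)).comp (ContinuousLinearMap.inl ℝ ℝ ℝ))
      ((hc.comp (Continuous.prodMk_right u)).intervalIntegrable _ _)]
  refine intervalIntegral.integral_congr fun τ _ => ?_
  exact (((h1.differentiable one_ne_zero) (u, τ)).hasFDerivAt.comp u
      (hasFDerivAt_prodMk_left u τ)).hasDerivAt.deriv.symm

theorem contDiff_deriv_fst {Φ : ℝ × ℝ → ℂ} (hΦ : ContDiff ℝ ∞ Φ) :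
    ContDiff ℝ ∞ fun q : ℝ × ℝ => deriv (fun u => Φ (u, q.2)) q.1 := by
  have h1 : ContDiff ℝ ∞ fun q : ℝ × ℝ => Φ (q.2, q.1) :=
    hΦ.comp (contDiff_snd.prodMk contDiff_fst)
  exact (contDiff_deriv_snd h1).comp (contDiff_snd.prodMk contDiff_fst)

theorem iteratedDeriv_parametric (k : ℕ) {Φ : ℝ × ℝ → ℂ} (hΦ : ContDiff ℝ ∞ Φ) (a b u : ℝ) :
    iteratedDeriv k (fun u => ∫ τ in a..b, Φ (u, τ)) u
      = ∫ τ in a..b, iteratedDeriv k (fun u => Φ (u, τ)) u := by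
  induction k generalizing Φ with
  | zero => simp
  | succ k ih =>
    rw [iteratedDeriv_succ', funext (deriv_parametric hΦ a b), ih (contDiff_deriv_fst hΦ)]
    simp only [iteratedDeriv_succ']

end Parametric

section Translation

variable {μ ν : ℂ}

/-- The function `g ↦ ∫₀ᵗ F(g ũ(τ)) dτ`. -/
def translateInt (t : ℝ) (F : PS μ ν) : PS μ ν :=
  ⟨fun g => ∫ τ in (0 : ℝ)..t, (F : Gtilde → ℂ) (g * uT τ), fun x y hy m g => by
    rw [← intervalIntegral.integral_const_mul]
    refine intervalIntegral.integral_congr fun τ _ => ?_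
    simp only [mul_assoc _ g]
    exact F.2.1 x y hy m (g * uT τ),
  contDiff_parametric (Φ := fun q : (ℝ × ℝ × ℝ) × ℝ => (F : Gtilde → ℂ) (chart q.1 * uT q.2))
    (F.2.2.comp ((isSmoothMap_chart contDiff_fst).mul (isSmoothMap_uT contDiff_snd))) 0 t⟩

theorem lineFn_act (t : ℝ) (F : PS μ ν) (x : ℝ) :
    lineFn (PS.act (uT t) F : PS μ ν) x = lineFn F (x - t) := by
  change (F : Gtilde → ℂ) (wT * uT (-x) * uT t) = (F : Gtilde → ℂ) (wT * uT (-(x - t)))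
  rw [mul_assoc, uT_mul]
  ring_nf

theorem lineFn_translateInt (t : ℝ) (F : PS μ ν) (x : ℝ) :
    lineFn (translateInt t F) x = ∫ y in (x - t)..x, lineFn F y := by
  have h : lineFn (translateInt t F) x = ∫ τ in (0 : ℝ)..t, lineFn F (x - τ) := by
    refine intervalIntegral.integral_congr fun τ _ => ?_
    exact lineFn_act τ F x
  rw [h, intervalIntegral.integral_comp_sub_left (fun y => lineFn F y), sub_zero]

/-- On the line the averaged vector is the integral of `lineFn F` over [x-t, x], whose derivative is
f(x) - f(x-t). Thus ρ(ũ(t))F - F lies in the image of E₊, and the whole question of equivariance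
reduces to that image. -/
theorem deriv_lineFn_translateInt (t : ℝ) (F : PS μ ν) (x : ℝ) :
    lineFn ((PS.act (uT t) F - F : PS μ ν) : Gtilde → ℂ) x
      = -deriv (lineFn (translateInt t F)) x := by
  have hc : Continuous (lineFn F) := (contDiff_lineFn F.2.2).continuous
  have h1 : lineFn (translateInt t F)
      = fun x => (∫ y in (0 : ℝ)..x, lineFn F y) - ∫ y in (0 : ℝ)..(x - t), lineFn F y := by
    funext x
    rw [lineFn_translateInt, intervalIntegral.integral_interval_sub_left]
      <;> exact hc.intervalIntegrable _ _
  have h2 : ∀ x, HasDerivAt (fun x => ∫ y in (0 : ℝ)..x, lineFn F y) (lineFn F x) x := fun x =>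
    hc.integral_hasStrictDerivAt 0 x |>.hasDerivAt
  have h3 := (h2 x).fun_sub ((h2 (x - t)).comp_sub_const x t)
  rw [h1, h3.deriv]
  change lineFn (PS.act (uT t) F : PS μ ν) x - lineFn F x = _
  rw [lineFn_act]
  ring

theorem jet_translateInt (k : ℕ) (t : ℝ) (F : PS μ ν) :
    iteratedDeriv k (inftyFn μ (translateInt t F)) 0
      = ∫ τ in (0 : ℝ)..t, iteratedDeriv k (inftyFn μ (PS.act (uT τ) F : PS μ ν)) 0 := by
  have h : inftyFn μ (translateInt t F)
      = fun u => ∫ τ in (0 : ℝ)..t, inftyFn μ (PS.act (uT τ) F : PS μ ν) u := by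
    funext u
    exact (intervalIntegral.integral_const_mul _ _).symm
  rw [h]
  refine iteratedDeriv_parametric k (Φ := fun q : ℝ × ℝ =>
    inftyFn μ (PS.act (uT q.2) F : PS μ ν) q.1) ?_ 0 t 0
  exact contDiff_const.mul
    (F.2.2.comp ((isSmoothMap_ubT contDiff_fst).mul (isSmoothMap_uT contDiff_snd)))

/-- Away from u = 0 this is the derivative formula for the twist together with its involutivity; at
u = 0 both sides are continuous and the punctured line is dense. -/
theorem inftyFn_of_lineFn_eq_neg_deriv {F G : PS μ ν}
    (h : ∀ x, lineFn F x = -deriv (lineFn G) x) (u : ℝ) :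
    inftyFn μ F u = -dOp ν (inftyFn μ G) u := by
  have hG := contDiff_inftyFn μ G.2.2
  have hd : Dense {u : ℝ | u ≠ 0} := dense_compl_singleton 0
  refine congrFun (Continuous.ext_on hd (contDiff_inftyFn μ F.2.2).continuous
    (contDiff_dOp ν hG).continuous.neg fun u (hu : u ≠ 0) => ?_) u
  have h1 : tw μ ν (lineFn F) u = tw μ ν (fun y => -1 * tw μ ν (dOp ν (inftyFn μ G)) y) u := by
    refine tw_congr μ ν fun _ => ?_
    have hy : -1 / u ≠ 0 := div_ne_zero (by norm_num) hu
    have h2 := (hasDerivAt_tw μ ν (hG.differentiable (by simp)) hy).congr_of_eventuallyEq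
      (f₁ := lineFn G) ((eventually_ne_nhds hy).mono fun z hz => lineFn_eq_tw G.2.1 hz)
    rw [h, h2.deriv]
    ring
  rw [inftyFn_eq_tw F.2.1 hu, h1, tw_const_mul, tw_tw μ ν _ hu]
  exact neg_one_mul _

theorem iteratedDeriv_id_mul {g : ℝ → ℂ} (hg : ContDiff ℝ ∞ g) (k : ℕ) (x : ℝ) :
    iteratedDeriv (k + 1) (fun u : ℝ => (u : ℂ) * g u) x
      = (x : ℂ) * iteratedDeriv (k + 1) g x + (k + 1) * iteratedDeriv k g x := by
  have hx : ∀ x : ℝ, HasDerivAt (fun u : ℝ => (u : ℂ)) 1 x := fun x =>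
    Complex.ofRealCLM.hasDerivAt
  induction k generalizing x with
  | zero =>
    rw [zero_add, iteratedDeriv_one, iteratedDeriv_zero, iteratedDeriv_one,
      ((hx x).fun_mul (hg.differentiable (by simp) x).hasDerivAt).deriv]
    push_cast; ring
  | succ k ih =>
    rw [iteratedDeriv_succ, funext ih, (((hx x).fun_mul
      (hasDerivAt_iteratedDeriv hg (k + 1) x)).fun_add
      ((hasDerivAt_iteratedDeriv hg k x).const_mul ((k : ℂ) + 1))).deriv]
    push_cast; ring

/-- On monomials `dOp` sends u^k to (k+2s+1)u^{k+1}, and factorials convert coefficients into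
derivatives. The zero at 2s + k + 1 = 0 is the source of the exceptional index -2ν. -/
theorem iteratedDeriv_dOp_zero (s : ℂ) {f : ℝ → ℂ} (hf : ContDiff ℝ ∞ f) (k : ℕ) :
    iteratedDeriv (k + 1) (dOp s f) 0 = (k + 1) * (2 * s + (k + 1)) * iteratedDeriv k f 0 := by
  have hi : ContDiff ℝ ∞ fun u : ℝ => (u : ℂ) := Complex.ofRealCLM.contDiff
  have hd : ContDiff ℝ ∞ (deriv f) := (contDiff_infty_iff_deriv.1 hf).2
  have h : dOp s f = fun u : ℝ => (u : ℂ) * ((u : ℂ) * deriv f u + (2 * s + 1) * f u) := by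
    funext u; simp only [dOp]; ring
  have h1 : ContDiff ℝ ∞ fun u : ℝ => (u : ℂ) * deriv f u := hi.mul hd
  have h2 : ContDiff ℝ ∞ fun u : ℝ => (2 * s + 1) * f u := contDiff_const.mul hf
  rw [h, iteratedDeriv_id_mul (h1.add h2), iteratedDeriv_fun_add (contDiffAt_of_smooth h1 k 0)
    (contDiffAt_of_smooth h2 k 0), iteratedDeriv_const_mul_field]
  have h3 : iteratedDeriv k (fun u : ℝ => (u : ℂ) * deriv f u) 0 = k * iteratedDeriv k f 0 := by
    cases k with
    | zero => simp
    | succ k => rw [iteratedDeriv_id_mul hd, iteratedDeriv_succ' (n := k) (f := f)]; push_cast; ring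
  rw [h3]
  push_cast
  ring

theorem jet_zero_of_lineFn_eq_neg_deriv {F G : PS μ ν}
    (h : ∀ x, lineFn F x = -deriv (lineFn G) x) : iteratedDeriv 0 (inftyFn μ F) 0 = 0 := by
  rw [iteratedDeriv_zero, inftyFn_of_lineFn_eq_neg_deriv h]
  simp [dOp]

theorem jet_succ_of_lineFn_eq_neg_deriv {F G : PS μ ν}
    (h : ∀ x, lineFn F x = -deriv (lineFn G) x) (k : ℕ) :
    iteratedDeriv (k + 1) (inftyFn μ F) 0
      = -((k + 1) * (2 * ν + (k + 1))) * iteratedDeriv k (inftyFn μ G) 0 := by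
  rw [funext (inftyFn_of_lineFn_eq_neg_deriv h), iteratedDeriv_fun_neg, 
    iteratedDeriv_dOp_zero ν (contDiff_inftyFn μ G.2.2)]
  ring

end Translation

/-! ### The Jacquet integral at zero of a derivative -/

section Anomaly

variable {μ ν : ℂ}

theorem hasDerivAt_tPoly (f : ℝ → ℂ) (M : ℕ) (u : ℝ) :
    HasDerivAt (tPoly f M) (∑ k ∈ Finset.range M,
      iteratedDeriv k f 0 / (k.factorial : ℂ) * (k * (u : ℂ) ^ (k - 1))) u := by
  unfold tPoly
  refine HasDerivAt.fun_sum fun k _ => HasDerivAt.const_mul _ ?_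
  exact (hasDerivAt_pow k (u : ℂ)).comp_ofReal

/-- `dOp` raises degrees by exactly one, so it is compatible with truncation: degree below M for G
corresponds to degree below M + 1 for F. -/
theorem tPoly_succ_of_lineFn_eq_neg_deriv {F G : PS μ ν}
    (h : ∀ x, lineFn F x = -deriv (lineFn G) x) (M : ℕ) (u : ℝ) :
    tPoly (inftyFn μ F) (M + 1) u = -dOp ν (tPoly (inftyFn μ G) M) u := by
  rw [dOp, (hasDerivAt_tPoly _ M u).deriv, tPoly, Finset.sum_range_succ',
    jet_zero_of_lineFn_eq_neg_deriv h, tPoly, Finset.mul_sum, Finset.mul_sum,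
    ← Finset.sum_add_distrib, ← Finset.sum_neg_distrib, zero_div, zero_mul, add_zero]
  refine Finset.sum_congr rfl fun k _ => ?_
  rw [jet_succ_of_lineFn_eq_neg_deriv h, Nat.factorial_succ]
  have h1 : (u : ℂ) ^ 2 * (k * (u : ℂ) ^ (k - 1)) = k * (u : ℂ) ^ (k + 1) := by
    cases k with
    | zero => simp
    | succ k => rw [Nat.add_sub_cancel]; ring
  have h2 : (k.factorial : ℂ) ≠ 0 := by exact_mod_cast k.factorial_ne_zero
  have h3 : (k : ℂ) + 1 ≠ 0 := by exact_mod_cast k.succ_ne_zero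
  rw [mul_left_comm _ (_ / _), h1]
  push_cast
  field_simp
  ring

/-- The twist of the Taylor remainder at `0`. -/
def twRem (μ ν : ℂ) (f : ℝ → ℂ) (M : ℕ) : ℝ → ℂ := tw μ ν fun u => f u - tPoly f M u

theorem differentiable_sub_tPoly {f : ℝ → ℂ} (hf : ContDiff ℝ ∞ f) (M : ℕ) :
    Differentiable ℝ fun u => f u - tPoly f M u := fun u =>
  ((hf.differentiable (by simp)) u).fun_sub (hasDerivAt_tPoly f M u).differentiableAt

/-- On |x| ≥ 1 the regularised integrand has an explicit primitive, the twisted Taylor remainder of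
G, because `dOp` commutes with the regularisation. -/
theorem hasDerivAt_twRem {F G : PS μ ν} (h : ∀ x, lineFn F x = -deriv (lineFn G) x) (M : ℕ)
    {x : ℝ} (hx : 1 ≤ |x|) :
    HasDerivAt (twRem μ ν (inftyFn μ G) M) (-regFn μ ν (M + 1) F x) x := by
  have hG := contDiff_inftyFn μ G.2.2
  have hx0 : x ≠ 0 := by rintro rfl; norm_num at hx
  have h1 := hasDerivAt_tw μ ν (differentiable_sub_tPoly hG M) hx0
  refine h1.congr_deriv ?_
  rw [regFn, lineFn_eq_tw F.2.1 hx0, ← tw_sub, ← neg_one_mul, ← tw_const_mul]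
  refine tw_congr μ ν fun _ => ?_
  rw [tCut, if_pos (abs_inv_le_one hx), tPoly_succ_of_lineFn_eq_neg_deriv h,
    inftyFn_of_lineFn_eq_neg_deriv h, dOp, dOp, dOp,
    (((hG.differentiable (by simp)) _).hasDerivAt.fun_sub
      (hasDerivAt_tPoly (inftyFn μ G) M _).differentiableAt.hasDerivAt).deriv]
  ring

theorem tendsto_twRem {f : ℝ → ℂ} (hf : ContDiff ℝ ∞ f) {M : ℕ} (hM : ν ∈ halfPl (M + 1)) :
    Tendsto (twRem μ ν f M) (comap (fun x => |x|) atTop) (𝓝 0) := by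
  obtain ⟨C, hC, hC'⟩ := exists_bound_iteratedDeriv hf M 1
  have hM' : 0 < 2 * ν.re + 1 + M := by
    simp only [halfPl, Set.mem_ofPred_eq] at hM
    push_cast at hM
    linarith
  have h1 : Tendsto (fun x : ℝ => sgnBound μ * C * |x| ^ (-(2 * ν.re + 1 + M)))
      (comap (fun x => |x|) atTop) (𝓝 0) := by
    rw [← mul_zero (sgnBound μ * C)]
    exact (((tendsto_rpow_neg_atTop hM').comp tendsto_comap)).const_mul _
  refine squeeze_zero_norm' ?_ h1
  filter_upwards [tendsto_comap.eventually_ge_atTop 1] with x hx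
  have hx0 : x ≠ 0 := by rintro rfl; norm_num at hx
  refine (norm_tw_le μ ν _ hx0).trans ?_
  rw [← pow_inv_mul_rpow hx0, mul_assoc]
  refine mul_le_mul_of_nonneg_left ?_ (sgnBound_pos μ).le
  rw [mul_left_comm]
  exact mul_le_mul_of_nonneg_left (norm_sub_tPoly_le hf hC' (abs_inv_le_one hx)) (by positivity)

/-- All three pieces are computed by primitives: `lineFn G` on [-1, 1] and `twRem` on the two ends,
where it tends to 0. The values of `lineFn G` at ±1 cancel, leaving the twisted Taylor polynomial of
G at ±1, whose j-th terms combine to c_{j+1}. -/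
theorem integral_regFn_of_lineFn_eq_neg_deriv {F G : PS μ ν}
    (h : ∀ x, lineFn F x = -deriv (lineFn G) x) {M : ℕ} (hM : ν ∈ halfPl (M + 1)) :
    ∫ x, regFn μ ν (M + 1) F x = ∑ j ∈ Finset.range M,
      iteratedDeriv j (inftyFn μ G) 0 / (j.factorial : ℂ) * cConst μ (j + 1) := by
  have hi := integrable_regFn F hM
  have hG := contDiff_inftyFn μ G.2.2
  have hl := contDiff_lineFn G.2.2
  have ht := tendsto_twRem (μ := μ) hG hM
  have h1 : ∫ x in Set.Ioi (1 : ℝ), -regFn μ ν (M + 1) F x = 0 - twRem μ ν (inftyFn μ G) M 1 := by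
    refine integral_Ioi_of_hasDerivAt_of_tendsto' (fun x hx => hasDerivAt_twRem h M ?_)
      hi.neg.integrableOn (ht.mono_left ?_)
    · exact (Set.mem_Ici.1 hx).trans (le_abs_self x)
    · exact tendsto_iff_comap.1 tendsto_abs_atTop_atTop
  have h2 : ∫ x in Set.Iic (-1 : ℝ), -regFn μ ν (M + 1) F x
      = twRem μ ν (inftyFn μ G) M (-1) - 0 := by
    refine integral_Iic_of_hasDerivAt_of_tendsto' (fun x hx => hasDerivAt_twRem h M ?_)
      hi.neg.integrableOn (ht.mono_left ?_)
    · have := Set.mem_Iic.1 hx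
      exact (by linarith : (1 : ℝ) ≤ -x).trans (neg_le_abs x)
    · exact tendsto_iff_comap.1 tendsto_abs_atBot_atTop
  have h3 : ∫ x in (-1 : ℝ)..1, regFn μ ν (M + 1) F x = lineFn G (-1) - lineFn G 1 := by
    have e : ∫ x in (-1 : ℝ)..1, regFn μ ν (M + 1) F x
        = ∫ x in (-1 : ℝ)..1, -deriv (lineFn G) x := by
      -- The endpoint x = 1 is discarded since the cut polynomial is still present at |u| = 1; the
      -- endpoint -1 is not in the half-open interval.
      refine intervalIntegral.integral_congr_ae ?_
      have : {(1 : ℝ)}ᶜ ∈ ae (volume : Measure ℝ) := compl_mem_ae_iff.2 (by simp)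
      filter_upwards [this] with x hx1 hx
      rw [Set.uIoc_of_le (by norm_num)] at hx
      rw [regFn_of_abs_lt_one F (M + 1) (abs_lt.2 ⟨hx.1, lt_of_le_of_ne hx.2 hx1⟩), h]
    rw [e, intervalIntegral.integral_neg, intervalIntegral.integral_deriv_eq_sub
      (fun x _ => (hl.differentiable (by simp)) x)
      ((contDiff_infty_iff_deriv.1 hl).2.continuous.intervalIntegrable _ _)]
    ring
  rw [integral_neg] at h1 h2
  have h4 : ∫ x, regFn μ ν (M + 1) F x = (∫ x in Set.Iic (-1 : ℝ), regFn μ ν (M + 1) F x)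
      + ((∫ x in (-1 : ℝ)..1, regFn μ ν (M + 1) F x) + ∫ x in Set.Ioi (1 : ℝ), regFn μ ν (M + 1) F x) := by
    rw [intervalIntegral.integral_interval_add_Ioi hi.integrableOn hi.integrableOn,
      intervalIntegral.integral_Iic_add_Ioi hi.integrableOn hi.integrableOn]
  have e1 : ∀ x, x ≠ 0 → twRem μ ν (inftyFn μ G) M x
      = lineFn G x - tw μ ν (tPoly (inftyFn μ G) M) x := fun x hx => by
    rw [twRem, tw_sub, lineFn_eq_tw G.2.1 hx]
  have h5 := neg_eq_iff_eq_neg.1 h1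
  have h6 := neg_eq_iff_eq_neg.1 h2
  rw [h4, h3, h5, h6, e1 1 one_ne_zero, e1 (-1) (by norm_num), tw_of_pos μ ν _ one_pos,
    tw_of_neg μ ν _ one_pos]
  simp only [Complex.ofReal_one, Complex.one_cpow, one_mul, tPoly, Finset.mul_sum]
  rw [show ∀ a b c d : ℂ, -(a - b - 0) + (a - c + -(0 - (c - d))) = b - d from
    fun a b c d => by ring, ← Finset.sum_sub_distrib]
  refine Finset.sum_congr rfl fun j _ => ?_
  rw [cConst]
  push_cast
  norm_num
  ring

/-- The value of the Jacquet integral at zero on an image of `E₊`. -/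
theorem jacquet_zero_of_lineFn_eq_neg_deriv {F G : PS μ ν}
    (h : ∀ x, lineFn F x = -deriv (lineFn G) x) {M : ℕ} (hM : ν ∈ halfPl (M + 1)) :
    jacquet μ ν 0 F = ∑ j ∈ Finset.range M, if 2 * ν + (j + 1) = 0 then
      iteratedDeriv j (inftyFn μ G) 0 / (j.factorial : ℂ) * cConst μ (j + 1) else 0 := by
  rw [jacquet_zero F hM, integral_regFn_of_lineFn_eq_neg_deriv h hM, Finset.sum_range_succ',
    jet_zero_of_lineFn_eq_neg_deriv h, zero_div, mul_zero, zero_div, add_zero,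
    ← Finset.sum_add_distrib]
  refine Finset.sum_congr rfl fun j _ => ?_
  rw [jet_succ_of_lineFn_eq_neg_deriv h, Nat.factorial_succ]
  have h2 : (j.factorial : ℂ) ≠ 0 := by exact_mod_cast j.factorial_ne_zero
  have h3 : (j : ℂ) + 1 ≠ 0 := by exact_mod_cast j.succ_ne_zero
  -- If 2ν + j + 1 = 0, the pole term is absent and the boundary term survives; otherwise the factor
  -- 2ν + j + 1 cancels the denominator and the two terms annihilate each other.
  split_ifs with h4
  · rw [h4]; simp
  · push_cast
    field_simp
    ring

/-- Writing (-1)^n = e^{nπi} and -1 = e^{πi}, the vanishing becomes an equality of exponentials,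
equivalent to μ - (n+1) being an even integer. Replacing n by -2ν changes this quantity only by 2n.
-/
theorem cConst_eq_zero_iff (μ ν : ℂ) (n : ℕ) (hn : -2 * ν = n) :
    cConst μ n = 0 ↔ ∃ k : ℤ, μ - 2 * ν - 1 = 2 * k := by
  have h0 := Complex.exp_ne_zero (-(Real.pi * Complex.I * μ / 2))
  have hpi : (Real.pi * Complex.I : ℂ) ≠ 0 :=
    mul_ne_zero (by exact_mod_cast Real.pi_ne_zero) Complex.I_ne_zero
  have h1 : (-1 : ℂ) ^ n = Complex.exp (n * (Real.pi * Complex.I)) := by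
    rw [Complex.exp_nat_mul, Complex.exp_pi_mul_I]
  have h2 : cConst μ n = Complex.exp (Real.pi * Complex.I * μ / 2)
      - Complex.exp ((n + 1) * (Real.pi * Complex.I) - Real.pi * Complex.I * μ / 2) := by
    rw [cConst, h1, sub_eq_add_neg _ (_ / _), Complex.exp_add, add_mul, one_mul, Complex.exp_add,
      Complex.exp_pi_mul_I]
    ring
  rw [h2, sub_eq_zero, Complex.exp_eq_exp_iff_exists_int]
  constructor
  · rintro ⟨k, hk⟩
    -- From μ = n + 1 + 2k and -2ν = n one gets μ - 2ν - 1 = 2(k + n).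
    refine ⟨k + n, ?_⟩
    have h3 : (Real.pi * Complex.I : ℂ) * (μ - (n + 1) - 2 * k) = 0 := by
      linear_combination hk
    have h4 := (mul_eq_zero.1 h3).resolve_left hpi
    push_cast
    linear_combination h4 + hn
  · rintro ⟨k, hk⟩
    refine ⟨k - n, ?_⟩
    push_cast
    linear_combination (Real.pi * Complex.I : ℂ) * (hk - hn)

end Anomaly

/-! ### Behaviour of Jacquet integrals and jets under translation -/

section Equivariance

variable {μ ν : ℂ}

theorem jacquet_act_of_ne_zero (t : ℝ) (F : PS μ ν) {l : ℝ} (hl : l ≠ 0) :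
    jacquet μ ν l (PS.act (uT t) F) = eChar t l * jacquet μ ν l F := by
  obtain ⟨N, hN⟩ := exists_mem_halfPl ν
  rw [jacquet_of_ne_zero _ hN hl, jacquet_of_ne_zero _ hN hl, mul_left_comm]
  congr 1
  have h : ∀ x, iteratedDeriv N (lineFn (PS.act (uT t) F : PS μ ν)) x * eChar x l
      = eChar t l * (iteratedDeriv N (lineFn F) (x - t) * eChar (x - t) l) := by
    intro x
    have h1 : eChar x l = eChar t l * eChar (x - t) l := by
      simp only [eChar]
      rw [← Complex.exp_add]
      congr 1
      push_cast
      ring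
    rw [funext (lineFn_act t F), iteratedDeriv_comp_sub_const, h1]
    ring
  rw [integral_congr_ae (Eventually.of_forall h), integral_const_mul,
    integral_sub_right_eq_self (fun x => iteratedDeriv N (lineFn F) x * eChar x l) t]

theorem jet_sub (F G : PS μ ν) (k : ℕ) :
    iteratedDeriv k (inftyFn μ ((F - G : PS μ ν) : Gtilde → ℂ)) 0
      = iteratedDeriv k (inftyFn μ F) 0 - iteratedDeriv k (inftyFn μ G) 0 := by
  have := jet_add (F - G) G k
  rw [sub_add_cancel] at this
  rw [this, add_sub_cancel_right]

/-- Translations act unipotently on the jets at infinity: the change in order j + 1 is a multiple of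
an average of the jets of order j of the translates. If all jets below k vanish, they stay zero and
the k-th jet is invariant. -/
theorem jet_act_of_vanish {F : PS μ ν} {k : ℕ}
    (hF : ∀ j < k, iteratedDeriv j (inftyFn μ F) 0 = 0) (t : ℝ) {j : ℕ} (hj : j ≤ k) :
    iteratedDeriv j (inftyFn μ (PS.act (uT t) F : PS μ ν)) 0
      = iteratedDeriv j (inftyFn μ F) 0 := by
  rw [← sub_eq_zero, ← jet_sub]
  induction j generalizing t with
  | zero => exact jet_zero_of_lineFn_eq_neg_deriv (deriv_lineFn_translateInt t F)
  | succ j ih =>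
    rw [jet_succ_of_lineFn_eq_neg_deriv (deriv_lineFn_translateInt t F), jet_translateInt]
    have : ∀ τ, iteratedDeriv j (inftyFn μ (PS.act (uT τ) F : PS μ ν)) 0 = 0 := fun τ => by
      have := ih τ (by omega)
      rwa [jet_sub, hF j (by omega), sub_zero] at this
    simp [this]

theorem jet_translateInt_of_vanish {F : PS μ ν} {k : ℕ}
    (hF : ∀ j < k, iteratedDeriv j (inftyFn μ F) 0 = 0) (t : ℝ) {j : ℕ} (hj : j ≤ k) :
    iteratedDeriv j (inftyFn μ (translateInt t F)) 0 = t * iteratedDeriv j (inftyFn μ F) 0 := by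
  rw [jet_translateInt]
  simp [jet_act_of_vanish hF _ hj]

end Equivariance

/-! ### Functions with prescribed order of vanishing at infinity -/

section Order

theorem iteratedDeriv_pow_mul {g : ℝ → ℂ} (hg : ContDiff ℝ ∞ g) (k : ℕ) :
    (∀ j < k, iteratedDeriv j (fun u : ℝ => (u : ℂ) ^ k * g u) 0 = 0) ∧
      iteratedDeriv k (fun u : ℝ => (u : ℂ) ^ k * g u) 0 = k.factorial * g 0 := by
  have hi : ContDiff ℝ ∞ fun u : ℝ => (u : ℂ) := Complex.ofRealCLM.contDiff
  induction k with
  | zero => simp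
  | succ k ih =>
    have h : (fun u : ℝ => (u : ℂ) ^ (k + 1) * g u)
        = fun u : ℝ => (u : ℂ) * ((u : ℂ) ^ k * g u) := by
      funext u; ring
    have h1 := iteratedDeriv_id_mul ((hi.pow k).mul hg)
    rw [h]
    refine ⟨fun j hj => ?_, ?_⟩
    · cases j with
      | zero => simp
      | succ j => rw [h1, ih.1 j (by omega)]; simp
    · rw [h1, ih.2, Nat.factorial_succ]
      push_cast
      ring

variable (μ ν : ℂ)

/-- The function `ũ(x) ã(eˢ) k̃(θ) ↦ e^{s(ν+1/2)} e^{iμθ} sin(2θ)^k`. -/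
def sinVec (k : ℕ) (q : Gtilde) : ℂ :=
  Complex.exp (((coords q).2.1 : ℂ) * (ν + 1 / 2)) * Complex.exp (Complex.I * μ * (q.θ : ℂ))
    * (Real.sin (2 * q.θ) : ℂ) ^ k

theorem isSmooth_sinVec (k : ℕ) : IsSmooth (sinVec μ ν k) := by
  unfold IsSmooth sinVec
  simp only [coords_chart, chart_theta]
  have h1 : ContDiff ℝ ∞ fun p : ℝ × ℝ × ℝ => (p.2.1 : ℂ) :=
    Complex.ofRealCLM.contDiff.comp (contDiff_fst.comp contDiff_snd)
  have h2 : ContDiff ℝ ∞ fun p : ℝ × ℝ × ℝ => (p.2.2 : ℂ) :=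
    Complex.ofRealCLM.contDiff.comp (contDiff_snd.comp contDiff_snd)
  have h3 : ContDiff ℝ ∞ fun p : ℝ × ℝ × ℝ => ((Real.sin (2 * p.2.2) : ℝ) : ℂ) :=
    Complex.ofRealCLM.contDiff.comp
      (show ContDiff ℝ ∞ fun p : ℝ × ℝ × ℝ => Real.sin (2 * p.2.2) by fun_prop)
  exact ((h1.mul contDiff_const).cexp.mul (contDiff_const.mul h2).cexp).mul (h3.pow k)

/-- The factor sin(2θ)^k is π-periodic in θ and independent of x and s, so it does not disturb the
transformation law carried by the exponentials. -/
theorem law_sinVec (k : ℕ) : Law μ ν (sinVec μ ν k) := by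
  intro x y hy m g
  have hpos : 0 < ((g.g • UpperHalfPlane.I : UpperHalfPlane) : ℂ).im := UpperHalfPlane.im_pos _
  have hθ : (uT x * aT y hy * kT (m * Real.pi) * g).θ = g.θ + m * Real.pi := by
    rw [mul_assoc _ _ g, kT_int_pi_mul, ← mul_assoc, kT_mul_theta, mul_assoc, Gtilde.mul_theta,
      Gtilde.mul_theta, Gtilde.corr_eq, Gtilde.corr_eq]
    simp [uT, aT, J_uM, J_aM]
  have hs : (((uT x * aT y hy * kT (m * Real.pi) * g).g • UpperHalfPlane.I : UpperHalfPlane) : ℂ).im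
      = y * ((g.g • UpperHalfPlane.I : UpperHalfPlane) : ℂ).im := by
    rw [mul_assoc _ _ g, kT_int_pi_mul, ← mul_assoc, mul_kT_smul, mul_assoc, Gtilde.mul_g,
      Gtilde.mul_g, mul_smul, mul_smul]
    simp only [uT, aT]
    rw [uM_smul, aM_smul]
    simp
  have h1 : Real.sin (2 * (g.θ + m * Real.pi)) = Real.sin (2 * g.θ) := by
    rw [show 2 * (g.θ + m * Real.pi) = 2 * g.θ + m * (2 * Real.pi) by ring]
    exact Real.sin_add_int_mul_two_pi _ m
  have hy0 : (y : ℂ) ≠ 0 := by exact_mod_cast hy.ne'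
  simp only [sinVec, coords]
  rw [hθ, hs, h1, Real.log_mul hy.ne' hpos.ne', Complex.cpow_def_of_ne_zero hy0,
    ← Complex.ofReal_log hy.le]
  push_cast
  rw [add_mul (Real.log y : ℂ), Complex.exp_add, mul_add (Complex.I * μ), Complex.exp_add,
    show Complex.I * μ * (m * Real.pi) = Real.pi * m * Complex.I * μ by ring]
  ring

/-- The angle of `ubT u` is -arg(1 + ui), and the double angle formula applies. The point is the
simple zero at u = 0 with a smooth cofactor without zeros. -/
theorem sin_two_theta_ubT (u : ℝ) : Real.sin (2 * (ubT u).θ) = u * (-2 * (1 + u ^ 2)⁻¹) := by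
  have h0 : (1 : ℂ) + u * Complex.I ≠ 0 := fun h => by
    have := congrArg Complex.re h
    simp at this
  have hn : ‖(1 : ℂ) + u * Complex.I‖ ^ 2 = 1 + u ^ 2 := by
    rw [Complex.sq_norm, Complex.normSq_apply]
    simp
    ring
  have hn0 : ‖(1 : ℂ) + u * Complex.I‖ ≠ 0 := by simpa using h0
  rw [ubT_theta, Real.sin_two_mul, Real.sin_neg, Real.cos_neg, Complex.sin_arg,
    Complex.cos_arg h0, ← hn]
  simp
  field_simp

/-- Each factor sin(2θ) contributes one simple zero at infinity, so `sinVec μ ν k` vanishes there to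
order exactly k. These test vectors show that the jets are linearly independent functionals. -/
theorem exists_jet_order (k : ℕ) : ∃ F : PS μ ν,
    (∀ j < k, iteratedDeriv j (inftyFn μ F) 0 = 0) ∧ iteratedDeriv k (inftyFn μ F) 0 ≠ 0 := by
  have h0 := contDiff_inftyFn μ (isSmooth_sinVec μ ν 0)
  have hr : ContDiff ℝ ∞ fun u : ℝ => ((-2 * (1 + u ^ 2)⁻¹ : ℝ) : ℂ) :=
    Complex.ofRealCLM.contDiff.comp (contDiff_const.mul
      ((contDiff_const.add (contDiff_id.pow 2)).inv fun u => by simp only [id]; positivity))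
  have h : inftyFn μ (sinVec μ ν k) = fun u : ℝ => (u : ℂ) ^ k
      * (((-2 * (1 + u ^ 2)⁻¹ : ℝ) : ℂ) ^ k * inftyFn μ (sinVec μ ν 0) u) := by
    funext u
    simp only [inftyFn, sinVec, sin_two_theta_ubT, pow_zero, mul_one]
    push_cast
    ring
  obtain ⟨h1, h2⟩ := iteratedDeriv_pow_mul ((hr.pow k).mul h0) k
  refine ⟨⟨sinVec μ ν k, law_sinVec μ ν k, isSmooth_sinVec μ ν k⟩, ?_, ?_⟩
  · change ∀ j < k, iteratedDeriv j (inftyFn μ (sinVec μ ν k)) 0 = 0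
    rw [h]; exact h1
  · change iteratedDeriv k (inftyFn μ (sinVec μ ν k)) 0 ≠ 0
    rw [h, h2]
    refine mul_ne_zero (by exact_mod_cast k.factorial_ne_zero) (mul_ne_zero (by simp) ?_)
    simp [inftyFn, sinVec, Complex.exp_ne_zero]

end Order

/-! ### Invariance under the dual lattice -/

section Invariance

variable {μ ν : ℂ} {L : ShiftedLattice} {α : L.carrier → ℂ} {β : ℕ →₀ ℂ}

theorem ShiftedLattice.omega_eq_eChar {l t : ℝ} (hl : l ∈ L.carrier) (ht : t ∈ L.dual) :
    L.omega t = eChar t l := by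
  rw [L.omega_eq hl ht, eChar]
  congr 1
  ring

theorem ShiftedLattice.omega_eq_one {t : ℝ} (h0 : (0 : ℝ) ∈ L.carrier) (ht : t ∈ L.dual) :
    L.omega t = 1 := by
  rw [L.omega_eq_eChar h0 ht, eChar_zero_right]

theorem ShiftedLattice.inv_mem_dual {u₁ u₂ : ℝ} (h2 : u₂ ≠ 0)
    (h : L.carrier = Set.range fun n : ℤ => u₁ + u₂ * n) : u₂⁻¹ ∈ L.dual := by
  intro l₁ h₁ l₂ h₂
  rw [h] at h₁ h₂
  obtain ⟨n₁, rfl⟩ := h₁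
  obtain ⟨n₂, rfl⟩ := h₂
  refine ⟨n₁ - n₂, ?_⟩
  push_cast
  field_simp
  ring

/-- The coefficients of the functional `λ(ρ(ũ(t)) F - F)` with respect to the jets at infinity of
`∫₀ᵗ ρ(ũ(τ)) F dτ`, if `0 ∈ L` and `t` is in the dual lattice. -/
def jumpCoeff (μ ν a : ℂ) (β : ℕ →₀ ℂ) (j : ℕ) : ℂ :=
  (if 2 * ν + (j + 1) = 0 then a * (cConst μ (j + 1) / (j.factorial : ℂ)) else 0)
    - β (j + 1) * ((-1) ^ (j + 1) * ((j + 1) * (2 * ν + (j + 1))))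

/-- The two contributions never compete: when 2ν + j + 1 = 0 the term with β drops out, otherwise
the anomaly of 𝒥_0 is absent. Hence α(0) and β are constrained separately. -/
theorem jumpCoeff_eq_zero_iff (μ ν a : ℂ) (β : ℕ →₀ ℂ) (j : ℕ) : jumpCoeff μ ν a β j = 0 ↔
    (2 * ν + (j + 1) = 0 → a * cConst μ (j + 1) = 0) ∧ (2 * ν + (j + 1) ≠ 0 → β (j + 1) = 0) := by
  have h1 : (j.factorial : ℂ) ≠ 0 := by exact_mod_cast j.factorial_ne_zero
  have h2 : (j : ℂ) + 1 ≠ 0 := by exact_mod_cast j.succ_ne_zero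
  by_cases h : 2 * ν + (j + 1) = 0
  · simp [jumpCoeff, h, h1]
  · simp [jumpCoeff, h, h2]

theorem lambdaDist_sub (hα : α ∈ L.polyGrowth) (F G : PS μ ν) :
    lambdaDist μ ν L α β (F - G) = lambdaDist μ ν L α β F - lambdaDist μ ν L α β G :=
  (lambdaDist_mem_distributions hα β).1.map_sub F G

/-- As 0 ∈ L the character is trivial, and λ is evaluated on ρ(ũ(t))F - F, the E₊-image of the
averaged vector. All 𝒥_l with l ≠ 0 vanish on it, 𝒥_0 leaves its anomaly, and the jets shift by one,
the jet of order 0 being zero. -/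
theorem lambdaDist_act_sub (hα : α ∈ L.polyGrowth) (h0 : (0 : ℝ) ∈ L.carrier) {t : ℝ}
    (ht : t ∈ L.dual) {M : ℕ} (hM : ν ∈ halfPl (M + 1)) (hβ : β.support ⊆ Finset.range (M + 1))
    (F : PS μ ν) :
    lambdaDist μ ν L α β (PS.act (uT t) F) - L.omega t * lambdaDist μ ν L α β F
      = ∑ j ∈ Finset.range M, jumpCoeff μ ν (α ⟨0, h0⟩) β j
        * iteratedDeriv j (inftyFn μ (translateInt t F)) 0 := by
  have hd := deriv_lineFn_translateInt t F
  rw [L.omega_eq_one h0 ht, one_mul, ← lambdaDist_sub hα, lambdaDist,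
    tsum_eq_single ⟨0, h0⟩, jacquet_zero_of_lineFn_eq_neg_deriv hd hM,
    Finsupp.sum_of_support_subset _ hβ _ (by simp), Finset.sum_range_succ', deltaInfty_eq 0,
    jet_zero_of_lineFn_eq_neg_deriv hd, mul_zero, mul_zero, add_zero, Finset.mul_sum,
    ← Finset.sum_add_distrib]
  · refine Finset.sum_congr rfl fun j _ => ?_
    rw [deltaInfty_eq, jet_succ_of_lineFn_eq_neg_deriv hd, jumpCoeff]
    split_ifs <;> ring
  · rintro ⟨l, hl⟩ hne
    have hl0 : l ≠ 0 := fun h => hne (Subtype.ext h)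
    have h1 : jacquet μ ν l (PS.act (uT t) F - F) = 0 := by
      have h2 := jacquet_add l (PS.act (uT t) F - F) F
      rw [sub_add_cancel, jacquet_act_of_ne_zero t F hl0, ← L.omega_eq_eChar hl ht,
        L.omega_eq_one h0 ht, one_mul] at h2
      linear_combination -h2
    rw [h1, mul_zero]

theorem lambdaDist_act_sub_of_zero_notMem (h0 : (0 : ℝ) ∉ L.carrier) {t : ℝ}
    (ht : t ∈ L.dual) (F : PS μ ν) :
    lambdaDist μ ν L α β (PS.act (uT t) F) - L.omega t * lambdaDist μ ν L α β F
      = β.sum fun m b => b * ((-1) ^ m * (iteratedDeriv m (inftyFn μ (PS.act (uT t) F : PS μ ν)) 0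
          - L.omega t * iteratedDeriv m (inftyFn μ F) 0)) := by
  have h1 : ∀ l : L.carrier, α l * jacquet μ ν l (PS.act (uT t) F)
      = L.omega t * (α l * jacquet μ ν l F) := by
    rintro ⟨l, hl⟩
    have hl0 : l ≠ 0 := by rintro rfl; exact h0 hl
    rw [jacquet_act_of_ne_zero t F hl0, L.omega_eq_eChar hl ht]
    ring
  rw [lambdaDist, lambdaDist, funext h1, tsum_mul_left, mul_add, add_sub_add_left_eq_sub,
    Finsupp.mul_sum]
  simp only [Finsupp.sum, ← Finset.sum_sub_distrib, deltaInfty_eq]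
  exact Finset.sum_congr rfl fun m _ => by ring

/-- A linear combination of jets vanishing on all translation averages is trivial. -/
theorem eq_zero_of_sum_jet_translateInt {t : ℝ} (ht : t ≠ 0) {M : ℕ} {γ : ℕ → ℂ}
    (h : ∀ F : PS μ ν, ∑ j ∈ Finset.range M,
      γ j * iteratedDeriv j (inftyFn μ (translateInt t F)) 0 = 0) : ∀ j < M, γ j = 0 := by
  classical
  by_contra! hne
  set S := (Finset.range M).filter fun j => γ j ≠ 0
  have hS : S.Nonempty := by
    obtain ⟨j, h1, h2⟩ := hne
    exact ⟨j, Finset.mem_filter.2 ⟨Finset.mem_range.2 h1, h2⟩⟩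
  obtain ⟨hk1, hk2⟩ := Finset.mem_filter.1 (S.max'_mem hS)
  set k := S.max' hS
  -- Here k is the largest index with nonzero coefficient. A vector vanishing to order k kills all
  -- lower jets, so only the k-th term remains, and averaging multiplies its jet by t ≠ 0.
  obtain ⟨F, hF1, hF2⟩ := exists_jet_order μ ν k
  have h1 := h F
  rw [Finset.sum_eq_single_of_mem k hk1, jet_translateInt_of_vanish hF1 t le_rfl] at h1
  · have ht' : (t : ℂ) ≠ 0 := by exact_mod_cast ht
    exact mul_ne_zero hk2 (mul_ne_zero ht' hF2) h1
  · intro j hj hjk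
    rcases lt_or_gt_of_ne hjk with hlt | hgt
    · rw [jet_translateInt_of_vanish hF1 t hlt.le, hF1 j hlt]; simp
    · have : γ j = 0 := by
        by_contra hc
        exact absurd (S.le_max' j (Finset.mem_filter.2 ⟨hj, hc⟩)) (not_le.2 hgt)
      rw [this, zero_mul]

theorem exists_truncation (ν : ℂ) (β : ℕ →₀ ℂ) (j : ℕ) :
    ∃ M, j < M ∧ ν ∈ halfPl (M + 1) ∧ β.support ⊆ Finset.range (M + 1) := by
  obtain ⟨N, hN⟩ := exists_mem_halfPl ν
  refine ⟨N + (j + 1) + β.support.sup id, by omega, halfPl_mono (by omega) hN, fun m hm => ?_⟩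
  have : m ≤ β.support.sup id := Finset.le_sup (f := id) hm
  rw [Finset.mem_range]
  omega

theorem mem_invariantDist_iff_of_zero_mem (hα : α ∈ L.polyGrowth) (h0 : (0 : ℝ) ∈ L.carrier) :
    lambdaDist μ ν L α β ∈ invariantDist μ ν L ↔ ∀ j, jumpCoeff μ ν (α ⟨0, h0⟩) β j = 0 := by
  constructor
  · rintro ⟨-, h⟩ j
    obtain ⟨u₁, u₂, h2, hL⟩ := L.exists_eq
    have ht := L.inv_mem_dual h2 hL
    obtain ⟨M, hj, hM, hβ⟩ := exists_truncation ν β j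
    refine eq_zero_of_sum_jet_translateInt (μ := μ) (ν := ν) (inv_ne_zero h2) (fun F => ?_) j hj
    rw [← lambdaDist_act_sub hα h0 ht hM hβ F, h _ ht F, sub_self]
  · refine fun h => ⟨lambdaDist_mem_distributions hα β, fun t ht F => ?_⟩
    obtain ⟨M, -, hM, hβ⟩ := exists_truncation ν β 0
    rw [← sub_eq_zero, lambdaDist_act_sub hα h0 ht hM hβ F]
    exact Finset.sum_eq_zero fun j _ => by rw [h, zero_mul]

/-- All 𝒥_l with l ∈ L are equivariant, so only the jets can obstruct. Their leading part is
translation invariant, which is incompatible with a nontrivial character. -/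
theorem mem_invariantDist_iff_of_zero_notMem (hα : α ∈ L.polyGrowth)
    (h0 : (0 : ℝ) ∉ L.carrier) :
    lambdaDist μ ν L α β ∈ invariantDist μ ν L ↔ β = 0 := by
  constructor
  · rintro ⟨-, h⟩
    by_contra hne
    obtain ⟨u₁, u₂, h2, hL⟩ := L.exists_eq
    have ht := L.inv_mem_dual h2 hL
    have hS : β.support.Nonempty := Finsupp.support_nonempty_iff.2 hne
    have hk := β.support.max'_mem hS
    set k := β.support.max' hS
    obtain ⟨F, hF1, hF2⟩ := exists_jet_order μ ν k
    have h1 := lambdaDist_act_sub_of_zero_notMem (α := α) (β := β) h0 ht F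
    rw [h _ ht F, sub_self, Finsupp.sum, Finset.sum_eq_single_of_mem k hk,
      jet_act_of_vanish hF1 _ le_rfl] at h1
    -- If ω_L(1/u₂) = e^{2πi u₁/u₂} were 1, then u₁ would be an integral multiple of u₂ and 0 would
    -- belong to L.
    · have hω : L.omega u₂⁻¹ ≠ 1 := by
        have hu : u₁ ∈ L.carrier := by rw [hL]; exact ⟨0, by simp⟩
        rw [L.omega_eq hu ht]
        intro hc
        obtain ⟨n, hn⟩ := Complex.exp_eq_one_iff.1 hc
        apply h0
        rw [hL]
        refine ⟨-n, ?_⟩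
        have h3 : (2 * Real.pi * Complex.I : ℂ) * (u₁ * (u₂⁻¹ : ℝ) - n) = 0 := by
          linear_combination hn
        have h4 := (mul_eq_zero.1 h3).resolve_left Complex.two_pi_I_ne_zero
        have h5 : u₁ * u₂⁻¹ - n = 0 := by exact_mod_cast h4
        have h6 : u₁ = u₂ * n := by
          field_simp at h5
          linarith
        dsimp only
        push_cast
        rw [h6]; ring
      have h3 : β k * ((-1) ^ k * (1 - L.omega u₂⁻¹) * iteratedDeriv k (inftyFn μ F) 0) = 0 := by
        rw [h1]; ring
      exact mul_ne_zero (Finsupp.mem_support_iff.1 hk) (mul_ne_zero (mul_ne_zero (by simp)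
        (sub_ne_zero.2 hω.symm)) hF2) h3
    · intro m hm hmk
      have hlt : m < k := lt_of_le_of_ne (β.support.le_max' m hm) hmk
      rw [jet_act_of_vanish hF1 _ hlt.le, hF1 m hlt]
      simp
  · rintro rfl
    refine ⟨lambdaDist_mem_distributions hα 0, fun t ht F => ?_⟩
    rw [← sub_eq_zero, lambdaDist_act_sub_of_zero_notMem h0 ht F, Finsupp.sum_zero_index]

/-- The index j of the equations corresponds to m = j + 1 in β. Hence β(0) is free, β(m) with m ≥ 1
must vanish unless m = -2ν, and for m = -2ν the condition is α(0) = 0 unless c_m = 0. -/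
theorem jumpCoeff_eq_zero_iff_mem (hα : α ∈ L.polyGrowth) (h0 : (0 : ℝ) ∈ L.carrier) :
    (∀ j, jumpCoeff μ ν (α ⟨0, h0⟩) β j = 0) ↔
      α ∈ L.polyGrowthZero μ ν ∧ β ∈ finSuppOn (L.expSet ν) := by
  have key : ∀ j : ℕ, 2 * ν + (j + 1) = 0 ↔ -2 * ν = ((j + 1 : ℕ) : ℂ) := fun j => by
    push_cast
    constructor <;> intro h <;> linear_combination -h
  simp only [jumpCoeff_eq_zero_iff, ne_eq, key]
  constructor
  · refine fun h => ⟨⟨hα, ?_⟩, fun m hm => ?_⟩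
    · rintro h0' ⟨n, hn, hn'⟩ hk
      obtain ⟨j, rfl⟩ := Nat.exists_eq_succ_of_ne_zero hn.ne'
      rw [← cConst_eq_zero_iff μ ν (j + 1) hn'] at hk
      exact (mul_eq_zero.1 ((h j).1 hn')).resolve_right hk
    · obtain ⟨h1, h2⟩ := not_or.1 fun h' => hm ⟨h0, h'⟩
      obtain ⟨j, rfl⟩ := Nat.exists_eq_succ_of_ne_zero h1
      exact (h j).2 fun h' => h2 h'.symm
  · rintro ⟨⟨-, h1⟩, h2⟩ j
    refine ⟨fun hj => ?_, fun hj => h2 _ ?_⟩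
    · by_cases hk : ∃ k : ℤ, μ - 2 * ν - 1 = 2 * k
      · rw [(cConst_eq_zero_iff μ ν (j + 1) hj).2 hk, mul_zero]
      · rw [h1 h0 ⟨j + 1, j.succ_pos, hj⟩ hk, zero_mul]
    · rintro ⟨-, h | h⟩
      · exact absurd h j.succ_ne_zero
      · exact hj h.symm

end Invariance

end AutoDist

end

theorem mainTheorem7 (L : AutoDist.ShiftedLattice) (μ ν : ℂ) (α : L.carrier → ℂ)
    (hα : α ∈ L.polyGrowth) (β : ℕ →₀ ℂ) :
    (∀ F : AutoDist.PS μ ν,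
      Summable fun l : L.carrier => α l * AutoDist.jacquet μ ν l F) ∧
    (AutoDist.lambdaDist μ ν L α β ∈ AutoDist.invariantDist μ ν L ↔
      α ∈ L.polyGrowthZero μ ν ∧ β ∈ AutoDist.finSuppOn (L.expSet ν)) := by
  refine ⟨AutoDist.summable_expansion hα, ?_⟩
  by_cases h0 : (0 : ℝ) ∈ L.carrier
  · rw [AutoDist.mem_invariantDist_iff_of_zero_mem hα h0,
      AutoDist.jumpCoeff_eq_zero_iff_mem hα h0]
  -- For 0 ∉ L the condition on α is vacuous and S_ν(L) is empty, so the right-hand side says β = 0.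
  · rw [AutoDist.mem_invariantDist_iff_of_zero_notMem hα h0]
    constructor
    · rintro rfl
      exact ⟨⟨hα, fun h => absurd h h0⟩, fun _ _ => rfl⟩
    · exact fun h => Finsupp.ext fun m => h.2 m fun hm => h0 hm.1
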